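/- Let $\kappa$ be a field of characteristic $0$ and let $\mathcal A$ be a $\kappa$-linear tensor category, i.e. a symmetric monoidal category which is additive, pseudo-abelian (all idempotents split) and $\kappa$-linear, such that $\otimes$ is $\kappa$-bilinear. The symmetric group $S_n$ acts on $X^{\otimes n}$ for every object $X$ of $\mathcal A$, and one puts $$\operatorname{Sym}^n(X)=\operatorname{im}\Big(\frac1{n!}\sum_{\sigma\in S_n}\sigma\Big),\qquad \operatorname{Alt}^n(X)=\operatorname{im}\Big(\frac1{n!}\sum_{\sigma\in S_n}\operatorname{sign}(\sigma)\,\sigma\Big).$$ Let $K_0(\mathcal A)$ be the free abelian group on the isomorphism classes $[X]$ of objects of $\mathcal A$ modulo the relations $[X\oplus Y]=[X]+[Y]$, with the commutative ring structure induced by $\otimes$. A $\lambda$-structure on a commutative ring $R$ is a family of maps $\lambda^r:R\to R$ $(r\ge 0)$ with $\lambda^0(a)=1$, $\lambda^1(a)=a$ and $\lambda^r(a+b)=\sum_{i+j=r}\lambda^i(a)\lambda^j(b)$; put $\lambda_t(a)=1+\sum_{r\ge1}\lambda^r(a)t^r$. The opposite $\lambda$-structure $\sigma^r$ is defined by $1+\sum_{r\ge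 1}\sigma^r(a)t^r=\lambda_{-t}(a)^{-1}$. Let $P_n(\sigma_1,\dots,\sigma_n;s_1,\dots,s_n)$ and $P_{n,r}(\sigma_1,\dots,\sigma_{rn})$ be the integral polynomials which, when the $\sigma_i$ and $s_i$ are the elementary symmetric polynomials in $\xi_1,\dots,\xi_N$ and in $x_1,\dots,x_N$, are the coefficient of $t^n$ in $\prod_{i,j}(1+\xi_ix_jt)$ (with $N\ge n$) and in $\prod_{i_1<\dots<i_r}(1+\xi_{i_1}\cdots\xi_{i_r}t)$ (with $N\ge rn$), respectively. The $\lambda$-structure is special if $\lambda_t$ is a homomorphism of $\lambda$-rings from $R$ to $1+tR[[t]]$, i.e. if $\lambda_t(1)=1+t$, and for all $a,b\in R$ and $n,m,r\ge 0$ $$\lambda^n(ab)=P_n(\lambda^1(a),\dots,\lambda^n(a);\lambda^1(b),\dots,\lambda^n(b)),\qquad \lambda^m(\lambda^r(a))=P_{m,r}(\lambda^1(a),\dots,\lambda^{rm}(a)).$$ Then there is a unique $\lambda$-structure on $K_0(\mathcal A)$ with $\lambda^n([X])=[\operatorname{Alt}^n(X)]$ for all $n\ge0$ and all objects $X$. It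 is special, and its opposite $\lambda$-structure satisfies $\sigma^n([X])=[\operatorname{Sym}^n(X)]$ for all $n\ge 0$ and all $X$. Moreover, writing $\operatorname{Alt}^n$ and $\operatorname{Sym}^n$ for the operations $\lambda^n$ and $\sigma^n$ on $K_0(\mathcal A)$, for all objects $X,Y$ with classes $x=[X]$, $y=[Y]$ and all $m,n\ge 0$: $$\operatorname{Sym}^m(\operatorname{Sym}^n(x))=P_{m,n}(\operatorname{Sym}^1(x),\dots,\operatorname{Sym}^{mn}(x))\quad\text{if $n$ is odd},$$ $$\operatorname{Alt}^m(\operatorname{Sym}^n(x))=P_{m,n}(\operatorname{Sym}^1(x),\dots,\operatorname{Sym}^{mn}(x))\quad\text{if $n$ is even},$$ $$\operatorname{Alt}^n(xy)=P_n(\operatorname{Sym}^1(x),\dots,\operatorname{Sym}^n(x);\operatorname{Sym}^1(y),\dots,\operatorname{Sym}^n(y)),$$ $$\operatorname{Sym}^n(xy)=P_n(\operatorname{Sym}^1(x),\dots,\operatorname{Sym}^n(x);\operatorname{Alt}^1(y),\dots,\operatorname{Alt}^n(y))=P_n(\operatorname{Alt}^1(x),\dots,\operatorname{Alt}^n(x);\operatorname{Sym}^1(y),\dots,\operatorname{Sym}^n(y)).$$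 -/

import Mathlib

open CategoryTheory MonoidalCategory Equiv

universe w v u

namespace LambdaK0

/-! ### Universal polynomials -/

section Polynomials

open MvPolynomial

theorem univP_exists (n : ℕ) : ∃ P : MvPolynomial (Fin n ⊕ Fin n) ℤ,
    aeval (Sum.elim
      (fun i : Fin n => rename Sum.inl (esymm (Fin n) ℤ (i + 1)))
      (fun j : Fin n => rename Sum.inr (esymm (Fin n) ℤ (j + 1)))) P =
    (∏ i : Fin n, ∏ j : Fin n, (1 + Polynomial.C (X (Sum.inl i) * X (Sum.inr j)) * Polynomial.X :
      Polynomial (MvPolynomial (Fin n ⊕ Fin n) ℤ))).coeff n := by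
  classical
  let S := MvPolynomial (Fin n) ℤ
  let W := MvPolynomial (Fin n ⊕ Fin n) ℤ
  -- the product over `j` expanded, with formal variables in place of the elementary symmetric
  -- polynomials in the second group of variables
  let F : MvPolynomial (Fin n) S := (∏ i : Fin n, (1 + ∑ j : Fin n,
    Polynomial.C (C (X j) * X i ^ (j.val + 1)) * Polynomial.X ^ (j.val + 1) :
      Polynomial (MvPolynomial (Fin n) S))).coeff n
  have hF : F ∈ symmetricSubalgebra (Fin n) S := by
    rw [mem_symmetricSubalgebra]
    intro e
    change (rename e : _ →ₐ[S] _).toRingHom _ = _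
    simp only [F]
    rw [← Polynomial.coeff_map, Polynomial.map_prod]
    congr 1
    refine Fintype.prod_equiv e _ _ fun i => ?_
    simp [Polynomial.map_sum]
  obtain ⟨G, hG⟩ := esymmAlgHom_surjective (σ := Fin n) S (n := n) (by simp) ⟨F, hF⟩
  have hG' : aeval (fun i : Fin n => esymm (Fin n) S (i + 1)) G = F := by
    have := congrArg Subtype.val hG
    rwa [esymmAlgHom_apply] at this
  let φ : S →ₐ[ℤ] W := aeval fun j : Fin n => rename Sum.inr (esymm (Fin n) ℤ (j + 1))
  have hφX : ∀ j, φ (X j) = rename Sum.inr (esymm (Fin n) ℤ (j + 1)) := fun j => aeval_X _ _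
  let Φ : MvPolynomial (Fin n) S →+* W := eval₂Hom φ.toRingHom fun i => X (Sum.inl i)
  have hΦC : ∀ s, Φ (C s) = φ s := fun s => by simp [Φ]
  have hΦX : ∀ i, Φ (X i) = X (Sum.inl i) := fun i => by simp [Φ]
  have hΦe : ∀ k, Φ (esymm (Fin n) S k) = rename Sum.inl (esymm (Fin n) ℤ k) := fun k => by
    simp [esymm, hΦX]
  refine ⟨(sumAlgEquiv ℤ (Fin n) (Fin n)).symm G, ?_⟩
  have h1 : ∀ G : MvPolynomial (Fin n) S,
      aeval (Sum.elim
      (fun i : Fin n => rename Sum.inl (esymm (Fin n) ℤ (i + 1)))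
      (fun j : Fin n => (rename Sum.inr (esymm (Fin n) ℤ (j + 1)) : W)))
      ((sumAlgEquiv ℤ (Fin n) (Fin n)).symm G) =
      Φ (aeval (fun i : Fin n => esymm (Fin n) S (i + 1)) G) := by
    intro G
    obtain ⟨Q, rfl⟩ := (sumAlgEquiv ℤ (Fin n) (Fin n)).surjective G
    rw [AlgEquiv.symm_apply_apply]
    induction Q using MvPolynomial.induction_on with
    | C a => simp
    | add p q hp hq => simp only [map_add, hp, hq]
    | mul_X p i hp =>
      simp only [map_mul, hp]
      congr 1
      rcases i with i | i
      · simp [hΦe]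
      · simp [hΦC, hφX, MvPolynomial.algebraMap_eq]
  rw [h1, hG']
  simp only [F]
  rw [← Polynomial.coeff_map, Polynomial.map_prod]
  congr 1
  refine Finset.prod_congr rfl fun i _ => ?_
  rw [Finset.prod_one_add, Finset.sum_powerset, Finset.card_univ, Fintype.card_fin,
    Finset.sum_range_succ']
  simp only [Polynomial.map_add, Polynomial.map_one, Polynomial.map_sum, Polynomial.map_mul,
    Polynomial.map_C, Polynomial.map_pow, Polynomial.map_X, map_mul, map_pow, hΦC, hΦX, hφX,
    Finset.powersetCard_zero, Finset.sum_singleton, Finset.prod_empty]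
  rw [add_comm, ← Fin.sum_univ_eq_sum_range
    (fun k => ∑ t ∈ Finset.powersetCard (k + 1) (Finset.univ : Finset (Fin n)),
      ∏ j ∈ t, Polynomial.C (X (Sum.inl i) : W) * Polynomial.C (X (Sum.inr j)) * Polynomial.X) n]
  congr 1
  refine Finset.sum_congr rfl fun k _ => ?_
  simp only [esymm, map_sum, map_prod, rename_X,
    Finset.sum_mul]
  refine Finset.sum_congr rfl fun t ht => ?_
  rw [Finset.prod_mul_distrib, Finset.prod_mul_distrib, Finset.prod_const, Finset.prod_const,
    (Finset.mem_powersetCard.mp ht).2]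
  ring

/-- The universal polynomial `P_n(σ_1, …, σ_n; s_1, …, s_n)`, where the variable `inl i` stands for
`σ_{i+1}` and the variable `inr j` for `s_{j+1}`: when elementary symmetric polynomials in
`ξ_1, …, ξ_N` resp. `x_1, …, x_N` are substituted, it becomes the coefficient of `t^n` in
`∏_{i,j} (1 + ξ_i x_j t)`. This determines `P_n` for every `N ≥ n`, independently of `N`; here
`N = n`. -/
noncomputable def univP (n : ℕ) : MvPolynomial (Fin n ⊕ Fin n) ℤ := (univP_exists n).choose

theorem univPP_exists (n r : ℕ) : ∃ P : MvPolynomial (Fin (r * n)) ℤ,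
    aeval (fun i : Fin (r * n) => esymm (Fin (r * n)) ℤ (i + 1)) P =
    (∏ s ∈ Finset.powersetCard r (Finset.univ : Finset (Fin (r * n))),
      (1 + Polynomial.C (∏ i ∈ s, X i) * Polynomial.X :
      Polynomial (MvPolynomial (Fin (r * n)) ℤ))).coeff n := by
  have hs : (∏ s ∈ Finset.powersetCard r (Finset.univ : Finset (Fin (r * n))),
      (1 + Polynomial.C (∏ i ∈ s, X i) * Polynomial.X :
      Polynomial (MvPolynomial (Fin (r * n)) ℤ))).coeff n ∈
      symmetricSubalgebra (Fin (r * n)) ℤ := by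
    rw [mem_symmetricSubalgebra]
    intro e
    change (rename e : _ →ₐ[ℤ] _).toRingHom _ = _
    rw [← Polynomial.coeff_map, Polynomial.map_prod]
    congr 1
    refine Finset.prod_bij' (fun s _ => s.map e.toEmbedding) (fun s _ => s.map e.symm.toEmbedding)
      ?_ ?_ ?_ ?_ ?_
    · intro s hs; simpa using hs
    · intro s hs; simpa using hs
    · intro s _; ext; simp
    · intro s _; ext; simp
    · intro s _; simp [Finset.prod_map, Polynomial.map_prod]
  obtain ⟨P, hP⟩ := esymmAlgHom_surjective (σ := Fin (r * n)) ℤ (n := r * n) (by simp) ⟨_, hs⟩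
  refine ⟨P, ?_⟩
  have := congrArg Subtype.val hP
  rw [esymmAlgHom_apply] at this
  exact this

/-- The universal polynomial `P_{n,r}(σ_1, …, σ_{rn})`, where the variable `i` stands for `σ_{i+1}`:
when elementary symmetric polynomials in `ξ_1, …, ξ_N` are substituted, it becomes the coefficient
of `t^n` in `∏_{i_1 < … < i_r} (1 + ξ_{i_1} ⋯ ξ_{i_r} t)`. This determines `P_{n,r}` for every
`N ≥ rn`, independently of `N`; here `N = rn`. -/
noncomputable def univPP (n r : ℕ) : MvPolynomial (Fin (r * n)) ℤ := (univPP_exists n r).choose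

/-- The value `P_n(a_1, …, a_n; b_1, …, b_n)`. -/
noncomputable def evalP {R : Type*} [CommRing R] (n : ℕ) (a b : ℕ → R) : R :=
  aeval (Sum.elim (fun i : Fin n => a (i + 1)) (fun j : Fin n => b (j + 1))) (univP n)

/-- The value `P_{n,r}(a_1, …, a_{rn})`. -/
noncomputable def evalPP {R : Type*} [CommRing R] (n r : ℕ) (a : ℕ → R) : R :=
  aeval (fun i : Fin (r * n) => a (i + 1)) (univPP n r)

end Polynomials

/-! ### `λ`-rings -/

/-- A `λ`-structure on a commutative ring `R`, making it a `λ`-ring. -/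
@[ext] structure LambdaStructure (R : Type*) [CommRing R] where
  /-- the operations `λ^r` -/
  lam : ℕ → R → R
  lam_zero : ∀ a, lam 0 a = 1
  lam_one : ∀ a, lam 1 a = a
  lam_add : ∀ r a b, lam r (a + b) =
    ∑ ij ∈ Finset.HasAntidiagonal.antidiagonal r, lam ij.1 a * lam ij.2 b

namespace LambdaStructure

variable {R : Type*} [CommRing R] (L : LambdaStructure R)

/-- The power series `λ_t(a) = 1 + ∑_{r ≥ 1} λ^r(a) t^r`. -/
def lamT (a : R) : PowerSeries R := PowerSeries.mk fun r => L.lam r a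

theorem lamT_add (a b : R) : L.lamT (a + b) = L.lamT a * L.lamT b := by
  ext r
  simp [lamT, PowerSeries.coeff_mul, L.lam_add]

/-- The power series `σ_t(a) = (1 + ∑_{r ≥ 1} λ^r(a) (-t)^r)⁻¹`. -/
noncomputable def oppT (a : R) : PowerSeries R :=
  PowerSeries.invOfUnit (PowerSeries.rescale (-1) (L.lamT a)) 1

theorem oppT_spec (a : R) : PowerSeries.rescale (-1) (L.lamT a) * L.oppT a = 1 := by
  refine PowerSeries.mul_invOfUnit _ _ ?_
  rw [← PowerSeries.coeff_zero_eq_constantCoeff_apply, PowerSeries.coeff_rescale]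
  simp [lamT, L.lam_zero]

theorem oppT_add (a b : R) : L.oppT (a + b) = L.oppT a * L.oppT b := by
  have h1 := L.oppT_spec a
  have h2 := L.oppT_spec b
  have h3 := L.oppT_spec (a + b)
  rw [L.lamT_add, map_mul] at h3
  linear_combination (L.oppT a * L.oppT b) * h3 - L.oppT (a + b) * (h1 *
    (PowerSeries.rescale (-1) (L.lamT b) * L.oppT b) + h2)

theorem coeff_zero_oppT (a : R) : PowerSeries.coeff 0 (L.oppT a) = 1 := by
  have h := congrArg (PowerSeries.coeff 0) (L.oppT_spec a)
  rw [PowerSeries.coeff_mul] at h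
  simp only [Finset.Nat.antidiagonal_zero, Finset.sum_singleton, PowerSeries.coeff_rescale, lamT,
    PowerSeries.coeff_mk, L.lam_zero, pow_zero, one_mul, PowerSeries.coeff_zero_one] at h
  exact h

theorem coeff_one_oppT (a : R) : PowerSeries.coeff 1 (L.oppT a) = a := by
  have h := congrArg (PowerSeries.coeff 1) (L.oppT_spec a)
  rw [PowerSeries.coeff_mul, Finset.Nat.sum_antidiagonal_succ] at h
  simp only [Finset.Nat.antidiagonal_zero, Finset.sum_singleton, PowerSeries.coeff_rescale, lamT,
    PowerSeries.coeff_mk, L.lam_zero, L.lam_one, zero_add, coeff_zero_oppT] at h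
  simp [PowerSeries.coeff_one] at h
  linear_combination h

/-- The opposite `λ`-structure, with operations the coefficients of `σ_t`. -/
noncomputable def opposite : LambdaStructure R where
  lam r a := PowerSeries.coeff r (L.oppT a)
  lam_zero a := L.coeff_zero_oppT a
  lam_one a := L.coeff_one_oppT a
  lam_add r a b := by rw [L.oppT_add, PowerSeries.coeff_mul]

end LambdaStructure

/-- The product `f ∘ g` of the ring `1 + t R[[t]]` (whose addition is the product of power series);
its neutral element is `1 + t`. -/
noncomputable def circ {R : Type*} [CommRing R] (f g : PowerSeries R) : PowerSeries R :=
  PowerSeries.mk fun n => evalP n (fun k => PowerSeries.coeff k f) (fun k => PowerSeries.coeff k g)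

/-- The operations `Λ^r` of the `λ`-ring `1 + t R[[t]]`. -/
noncomputable def bigLam {R : Type*} [CommRing R] (r : ℕ) (f : PowerSeries R) : PowerSeries R :=
  PowerSeries.mk fun n => evalPP n r (fun k => PowerSeries.coeff k f)

/-- A `λ`-structure is special if `λ_t : R → 1 + t R[[t]]` is a homomorphism of `λ`-rings, i.e.
compatible with units, products and `λ`-operations; it is always compatible with the additions
(`lamT_add`). -/
structure LambdaStructure.IsSpecial {R : Type*} [CommRing R] (L : LambdaStructure R) : Prop where
  map_one : L.lamT 1 = 1 + PowerSeries.X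
  map_mul : ∀ a b, L.lamT (a * b) = circ (L.lamT a) (L.lamT b)
  map_lam : ∀ r a, L.lamT (L.lam r a) = bigLam r (L.lamT a)

/-! ### The action of the symmetric group on a tensor power -/

section Permutations

variable {C : Type u} [Category.{v} C] [MonoidalCategory C]

/-- The tensor power `X^{⊗ n}`, bracketed to the right. -/
@[reducible] def tpow (X : C) : ℕ → C
  | 0 => 𝟙_ C
  | n + 1 => X ⊗ tpow X n

variable [SymmetricCategory C]

/-- The symmetry exchanging the first two factors of `X ⊗ (X ⊗ T)`. -/
def swapFirst (X T : C) : X ⊗ (X ⊗ T) ⟶ X ⊗ (X ⊗ T) :=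
  (α_ X X T).inv ≫ (β_ X X).hom ▷ T ≫ (α_ X X T).hom

/-- The symmetry exchanging the first two factors of `X^{⊗ (n + 1)}`; the identity if `n = 0`. -/
def adjFirst (X : C) : (n : ℕ) → (tpow X (n + 1) ⟶ tpow X (n + 1))
  | 0 => 𝟙 _
  | n + 1 => swapFirst X (tpow X n)

/-- The symmetry exchanging the adjacent factors number `i` and `i + 1` (counted from `0`)
of `X^{⊗ n}`; the identity if `n ≤ i + 1`. -/
def adj (X : C) : (n i : ℕ) → (tpow X n ⟶ tpow X n)
  | 0, _ => 𝟙 _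
  | n + 1, 0 => adjFirst X n
  | n + 1, i + 1 => X ◁ adj X n i

/-- The symmetry of `X^{⊗ (n + 1)}` moving the first factor to position `p` (counted from `0`) and
keeping the order of the other factors. -/
def cyc (X : C) : (n p : ℕ) → (tpow X (n + 1) ⟶ tpow X (n + 1))
  | _, 0 => 𝟙 _
  | 0, _ + 1 => 𝟙 _
  | n + 1, p + 1 => swapFirst X (tpow X n) ≫ X ◁ cyc X n p

/-- The permutation of `Fin n` that a permutation `σ` of `Fin (n + 1)` induces on the positions
different from `0` in the source and from `σ 0` in the target. -/
def tailPerm {n : ℕ} (σ : Perm (Fin (n + 1))) : Perm (Fin n) :=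
  (Perm.decomposeFin ((σ 0).cycleRange * σ)).2

/-- The symmetry of `X^{⊗ n}` that moves the factor at position `j` to position `σ j`. -/
def permMor (X : C) : (n : ℕ) → Perm (Fin n) → (tpow X n ⟶ tpow X n)
  | 0, _ => 𝟙 _
  | n + 1, σ => X ◁ permMor X n (tailPerm σ) ≫ cyc X n (σ 0)

theorem apply_succ_eq {n : ℕ} (σ : Perm (Fin (n + 1))) (j : Fin n) :
    σ j.succ = (σ 0).succAbove (tailPerm σ j) := by
  have h1 := Perm.decomposeFin.symm_apply_apply ((σ 0).cycleRange * σ)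
  have h0 : (Perm.decomposeFin ((σ 0).cycleRange * σ)).1 = 0 := by
    have := Perm.decomposeFin_symm_apply_zero (Perm.decomposeFin ((σ 0).cycleRange * σ)).1
      (Perm.decomposeFin ((σ 0).cycleRange * σ)).2
    rw [Prod.mk.eta, h1] at this
    rw [← this]; simp
  have h2 := Perm.decomposeFin_symm_apply_succ (Perm.decomposeFin ((σ 0).cycleRange * σ)).2
    (Perm.decomposeFin ((σ 0).cycleRange * σ)).1 j
  rw [Prod.mk.eta, h1, h0] at h2
  simp only [Perm.mul_apply, swap_self, refl_apply] at h2
  rw [← Fin.cycleRange_symm_succ, Equiv.eq_symm_apply, h2]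
  rfl

theorem tailPerm_eq {n : ℕ} (σ : Perm (Fin (n + 1))) (e : Perm (Fin n))
    (h : ∀ j, σ j.succ = (σ 0).succAbove (e j)) : tailPerm σ = e := by
  ext j
  rw [Fin.succAbove_right_injective ((apply_succ_eq σ j).symm.trans (h j))]

theorem tailPerm_one {n : ℕ} : tailPerm (1 : Perm (Fin (n + 1))) = 1 :=
  tailPerm_eq _ _ fun j => by simp

@[simp] theorem swapFirst_swapFirst (X T : C) : swapFirst X T ≫ swapFirst X T = 𝟙 _ := by
  simp [swapFirst, ← comp_whiskerRight_assoc]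

theorem swapFirst_natural (X : C) {S T : C} (f : S ⟶ T) :
    (X ◁ X ◁ f) ≫ swapFirst X T = swapFirst X S ≫ (X ◁ X ◁ f) := by
  have h : (X ⊗ X) ◁ f ≫ (β_ X X).hom ▷ T = (β_ X X).hom ▷ S ≫ (X ⊗ X) ◁ f :=
    whisker_exchange _ _
  have h1 : (X ◁ X ◁ f) = (α_ X X S).inv ≫ (X ⊗ X) ◁ f ≫ (α_ X X T).hom := by simp
  rw [h1]
  simp only [swapFirst, Category.assoc, Iso.hom_inv_id_assoc, reassoc_of% h]

theorem swapFirst_braid (X T : C) :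
    swapFirst X (X ⊗ T) ≫ X ◁ swapFirst X T ≫ swapFirst X (X ⊗ T) =
      X ◁ swapFirst X T ≫ swapFirst X (X ⊗ T) ≫ X ◁ swapFirst X T := by
  have h := congrArg (fun f => (α_ X X (X ⊗ T)).inv ≫ (α_ (X ⊗ X) X T).inv ≫ (α_ X X X).hom ▷ T ≫
    f ▷ T ≫ (α_ X X X).inv ▷ T ≫ (α_ (X ⊗ X) X T).hom ≫ (α_ X X (X ⊗ T)).hom)
    (BraidedCategory.yang_baxter X X X)
  simp only [swapFirst]
  refine Eq.trans ?_ (h.trans ?_)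
  · monoidal
  · monoidal

theorem adj_adj (X : C) : ∀ n i : ℕ, adj X n i ≫ adj X n i = 𝟙 _
  | 0, _ => by simp [adj]
  | 1, 0 => by simp [adj, adjFirst]
  | n + 2, 0 => swapFirst_swapFirst _ _
  | n + 1, i + 1 => by
    simp only [adj]
    rw [← whiskerLeft_comp, adj_adj X n i, whiskerLeft_id]

theorem cyc_adj_self (X : C) : ∀ n i : ℕ, i < n → cyc X n i ≫ adj X (n + 1) i = cyc X n (i + 1)
  | n + 1, 0, _ => by
    simp only [cyc, adj, adjFirst]
    rw [Category.id_comp]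
    erw [whiskerLeft_id, Category.comp_id]
  | n + 1, i + 1, h => by
    have := cyc_adj_self X n i (by omega)
    rw [cyc, cyc, adj, Category.assoc, ← whiskerLeft_comp, this]

theorem cyc_succ_adj (X : C) (n i : ℕ) (h : i < n) :
    cyc X n (i + 1) ≫ adj X (n + 1) i = cyc X n i := by
  rw [← cyc_adj_self X n i h, Category.assoc, adj_adj, Category.comp_id]

theorem cyc_adj_lt (X : C) : ∀ n p j : ℕ, p ≤ j →
    cyc X n p ≫ adj X (n + 1) (j + 1) = X ◁ adj X n j ≫ cyc X n p
  | n, 0, j, _ => by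
    cases n <;> simp only [cyc, adj] <;> erw [Category.id_comp, Category.comp_id]
  | 0, p + 1, j, _ => by
    simp only [cyc, adj]; erw [Category.id_comp, Category.comp_id]
  | n + 1, p + 1, 0, h => by omega
  | n + 1, p + 1, j + 1, h => by
    have := cyc_adj_lt X n p j (by omega)
    have h1 : adj X (n + 1 + 1) (j + 1 + 1) = X ◁ adj X (n + 1) (j + 1) := rfl
    have h2 : adj X (n + 1) (j + 1) = X ◁ adj X n j := rfl
    rw [cyc, h1, Category.assoc, ← whiskerLeft_comp, this, whiskerLeft_comp, h2]
    exact (reassoc_of% (swapFirst_natural X (adj X n j))) _ |>.symm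

theorem cyc_adj_gt (X : C) : ∀ n p i : ℕ, i + 2 ≤ p → p ≤ n →
    cyc X n p ≫ adj X (n + 1) i = X ◁ adj X n i ≫ cyc X n p
  | n + 2, p + 2, 0, _, _ => by
    have h1 : adj X (n + 2 + 1) 0 = swapFirst X (tpow X (n + 1)) := rfl
    have h2 : adj X (n + 2) 0 = swapFirst X (tpow X n) := rfl
    have h3 := swapFirst_natural X (cyc X n p)
    have h4 := swapFirst_braid X (tpow X n)
    simp only [cyc, h1, h2, whiskerLeft_comp, Category.assoc]
    erw [h3]
    exact (reassoc_of% h4) _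
  | n + 1, p + 1, i + 1, h, h' => by
    have := cyc_adj_gt X n p i (by omega) (by omega)
    have h1 : adj X (n + 1 + 1) (i + 1) = X ◁ adj X (n + 1) i := rfl
    have h2 : adj X (n + 1) (i + 1) = X ◁ adj X n i := rfl
    rw [cyc, h1, Category.assoc, ← whiskerLeft_comp, this, whiskerLeft_comp, h2]
    exact (reassoc_of% (swapFirst_natural X (adj X n i))) _ |>.symm
  | 0, _, _, _, _ => by omega
  | 1, _, _, _, _ => by omega
  | _ + 2, 0, _, _, _ => by omega
  | _ + 2, 1, _, _, _ => by omega

theorem permMor_one (X : C) : ∀ n : ℕ, permMor X n 1 = 𝟙 _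
  | 0 => rfl
  | n + 1 => by
    rw [permMor, tailPerm_one, permMor_one X n]
    cases n <;> simp [cyc]

theorem permMor_swap_mul (X : C) : ∀ (n i : ℕ) (h : i + 1 < n) (σ : Perm (Fin n)),
    permMor X n (swap ⟨i, by omega⟩ ⟨i + 1, h⟩ * σ) = permMor X n σ ≫ adj X n i
  | n + 1, i, h, σ => by
    set τ : Perm (Fin (n + 1)) := swap ⟨i, by omega⟩ ⟨i + 1, h⟩ * σ with hτ
    have hσ := apply_succ_eq σ
    have hτ0 : τ 0 = swap ⟨i, by omega⟩ ⟨i + 1, h⟩ (σ 0) := rfl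
    have hτs : ∀ j : Fin n, τ j.succ =
        swap ⟨i, by omega⟩ ⟨i + 1, h⟩ ((σ 0).succAbove (tailPerm σ j)) := fun j => by
      rw [← hσ]; rfl
    generalize hp : σ 0 = p at *
    generalize tailPerm σ = e at *
    have key : ∀ (e' : Perm (Fin n)) (p' : Fin (n + 1)), τ 0 = p' →
        (∀ j, τ j.succ = p'.succAbove (e' j)) →
        permMor X (n + 1) τ = X ◁ permMor X n e' ≫ cyc X n p' := by
      intro e' p' h0 h1
      rw [permMor, tailPerm_eq τ e' (by rw [h0]; exact h1), h0]
    have hs : permMor X (n + 1) σ = X ◁ permMor X n e ≫ cyc X n p := by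
      rw [permMor, tailPerm_eq σ e (by rw [hp]; exact hσ), hp]
    rw [hs, Category.assoc]
    rcases lt_trichotomy p.val i with hlt | heq | hgt
    · obtain ⟨j, rfl⟩ : ∃ j, i = j + 1 := ⟨i - 1, by omega⟩
      rw [cyc_adj_lt X n p j (by omega), ← whiskerLeft_comp_assoc,
        ← permMor_swap_mul X n j (by omega)]
      refine key _ _ ?_ ?_
      · rw [hτ0, swap_apply_of_ne_of_ne] <;> simp [Fin.ext_iff] <;> omega
      · intro k
        rw [hτs, Perm.mul_apply]
        generalize e k = m
        simp only [swap_apply_def, Fin.succAbove, Fin.ext_iff, Fin.lt_def]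
        grind
    · rw [heq, cyc_adj_self X n i (by omega)]
      refine key e ⟨i + 1, h⟩ ?_ ?_
      · rw [hτ0, show p = ⟨i, by omega⟩ from Fin.ext heq, swap_apply_left]
      · intro k
        rw [hτs]
        generalize e k = m
        simp only [swap_apply_def, Fin.succAbove, Fin.ext_iff, Fin.lt_def]
        grind
    · rcases Nat.lt_or_ge (i + 1) p.val with hgt' | hle
      · rw [cyc_adj_gt X n p i (by omega) (by omega), ← whiskerLeft_comp_assoc,
          ← permMor_swap_mul X n i (by omega)]
        refine key _ _ ?_ ?_
        · rw [hτ0, swap_apply_of_ne_of_ne] <;> simp [Fin.ext_iff] <;> omega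
        · intro k
          rw [hτs, Perm.mul_apply]
          generalize e k = m
          simp only [swap_apply_def, Fin.succAbove, Fin.ext_iff, Fin.lt_def]
          grind
      · have hpi : p.val = i + 1 := by omega
        rw [hpi, cyc_succ_adj X n i (by omega)]
        refine key e ⟨i, Nat.lt_of_succ_lt h⟩ ?_ ?_
        · rw [hτ0, show p = ⟨i + 1, h⟩ from Fin.ext hpi]; exact swap_apply_right _ _
        · intro k
          rw [hτs]
          generalize e k = m
          simp only [swap_apply_def, Fin.succAbove, Fin.ext_iff, Fin.lt_def]
          grind

theorem permMor_swap (X : C) (n i : ℕ) (h : i + 1 < n) :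
    permMor X n (swap ⟨i, by omega⟩ ⟨i + 1, h⟩) = adj X n i := by
  simpa [permMor_one] using permMor_swap_mul X n i h 1

theorem permMor_mul (X : C) : ∀ (n : ℕ) (τ σ : Perm (Fin n)),
    permMor X n (τ * σ) = permMor X n σ ≫ permMor X n τ
  | 0, _, _ => by simp [permMor]
  | n + 1, τ, σ => by
    have hτ : τ ∈ Submonoid.closure
        (Set.range fun i : Fin n => swap i.castSucc i.succ) := by
      rw [Perm.mclosure_swap_castSucc_succ]; trivial
    induction hτ using Submonoid.closure_induction generalizing σ with
    | mem x hx =>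
      obtain ⟨i, rfl⟩ := hx
      have h1 := permMor_swap_mul X (n + 1) i (by omega) σ
      have h2 := permMor_swap X (n + 1) i (by omega)
      rw [← h2] at h1
      exact h1
    | one => simp [permMor_one]
    | mul x y _ _ hx hy => rw [mul_assoc, hx, hy, hx y, Category.assoc]

/-- The action of the symmetric group `S_n` on `X^{⊗ n}` given by the symmetry of the category. -/
def permAction (X : C) (n : ℕ) : Perm (Fin n) →* End (tpow X n) where
  toFun σ := permMor X n σ
  map_one' := permMor_one X n
  map_mul' τ σ := permMor_mul X n τ σ

end Permutations

/-! ### Symmetric and exterior powers -/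

section Powers

variable (κ : Type w) [Field κ] [CharZero κ] {A : Type u} [Category.{v} A] [Preadditive A]
  [Linear κ A] [MonoidalCategory A] [SymmetricCategory A]

/-- For a sign character `χ` of `S_n`, the endomorphism `1/n! ∑_σ χ(σ) σ` of `X^{⊗ n}`. -/
noncomputable def charProj (X : A) (n : ℕ) (χ : Perm (Fin n) →* ℤˣ) : tpow X n ⟶ tpow X n :=
  (n.factorial : κ)⁻¹ • ∑ σ : Perm (Fin n), ((χ σ : ℤ) : κ) • (permAction X n σ : tpow X n ⟶ tpow X n)

theorem charProj_idem (X : A) (n : ℕ) (χ : Perm (Fin n) →* ℤˣ) :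
    charProj κ X n χ ≫ charProj κ X n χ = charProj κ X n χ := by
  set S : tpow X n ⟶ tpow X n :=
    ∑ σ : Perm (Fin n), ((χ σ : ℤ) : κ) • (permAction X n σ : tpow X n ⟶ tpow X n) with hS
  have h1 : ∀ τ : Perm (Fin n), (permAction X n τ : tpow X n ⟶ tpow X n) ≫ S =
      ((χ τ : ℤ) : κ) • S := by
    intro τ
    rw [hS, Preadditive.comp_sum, Finset.smul_sum,
      ← Equiv.sum_comp (Equiv.mulRight τ) fun σ => ((χ τ : ℤ) : κ) • ((χ σ : ℤ) : κ) •
        (permAction X n σ : tpow X n ⟶ tpow X n)]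
    refine Finset.sum_congr rfl fun σ _ => ?_
    have h2 : (permAction X n (σ * τ) : tpow X n ⟶ tpow X n) =
      (permAction X n τ : tpow X n ⟶ tpow X n) ≫ permAction X n σ := permMor_mul X n σ τ
    have h3 : ((χ τ : ℤ) : κ) * ((χ (σ * τ) : ℤ) : κ) = ((χ σ : ℤ) : κ) := by
      have h4 : ((χ τ : ℤ)) * (χ τ : ℤ) = 1 := by
        rw [← Units.val_mul, Int.units_mul_self, Units.val_one]
      rw [map_mul, Units.val_mul, Int.cast_mul, mul_comm, mul_assoc, ← Int.cast_mul, h4]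
      simp
    rw [Linear.comp_smul, Equiv.coe_mulRight, smul_smul, h3, h2]
  have h5 : S ≫ S = (n.factorial : κ) • S := by
    conv_lhs => rw [hS, Preadditive.sum_comp]
    have h6 : ∀ τ : Perm (Fin n),
        (((χ τ : ℤ) : κ) • (permAction X n τ : tpow X n ⟶ tpow X n)) ≫ S = S := by
      intro τ
      rw [Linear.smul_comp, h1, smul_smul, ← Int.cast_mul, ← Units.val_mul, Int.units_mul_self]
      simp
    rw [Finset.sum_congr rfl fun τ _ => h6 τ, Finset.sum_const, Finset.card_univ,
      Fintype.card_perm, Fintype.card_fin, Nat.cast_smul_eq_nsmul]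
  have h7 : (n.factorial : κ) ≠ 0 := Nat.cast_ne_zero.mpr n.factorial_ne_zero
  change ((n.factorial : κ)⁻¹ • S) ≫ ((n.factorial : κ)⁻¹ • S) = (n.factorial : κ)⁻¹ • S
  rw [Linear.smul_comp, Linear.comp_smul, h5, smul_smul (n.factorial : κ)⁻¹ (n.factorial : κ), inv_mul_cancel₀ h7,
    one_smul]

variable [IsIdempotentComplete A]

/-- The image of an idempotent endomorphism (unique up to isomorphism): an object `Y` with
`i : Y ⟶ X` and `e : X ⟶ Y` such that `i ≫ e = 𝟙 Y` and `e ≫ i = p`. -/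
noncomputable def idemImage {X : A} (p : X ⟶ X) (hp : p ≫ p = p) : A :=
  (IsIdempotentComplete.idempotents_split X p hp).choose

/-- The symmetric power `Sym^n(X)`, the image of `1/n! ∑_σ σ`. -/
noncomputable def symPow (X : A) (n : ℕ) : A :=
  idemImage (charProj κ X n 1) (charProj_idem κ X n 1)

/-- The exterior power `Alt^n(X)`, the image of `1/n! ∑_σ sign(σ) σ`. -/
noncomputable def altPow (X : A) (n : ℕ) : A :=
  idemImage (charProj κ X n Perm.sign) (charProj_idem κ X n Perm.sign)

end Powers

/-! ### The Grothendieck ring -/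

section GrothendieckRing

variable (A : Type u) [Category.{v} A] [Preadditive A] [Limits.HasFiniteBiproducts A]
  [MonoidalCategory A] [SymmetricCategory A]

/-- The elements `[X ⊕ Y] - [X] - [Y]` of the free abelian group on the isomorphism classes of
objects of `A`. -/
def K0.relators : Set (FreeAbelianGroup (Skeleton A)) :=
  haveI := Limits.hasBinaryBiproducts_of_finite_biproducts A
  {z | ∃ X Y : A, z = FreeAbelianGroup.of (toSkeleton (Limits.biprod X Y)) -
    FreeAbelianGroup.of (toSkeleton X) - FreeAbelianGroup.of (toSkeleton Y)}

/-- The Grothendieck ring of `A`: the free abelian group on isomorphism classes of objects, with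
the product induced by `⊗`, modulo the relations `[X ⊕ Y] = [X] + [Y]`. If `⊗` is biadditive, the
ideal generated by the relators is the subgroup generated by them (`K0.span_relators`). -/
abbrev K0 : Type u := FreeAbelianGroup (Skeleton A) ⧸ Ideal.span (K0.relators A)

theorem K0.span_relators [MonoidalPreadditive A] :
    (Ideal.span (K0.relators A)).toAddSubgroup = AddSubgroup.closure (K0.relators A) := by
  have := Limits.hasBinaryBiproducts_of_finite_biproducts A
  have hmul : ∀ a, ∀ z ∈ AddSubgroup.closure (K0.relators A),
      a * z ∈ AddSubgroup.closure (K0.relators A) := by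
    intro a z hz
    induction hz using AddSubgroup.closure_induction with
    | zero => simp
    | add x y _ _ hx hy => rw [mul_add]; exact add_mem hx hy
    | neg x _ hx => rw [mul_neg]; exact neg_mem hx
    | mem x hx =>
      obtain ⟨X, Y, rfl⟩ := hx
      induction a using FreeAbelianGroup.induction_on with
      | zero => simp
      | add x y hx hy => rw [add_mul]; exact add_mem hx hy
      | neg x hx => rw [neg_mul]; exact neg_mem hx
      | of s =>
        obtain ⟨Z, rfl⟩ : ∃ Z : A, toSkeleton Z = s := ⟨s.out, Quotient.out_eq s⟩
        refine AddSubgroup.subset_closure ⟨Z ⊗ X, Z ⊗ Y, ?_⟩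
        have := Limits.preservesBinaryBiproducts_of_preservesBiproducts (tensorLeft Z)
        have h : toSkeleton (Z ⊗ Limits.biprod X Y) =
            toSkeleton (Limits.biprod (Z ⊗ X) (Z ⊗ Y)) :=
          Quotient.sound ⟨(tensorLeft Z).mapBiprod X Y⟩
        rw [← h]
        simp only [mul_sub, FreeAbelianGroup.of_mul_of, Skeleton.toSkeleton_tensorObj]
  apply le_antisymm
  · intro z hz
    change z ∈ Ideal.span (K0.relators A) at hz
    induction hz using Submodule.span_induction with
    | mem x hx => exact AddSubgroup.subset_closure hx
    | zero => exact zero_mem _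
    | add x y _ _ hx hy => exact add_mem hx hy
    | smul a x _ hx => exact hmul a x hx
  · rw [AddSubgroup.closure_le]
    exact fun z hz => Ideal.subset_span hz

variable {A}

/-- The class `[X]` in the Grothendieck ring. -/
noncomputable def K0.cls (X : A) : K0 A :=
  Ideal.Quotient.mk _ (FreeAbelianGroup.of (toSkeleton X))

end GrothendieckRing

end LambdaK0

open LambdaK0

/-!
The proof reduces statements about objects to identities between symmetric functions.

An idempotent `e` of the group algebra `κ[S_N]` acts on `X^{⊗ N}`, so it has a class `imCls` in
`K0 A`, namely that of the image of the action; it also has a Frobenius characteristic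
`charPoly κ D e`, a symmetric polynomial in variables indexed by `D`. The algebra `κ[S_N]` is
semisimple and `κ` has characteristic zero, so traces decide whether two families of idempotents
can be cut into pairwise equivalent pieces (`sum_map_eq_of_traceLR_eq`), and for `N ≤ |D|` the
traces are determined by the characteristic (`classSum_eq_zero`). Therefore every linear relation
between characteristics of idempotents holds between the classes of their images
(`eq_of_mem_schurPairs`). No classification of irreducible representations is needed, and it does
not matter that `κ` need not be algebraically closed.

The characteristics of the idempotents defining `Alt^n`, `Sym^n` and `Alt^m ∘ Alt^r` are the
elementary symmetric polynomial, the complete homogeneous one and the plethysm of two elementary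
ones (`charPoly_sign`, `charPoly_triv`, `charPoly_wreathElt`). This gives the Koszul relation
between exterior and symmetric powers (`sum_cls_altPow_mul_cls_symPow`) and
`[Alt^m (Alt^r X)] = P_{m,r} ([Alt^1 X], …)` (`cls_altPow_altPow`). That permuting the factors of
`(X^{⊗ r})^{⊗ m}` is the same as permuting blocks of factors of `X^{⊗ rm}` is a coherence
statement; it is proved by labelling the tensor factors by arbitrary finite sets (`Label`,
`Label.braids`, `Label.permMor_eq_map`).

Decomposing `(X ⊕ Y)^{⊗ n}` along the words in two letters gives
`[Alt^n (X ⊕ Y)] = ∑ [Alt^i X] [Alt^j Y]` (`cls_altPow_of_biprod`), so that the series of exterior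
powers extends from objects to a homomorphism from `K0 A` to `1 + t K0 A[[t]]`: the `λ`-structure
`K0.lambda`.

It is special on classes of objects with respect to the operations `λ^r` by `cls_altPow_altPow`.
The product formula for objects follows from the case `r = 2`, applied to `X`, `Y` and `X ⊕ Y`,
because `λ^2 (a + b) = λ^2 a + a b + λ^2 b`. Both formulas extend to differences of classes
(`LambdaStructure.isSpecial_of_closure`) thanks to the identities of the `λ`-ring `1 + t R[[t]]`,
which are checked after adjoining roots: if `f = ∏ (1 + ξ_i t)`, then `circ f g = ∏ g (ξ_i t)` and
`bigLam r f` has the products of `r` of the `ξ_i` as roots (`circ_rootSeries`,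
`bigLam_rootSeries`). Finally the opposite structure is `σ^n a = (-1)^n λ^n (-a)`, and the
identities that involve symmetric powers result from those of `λ` by the substitution `t ↦ -t`.
-/

set_option linter.unusedSectionVars false

namespace LambdaK0

/-! ### Idempotents of a semisimple algebra and their traces -/

section SemisimpleAlgebra

/-- A semisimple ring is von Neumann regular: split off the left ideal generated by `u`. -/
theorem exists_mul_mul_eq_self {R : Type*} [Ring R] [IsSemisimpleRing R] (u : R) :
    ∃ v, u * v * u = u := by
  obtain ⟨J, hJ⟩ := exists_isCompl (Submodule.span R {u})
  have h1 : (1 : R) ∈ Submodule.span R {u} ⊔ J := by rw [hJ.sup_eq_top]; trivial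
  obtain ⟨a, ha, b, hb, hab⟩ := Submodule.mem_sup.mp h1
  obtain ⟨v, rfl⟩ := Submodule.mem_span_singleton.mp ha
  refine ⟨v, ?_⟩
  have h2 : u * b = u - u * (v • u) := by rw [eq_sub_iff_add_eq', ← mul_add, hab, mul_one]
  have h3 : u * b ∈ Submodule.span R {u} ⊓ J := by
    refine ⟨?_, J.smul_mem u hb⟩
    rw [h2]
    exact sub_mem (Submodule.mem_span_singleton_self u)
      (Submodule.smul_mem _ u (Submodule.smul_mem _ v (Submodule.mem_span_singleton_self u)))
  rw [hJ.inf_eq_bot, Submodule.mem_bot, h2, sub_eq_zero, smul_eq_mul, ← mul_assoc] at h3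
  exact h3.symm

/-- A nonzero element `u` of a corner `e R f` yields Murray-von Neumann equivalent nonzero
idempotents `u * v ≤ e` and `v * u ≤ f`. -/
theorem exists_corner_inverse {R : Type*} [Ring R] [IsSemisimpleRing R] {e f u : R}
    (he : e * e = e) (hf : f * f = f) (heu : e * u = u) (huf : u * f = u) :
    ∃ v, f * v = v ∧ v * e = v ∧ u * v * u = u ∧ v * u * v = v := by
  obtain ⟨v, hv⟩ := exists_mul_mul_eq_self u
  have h1 : u * (f * v * e) * u = u := by
    rw [← mul_assoc u, ← mul_assoc u, huf, mul_assoc _ e, heu, hv]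
  -- `f v e` is an inner inverse of `u` lying in the corner `f R e`; the element `(f v e) u (f v e)` is
  -- moreover such that `u` is an inner inverse of it.
  refine ⟨f * v * e * u * (f * v * e), ?_, ?_, ?_, ?_⟩
  · simp only [← mul_assoc, hf]
  · simp only [mul_assoc, he]
  · calc u * (f * v * e * u * (f * v * e)) * u = (u * (f * v * e) * u) * (f * v * e) * u := by
          simp only [mul_assoc]
      _ = u := by rw [h1, h1]
  · calc f * v * e * u * (f * v * e) * u * (f * v * e * u * (f * v * e))
        = f * v * e * ((u * (f * v * e) * u) * (f * v * e) * u) * (f * v * e) := by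
          simp only [mul_assoc]
      _ = f * v * e * u * (f * v * e) := by rw [h1, h1]

variable (κ : Type*) [Field κ] {R : Type*} [Ring R] [Algebra κ R]

/-- The trace of `y ↦ x * y * z`, as a linear functional of `z`. -/
noncomputable def traceLR (x : R) : R →ₗ[κ] κ where
  toFun z := LinearMap.trace κ R (LinearMap.mulLeft κ x * LinearMap.mulRight κ z)
  map_add' a b := by
    rw [← map_add]; congr 1; ext y; simp [mul_add]
  map_smul' a b := by
    rw [RingHom.id_apply, ← map_smul]; congr 1; ext y; simp

theorem traceLR_apply (x z : R) :
    traceLR κ x z = LinearMap.trace κ R (LinearMap.mulLeft κ x * LinearMap.mulRight κ z) := rfl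

theorem traceLR_mul_comm (x u v : R) : traceLR κ x (u * v) = traceLR κ x (v * u) := by
  have h1 : LinearMap.mulLeft κ x * LinearMap.mulRight κ (u * v) =
      (LinearMap.mulLeft κ x * LinearMap.mulRight κ v) * LinearMap.mulRight κ u := by
    ext y; simp [mul_assoc]
  have h2 : LinearMap.mulLeft κ x * LinearMap.mulRight κ (v * u) =
      LinearMap.mulRight κ u * (LinearMap.mulLeft κ x * LinearMap.mulRight κ v) := by
    ext y; simp [mul_assoc]
  rw [traceLR_apply, traceLR_apply, h1, h2, LinearMap.trace_mul_comm]

/-- For idempotents `x` and `z`, the dimension of the corner `x R z`. -/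
noncomputable def cornerDim (x z : R) : ℕ :=
  Module.finrank κ (LinearMap.range (LinearMap.mulLeft κ x * LinearMap.mulRight κ z))

theorem mul_mul_ne_zero_of_cornerDim {x z : R} (h : cornerDim κ x z ≠ 0) :
    ∃ r, x * r * z ≠ 0 := by
  by_contra! h1
  apply h
  have h2 : LinearMap.mulLeft κ x * LinearMap.mulRight κ z = 0 := by
    ext y; simp [← mul_assoc, h1]
  rw [cornerDim, h2, LinearMap.range_zero, finrank_bot]

variable [FiniteDimensional κ R]

theorem traceLR_eq_cornerDim {x z : R} (hx : x * x = x) (hz : z * z = z) :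
    traceLR κ x z = cornerDim κ x z := by
  have h : IsIdempotentElem (LinearMap.mulLeft κ x * LinearMap.mulRight κ z) := by
    ext y
    simp only [Module.End.mul_apply, LinearMap.mulLeft_apply, LinearMap.mulRight_apply]
    simp only [← mul_assoc, hx]
    simp only [mul_assoc, hz]
  exact (LinearMap.IsIdempotentElem.isProj_range _ h).trace

theorem cornerDim_ne_zero {x z r : R} (h : x * r * z ≠ 0) : cornerDim κ x z ≠ 0 := by
  intro h1
  rw [cornerDim, Submodule.finrank_eq_zero, LinearMap.range_eq_bot] at h1
  apply h
  simpa [mul_assoc] using LinearMap.congr_fun h1 r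

theorem sum_cornerDim (x : R) (hx : x * x = x) (s : Multiset R) (hs : ∀ e ∈ s, e * e = e) :
    traceLR κ x s.sum = ((s.map (cornerDim κ x)).sum : ℕ) := by
  rw [map_multiset_sum, Nat.cast_multiset_sum, Multiset.map_map]
  congr 1
  exact Multiset.map_congr rfl fun e he => traceLR_eq_cornerDim κ hx (hs e he)

variable [CharZero κ]

/-- If the traces of two families of idempotents agree, then a nonzero member `e` of the first family
is linked to some member of the second: otherwise all corners `e R f` vanish, so `e R e` does. -/
theorem exists_corner_ne_zero {s t : Multiset R} (hs : ∀ e ∈ s, e * e = e)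
    (ht : ∀ f ∈ t, f * f = f) (h : ∀ x, traceLR κ x s.sum = traceLR κ x t.sum) {e : R}
    (he : e ∈ s) (he0 : e ≠ 0) : ∃ f ∈ t, ∃ r, e * r * f ≠ 0 := by
  by_contra! h1
  have h2 := h e
  rw [sum_cornerDim κ e (hs e he) s hs, sum_cornerDim κ e (hs e he) t ht, Nat.cast_inj] at h2
  have h3 : (t.map (cornerDim κ e)).sum = 0 := by
    refine Multiset.sum_eq_zero fun n hn => ?_
    obtain ⟨f, hf, rfl⟩ := Multiset.mem_map.mp hn
    by_contra h4
    obtain ⟨r, hr⟩ := mul_mul_ne_zero_of_cornerDim κ h4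
    exact hr (h1 f hf r)
  rw [h3, Multiset.sum_eq_zero_iff] at h2
  refine cornerDim_ne_zero κ (x := e) (z := e) (r := 1) ?_
    (h2 _ (Multiset.mem_map_of_mem _ he))
  rw [mul_one, hs e he]
  exact he0

/-- Over a field of characteristic zero, the trace functionals detect the class of a family of
idempotents of a semisimple algebra: an invariant `c` of idempotents that is additive and invariant
under Murray-von Neumann equivalence takes the same total value on families with the same traces.
One splits off equivalent subidempotents until nothing is left. -/
theorem sum_map_eq_of_traceLR_eq [IsSemisimpleRing R] {M : Type*} [AddCommGroup M] (c : R → M)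
    (hadd : ∀ e f, e * e = e → f * f = f → e * f = 0 → f * e = 0 → c (e + f) = c e + c f)
    (hmul : ∀ u v, u * v * u = u → v * u * v = v → c (u * v) = c (v * u))
    (s t : Multiset R) (hs : ∀ e ∈ s, e * e = e) (ht : ∀ f ∈ t, f * f = f)
    (h : ∀ x, traceLR κ x s.sum = traceLR κ x t.sum) : (s.map c).sum = (t.map c).sum := by
  -- induction on the total dimension of the left ideals generated by the first family
  induction hn : (s.map (cornerDim κ 1)).sum using Nat.strong_induction_on generalizing s t with
  | _ n ih =>
  have hc0 : c 0 = 0 := by simpa using hadd 0 0 (by simp) (by simp) (by simp) (by simp)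
  by_cases h0 : ∃ e ∈ s, e ≠ 0
  · obtain ⟨e, he, he0⟩ := h0
    obtain ⟨f, hf, r, hr⟩ := exists_corner_ne_zero κ hs ht h he he0
    have hee := hs e he
    have hff := ht f hf
    set z := e * r * f with hz
    have hez : e * z = z := by rw [hz, ← mul_assoc, ← mul_assoc, hee]
    have hzf : z * f = z := by rw [hz, mul_assoc, hff]
    -- the equivalent idempotents `z y ≤ e` and `y z ≤ f` are to be split off
    obtain ⟨y, hfy, hye, hzyz, hyzy⟩ := exists_corner_inverse hee hff hez hzf
    have hp : (z * y) * (z * y) = z * y := by rw [← mul_assoc, hzyz]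
    have hq : (y * z) * (y * z) = y * z := by rw [← mul_assoc, hyzy]
    have hep : e * (z * y) = z * y := by rw [← mul_assoc, hez]
    have hpe : (z * y) * e = z * y := by rw [mul_assoc, hye]
    have hfq : f * (y * z) = y * z := by rw [← mul_assoc, hfy]
    have hqf : (y * z) * f = y * z := by rw [mul_assoc, hzf]
    have hp0 : z * y ≠ 0 := fun h0 => hr (by rw [← hzyz, h0, zero_mul])
    have hep' : (e - z * y) * (e - z * y) = e - z * y := by
      rw [sub_mul, mul_sub, mul_sub, hee, hep, hpe, hp, sub_self, sub_zero]
    have hfq' : (f - y * z) * (f - y * z) = f - y * z := by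
      rw [sub_mul, mul_sub, mul_sub, hff, hfq, hqf, hq, sub_self, sub_zero]
    obtain ⟨s', rfl⟩ := Multiset.exists_cons_of_mem he
    obtain ⟨t', rfl⟩ := Multiset.exists_cons_of_mem hf
    have hce : c e = c (e - z * y) + c (z * y) := by
      rw [← hadd _ _ hep' hp, sub_add_cancel]
      · rw [sub_mul, hep, hp, sub_self]
      · rw [mul_sub, hpe, hp, sub_self]
    have hcf : c f = c (f - y * z) + c (y * z) := by
      rw [← hadd _ _ hfq' hq, sub_add_cancel]
      · rw [sub_mul, hfq, hq, sub_self]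
      · rw [mul_sub, hqf, hq, sub_self]
    have hdim : cornerDim κ 1 e = cornerDim κ 1 (e - z * y) + cornerDim κ 1 (z * y) := by
      have : ((cornerDim κ 1 e : ℕ) : κ) =
          ((cornerDim κ 1 (e - z * y) + cornerDim κ 1 (z * y) : ℕ) : κ) := by
        rw [Nat.cast_add, ← traceLR_eq_cornerDim κ (one_mul _) hee,
          ← traceLR_eq_cornerDim κ (one_mul _) hep', ← traceLR_eq_cornerDim κ (one_mul _) hp,
          map_sub, sub_add_cancel]
      exact_mod_cast this
    have hpos : cornerDim κ 1 (z * y) ≠ 0 :=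
      cornerDim_ne_zero κ (r := 1) (by rwa [mul_one, one_mul])
    have key := ih (((e - z * y) ::ₘ s').map (cornerDim κ 1)).sum
      (by rw [← hn]; simp only [Multiset.map_cons, Multiset.sum_cons]; omega)
      ((e - z * y) ::ₘ s') ((f - y * z) ::ₘ t')
      (by
        intro a ha
        rcases Multiset.mem_cons.mp ha with rfl | ha
        · exact hep'
        · exact hs a (Multiset.mem_cons_of_mem ha))
      (by
        intro a ha
        rcases Multiset.mem_cons.mp ha with rfl | ha
        · exact hfq'
        · exact ht a (Multiset.mem_cons_of_mem ha))
      (by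
        intro x
        have h1 := h x
        have h2 := traceLR_mul_comm κ x z y
        simp only [Multiset.sum_cons, map_add, map_sub] at h1 ⊢
        linear_combination h1 - h2)
      rfl
    simp only [Multiset.map_cons, Multiset.sum_cons] at key ⊢
    rw [hce, hcf, hmul z y hzyz hyzy]
    rw [add_right_comm, key, add_right_comm]
  · push Not at h0
    have h1 : ∀ f ∈ t, f = 0 := by
      intro f hf
      by_contra hf0
      obtain ⟨e, he, r, hr⟩ := exists_corner_ne_zero κ ht hs (fun x => (h x).symm) hf hf0
      exact hr (by rw [h0 e he, mul_zero])
    rw [Multiset.sum_eq_zero, Multiset.sum_eq_zero]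
    · intro x hx
      obtain ⟨f, hf, rfl⟩ := Multiset.mem_map.mp hx
      rw [h1 f hf, hc0]
    · intro x hx
      obtain ⟨f, hf, rfl⟩ := Multiset.mem_map.mp hx
      rw [h0 f hf, hc0]

end SemisimpleAlgebra

/-! ### Characters of elements of the group algebra of a symmetric group -/

section Characters

/-- Permutations with the same orbits are conjugate. -/
theorem isConj_of_sameCycle_iff {ι : Type*} [Fintype ι] [DecidableEq ι] {σ τ : Perm ι}
    (h : ∀ i j, σ.SameCycle i j ↔ τ.SameCycle i j) : IsConj σ τ := by
  have hsupp : ∀ ρ : Perm ι, ∀ x, x ∈ ρ.support ↔ ∃ y, ρ.SameCycle x y ∧ y ≠ x := by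
    intro ρ x
    constructor
    · intro hx
      exact ⟨ρ x, (Perm.sameCycle_apply_right.mpr (Perm.SameCycle.refl _ _)),
        Perm.mem_support.mp hx⟩
    · rintro ⟨y, hy, hne⟩
      by_contra hx
      rw [Perm.notMem_support] at hx
      exact hne (hy.eq_of_left hx).symm
  have himg : ∀ ρ : Perm ι, ρ.cycleFactorsFinset.image Perm.support =
      ρ.support.image fun x => Finset.univ.filter (ρ.SameCycle x) := by
    intro ρ
    have h1 : ∀ x ∈ ρ.support,
        (ρ.cycleOf x).support = Finset.univ.filter (ρ.SameCycle x) := by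
      intro x hx
      ext y
      rw [Perm.mem_support_cycleOf_iff, Finset.mem_filter]
      simp [hx]
    ext S
    simp only [Finset.mem_image]
    constructor
    · rintro ⟨c, hc, rfl⟩
      obtain ⟨x, hx⟩ := (Perm.mem_cycleFactorsFinset_iff.mp hc).1.nonempty_support
      have hx' : x ∈ ρ.support := Perm.mem_cycleFactorsFinset_support_le hc hx
      exact ⟨x, hx', by rw [← h1 x hx', ← Perm.cycle_is_cycleOf hx hc]⟩
    · rintro ⟨x, hx, rfl⟩
      exact ⟨ρ.cycleOf x, Perm.cycleOf_mem_cycleFactorsFinset_iff.mpr hx, h1 x hx⟩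
  have hcyc : ∀ ρ : Perm ι, ρ.cycleType =
      (ρ.cycleFactorsFinset.image Perm.support).1.map Finset.card := by
    intro ρ
    rw [Perm.cycleType_def, Finset.image_val_of_injOn, Multiset.map_map]
    intro c hc d hd hcd
    by_contra hne
    have h2 := Perm.cycleFactorsFinset_pairwise_disjoint ρ hc hd hne
    rw [Perm.disjoint_iff_disjoint_support, show c.support = d.support from hcd,
      disjoint_self, Finset.bot_eq_empty, Perm.support_eq_empty_iff] at h2
    exact (Perm.mem_cycleFactorsFinset_iff.mp hd).1.ne_one h2
  have hsup : σ.support = τ.support := by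
    ext x
    rw [hsupp, hsupp]
    simp only [h]
  rw [Perm.isConj_iff_cycleType_eq, hcyc, hcyc, himg, himg, hsup]
  simp only [h]

variable (κ : Type w) [Field κ] {ι : Type*} [Fintype ι] [DecidableEq ι]
  (D : Type*) [Fintype D] [DecidableEq D]

open MvPolynomial in
/-- The sum of the monomials of the words `w : ι → D` fixed by `σ`. It is the trace of
`σ ∘ diag(x)^{⊗ ι}` on `(κ^D)^{⊗ ι}`, i.e. the product of the power sums of the lengths of the cycles
of `σ`. -/
noncomputable def permChar (σ : Perm ι) : MvPolynomial D κ :=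
  ∑ w : ι → D with w ∘ σ = w, ∏ j, X (w j)

/-- The linear extension of `permChar` to the group algebra: the Frobenius characteristic. -/
noncomputable def charPoly : MonoidAlgebra κ (Perm ι) →ₗ[κ] MvPolynomial D κ :=
  (MonoidAlgebra.basis (Perm ι) κ).constr κ (permChar κ D)

theorem charPoly_single (σ : Perm ι) (a : κ) :
    charPoly κ D (MonoidAlgebra.single σ a) = a • permChar κ D σ := by
  have h : (MonoidAlgebra.single σ a : MonoidAlgebra κ (Perm ι)) =
      a • MonoidAlgebra.basis (Perm ι) κ σ := by
    rw [MonoidAlgebra.basis_apply]; simp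
  rw [h, map_smul, charPoly, Module.Basis.constr_basis]

theorem charPoly_of (σ : Perm ι) :
    charPoly κ D (MonoidAlgebra.of κ _ σ) = permChar κ D σ := by
  rw [MonoidAlgebra.of_apply, charPoly_single, one_smul]

theorem charPoly_apply (z : MonoidAlgebra κ (Perm ι)) :
    charPoly κ D z = ∑ σ, z.coeff σ • permChar κ D σ := by
  induction z using MonoidAlgebra.induction_on with
  | of σ =>
    rw [charPoly_of, Finset.sum_eq_single σ]
    · simp [MonoidAlgebra.of_apply]
    · intro τ _ hτ
      simp [MonoidAlgebra.of_apply, hτ.symm]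
    · simp
  | add x y hx hy => simp [hx, hy, add_smul, Finset.sum_add_distrib]
  | smul r x hx => simp [hx, Finset.smul_sum, smul_smul]

variable {D} in
/-- The permutations fixing a word. -/
def wordStab (w : ι → D) : Finset (Perm ι) := Finset.univ.filter fun σ : Perm ι => w ∘ σ = w

variable {D} in
omit [Fintype D] in
@[simp] theorem mem_wordStab {w : ι → D} {σ : Perm ι} : σ ∈ wordStab w ↔ w ∘ σ = w := by
  simp [wordStab]

variable {D} in
/-- The exponent of the monomial of a word. -/
noncomputable def content (w : ι → D) : D →₀ ℕ := ∑ j, Finsupp.single (w j) 1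

open MvPolynomial in
variable {D} in
omit [Fintype D] [DecidableEq D] [DecidableEq ι] in
theorem prod_X_eq_monomial (w : ι → D) :
    ∏ j, (X (w j) : MvPolynomial D κ) = monomial (content w) 1 := by
  rw [content, monomial_sum_one]
  rfl

variable {D} in
omit [Fintype D] [DecidableEq ι] in
theorem content_apply (w : ι → D) (d : D) : content w d = Fintype.card {j // w j = d} := by
  rw [content, Finsupp.finsetSum_apply, Fintype.card_subtype, Finset.card_filter]
  exact Finset.sum_congr rfl fun j _ => by rw [Finsupp.single_apply]

variable {D} in
omit [Fintype D] [DecidableEq ι] in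
theorem exists_perm_of_content_eq {w w' : ι → D} (h : content w = content w') :
    ∃ y : Perm ι, w' ∘ y = w := by
  have h1 : ∀ d, Nonempty ({j // w j = d} ≃ {j // w' j = d}) := fun d => by
    refine ⟨Fintype.equivOfCardEq ?_⟩
    rw [← content_apply, ← content_apply, h]
  exact ⟨Equiv.ofFiberEquiv fun d => (h1 d).some, funext fun j => Equiv.ofFiberEquiv_map _ j⟩

variable {D} in
omit [Fintype D] [DecidableEq D] [DecidableEq ι] in
theorem content_comp (w : ι → D) (y : Perm ι) : content (w ∘ y) = content w :=
  Equiv.sum_comp y fun j => Finsupp.single (w j) 1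

variable {D} in
omit [Fintype D] in
/-- The words with the same content as `w₀` are the words `w₀ ∘ y`, each arising equally often. -/
theorem sum_comp_perm {M : Type*} [AddCommMonoid M] [Fintype D] (w₀ : ι → D) (F : (ι → D) → M) :
    ∑ y : Perm ι, F (w₀ ∘ y) = (wordStab w₀).card •
      ∑ w : ι → D with content w = content w₀, F w := by
  rw [← Finset.sum_fiberwise_of_maps_to (s := Finset.univ) (g := fun y : Perm ι => w₀ ∘ y)
    (t := Finset.univ.filter fun w => content w = content w₀)
    (fun y _ => by simp [content_comp]), Finset.smul_sum]
  refine Finset.sum_congr rfl fun w hw => ?_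
  obtain ⟨y₀, rfl⟩ := exists_perm_of_content_eq (Finset.mem_filter.mp hw).2
  rw [Finset.sum_congr rfl (g := fun _ => F (w₀ ∘ y₀))
    (fun y hy => by rw [(Finset.mem_filter.mp hy).2]), Finset.sum_const]
  congr 1
  refine Finset.card_bij' (fun y _ => y * y₀⁻¹) (fun y _ => y * y₀) ?_ ?_ ?_ ?_
  · intro y hy
    simp only [Finset.mem_filter, Finset.mem_univ, true_and, mem_wordStab] at hy ⊢
    rw [Perm.coe_mul, ← Function.comp_assoc, hy, Function.comp_assoc, ← Perm.coe_mul,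
      mul_inv_cancel, Perm.coe_one, Function.comp_id]
  · intro y hy
    simp only [Finset.mem_filter, Finset.mem_univ, true_and, mem_wordStab] at hy ⊢
    rw [Perm.coe_mul, ← Function.comp_assoc, hy]
  · intro y _; simp
  · intro y _; simp

open MvPolynomial in
theorem coeff_charPoly (z : MonoidAlgebra κ (Perm ι)) (w₀ : ι → D) :
    MvPolynomial.coeff (content w₀) (charPoly κ D z) =
      ∑ w : ι → D with content w = content w₀, ∑ σ ∈ wordStab w, z.coeff σ := by
  have h1 : ∀ σ : Perm ι, MvPolynomial.coeff (content w₀) (permChar κ D σ) =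
      ∑ w : ι → D with content w = content w₀, if w ∘ σ = w then 1 else 0 := by
    intro σ
    rw [permChar, coeff_sum, Finset.sum_filter, Finset.sum_filter]
    refine Finset.sum_congr rfl fun w _ => ?_
    rw [prod_X_eq_monomial, coeff_monomial]
    split_ifs <;> rfl
  rw [charPoly_apply, coeff_sum]
  simp only [coeff_smul, h1, Finset.smul_sum]
  rw [Finset.sum_comm]
  refine Finset.sum_congr rfl fun w _ => ?_
  rw [wordStab, Finset.sum_filter]
  refine Finset.sum_congr rfl fun σ _ => ?_
  split_ifs <;> simp

/-- The class function attached to an element of the group algebra. -/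
noncomputable def classSum (z : MonoidAlgebra κ (Perm ι)) (σ : Perm ι) : κ :=
  ∑ y : Perm ι, z.coeff (y⁻¹ * σ * y)

theorem classSum_eq_of_isConj (z : MonoidAlgebra κ (Perm ι)) {σ τ : Perm ι} (h : IsConj σ τ) :
    classSum κ z σ = classSum κ z τ := by
  obtain ⟨g, rfl⟩ := isConj_iff.mp h
  rw [classSum, ← Equiv.sum_comp (Equiv.mulLeft g⁻¹)]
  refine Finset.sum_congr rfl fun y _ => ?_
  simp [mul_assoc]

variable {κ D}

/-- If the Frobenius characteristic vanishes, the class function has sum zero over the stabilizer of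
each word, i.e. over each Young subgroup. -/
theorem sum_classSum_eq_zero {z : MonoidAlgebra κ (Perm ι)} (hz : charPoly κ D z = 0)
    (w₀ : ι → D) : ∑ σ ∈ wordStab w₀, classSum κ z σ = 0 := by
  have h1 := sum_comp_perm w₀ fun w => ∑ σ ∈ wordStab w, z.coeff σ
  rw [← coeff_charPoly, hz, MvPolynomial.coeff_zero, smul_zero] at h1
  rw [← h1]
  simp only [classSum]
  rw [Finset.sum_comm]
  refine Finset.sum_congr rfl fun y _ => ?_
  refine Finset.sum_bij' (fun σ _ => y⁻¹ * σ * y) (fun σ _ => y * σ * y⁻¹) ?_ ?_ ?_ ?_ ?_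
  · intro σ hσ
    rw [mem_wordStab] at hσ ⊢
    rw [Function.comp_assoc, ← Perm.coe_mul, ← mul_assoc, ← mul_assoc, mul_inv_cancel, one_mul,
      Perm.coe_mul, ← Function.comp_assoc, hσ]
  · intro σ hσ
    rw [mem_wordStab] at hσ ⊢
    rw [Perm.coe_mul, Perm.coe_mul, ← Function.comp_assoc, ← Function.comp_assoc, hσ,
      Function.comp_assoc, ← Perm.coe_mul, mul_inv_cancel, Perm.coe_one, Function.comp_id]
  · intro σ _; simp [mul_assoc]
  · intro σ _; simp [mul_assoc]
  · intro σ _; rfl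

/-- The Frobenius characteristic in sufficiently many variables determines the class function: a
permutation `σ₀` with a nonzero value and the maximal number of orbits would contribute alone, with
its conjugates, to the sum over the Young subgroup of its orbit partition. -/
theorem classSum_eq_zero [CharZero κ] (hD : Fintype.card ι ≤ Fintype.card D)
    {z : MonoidAlgebra κ (Perm ι)} (hz : charPoly κ D z = 0) (σ : Perm ι) : classSum κ z σ = 0 := by
  classical
  by_contra hne
  -- `n σ` is the number of orbits, and `w₀` below labels the orbits of `σ₀` by distinct letters, so that
  -- every permutation fixing `w₀` has orbits contained in those of `σ₀`
  let n : Perm ι → ℕ := fun σ => Fintype.card (Quotient (Perm.SameCycle.setoid σ))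
  obtain ⟨σ₀, h₀, hmax⟩ := (Finset.univ.filter fun σ => classSum κ z σ ≠ 0).exists_max_image n
    ⟨σ, by simpa using hne⟩
  simp only [Finset.mem_filter, Finset.mem_univ, true_and] at h₀ hmax
  obtain ⟨f⟩ : Nonempty (Quotient (Perm.SameCycle.setoid σ₀) ↪ D) :=
    Function.Embedding.nonempty_of_card_le ((Fintype.card_quotient_le _).trans hD)
  let w₀ : ι → D := fun i => f (Quotient.mk _ i)
  have hw₀ : ∀ i j, w₀ i = w₀ j → σ₀.SameCycle i j := fun i j h => Quotient.exact (f.injective h)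
  have hfix : ∀ τ : Perm ι, w₀ ∘ τ = w₀ → ∀ i j, τ.SameCycle i j → σ₀.SameCycle i j := by
    rintro τ hτ i j ⟨k, rfl⟩
    apply hw₀
    have h1 : ∀ k : ℕ, ∀ i, w₀ ((τ ^ k) i) = w₀ i := by
      intro k
      induction k with
      | zero => intro i; rfl
      | succ k ih => intro i; rw [pow_succ, Perm.mul_apply, ih]; exact congrFun hτ i
    rcases k with k | k
    · exact (h1 k i).symm
    · have := h1 (k + 1) ((τ ^ (Int.negSucc k)) i)
      rw [zpow_negSucc, ← Perm.mul_apply, mul_inv_cancel, Perm.one_apply] at this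
      rw [zpow_negSucc]; exact this
  -- by maximality such a permutation has the same orbits as `σ₀` wherever the class function is nonzero
  have hterm : ∀ τ : Perm ι, w₀ ∘ τ = w₀ → classSum κ z τ ≠ 0 →
      classSum κ z τ = classSum κ z σ₀ := by
    intro τ hτ hτ0
    let q : Quotient (Perm.SameCycle.setoid τ) → Quotient (Perm.SameCycle.setoid σ₀) :=
      Quotient.map' id (hfix τ hτ)
    have hq : Function.Surjective q := by
      intro x
      obtain ⟨i, rfl⟩ := Quotient.exists_rep x
      exact ⟨Quotient.mk _ i, rfl⟩
    have hbij : Function.Bijective q := (Fintype.bijective_iff_surjective_and_card q).mpr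
      ⟨hq, le_antisymm (hmax τ hτ0) (Fintype.card_le_of_surjective q hq)⟩
    refine classSum_eq_of_isConj κ z (isConj_of_sameCycle_iff fun i j => ⟨hfix τ hτ i j, ?_⟩)
    intro h
    have h1 : q (Quotient.mk _ i) = q (Quotient.mk _ j) := Quotient.sound h
    exact Quotient.exact (hbij.1 h1)
  have hσ₀ : w₀ ∘ σ₀ = w₀ := funext fun i =>
    congrArg f (Quotient.sound (Perm.sameCycle_apply_left.mpr (Perm.SameCycle.refl σ₀ i)))
  have hsum := sum_classSum_eq_zero hz w₀
  rw [← Finset.sum_filter_ne_zero, Finset.sum_congr rfl (g := fun _ => classSum κ z σ₀) (by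
    intro τ hτ
    simp only [Finset.mem_filter, mem_wordStab] at hτ
    exact hterm τ hτ.1 hτ.2), Finset.sum_const, smul_eq_zero] at hsum
  rcases hsum with h | h
  · rw [Finset.card_eq_zero] at h
    have : σ₀ ∈ (∅ : Finset (Perm ι)) := by
      rw [← h]
      simp [hσ₀, h₀]
    simp at this
  · exact h₀ h

/-- The traces of the regular bimodule are the values of the class function: the group elements form
a basis, and `y ↦ a y g` fixes `y` exactly if `g = y⁻¹ a⁻¹ y`. -/
theorem traceLR_of (a : Perm ι) (z : MonoidAlgebra κ (Perm ι)) :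
    traceLR κ (MonoidAlgebra.of κ _ a) z = classSum κ z a⁻¹ := by
  induction z using MonoidAlgebra.induction_on with
  | of g =>
    rw [traceLR_apply, LinearMap.trace_eq_matrix_trace κ (MonoidAlgebra.basis (Perm ι) κ),
      Matrix.trace, classSum]
    refine Finset.sum_congr rfl fun y _ => ?_
    rw [Matrix.diag_apply, LinearMap.toMatrix_apply]
    simp only [MonoidAlgebra.basis_apply, Module.End.mul_apply, LinearMap.mulLeft_apply,
      LinearMap.mulRight_apply, MonoidAlgebra.of_apply, MonoidAlgebra.single_mul_single, mul_one]
    change (MonoidAlgebra.single (a * (y * g)) (1 : κ)).coeff y = _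
    simp only [MonoidAlgebra.coeff_single, Finsupp.single_apply]
    congr 1
    rw [eq_iff_iff]
    constructor
    · intro h
      rw [eq_comm, mul_assoc, inv_mul_eq_iff_eq_mul, inv_mul_eq_iff_eq_mul]
      exact h.symm
    · rintro rfl
      simp [mul_assoc]
  | add x y hx hy => rw [map_add, hx, hy]; simp [classSum, Finset.sum_add_distrib]
  | smul r x hx => rw [map_smul, hx]; simp [classSum, Finset.mul_sum]

theorem traceLR_eq_zero_of_charPoly [CharZero κ] (hD : Fintype.card ι ≤ Fintype.card D)
    {z : MonoidAlgebra κ (Perm ι)} (hz : charPoly κ D z = 0) (x : MonoidAlgebra κ (Perm ι)) :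
    traceLR κ x z = 0 := by
  induction x using MonoidAlgebra.induction_on with
  | of a => rw [traceLR_of, classSum_eq_zero hD hz]
  | add x y hx hy =>
    have : LinearMap.mulLeft κ (x + y) = LinearMap.mulLeft κ x + LinearMap.mulLeft κ y := by
      ext; simp [add_mul]
    rw [traceLR_apply] at *
    rw [this, add_mul, map_add, hx, hy, add_zero]
  | smul r x hx =>
    have : LinearMap.mulLeft κ (r • x) = r • LinearMap.mulLeft κ x := by
      ext; simp
    rw [traceLR_apply] at *
    rw [this, smul_mul_assoc, map_smul, hx, smul_zero]

/-- Families of idempotents of `κ[S_ι]` with the same Frobenius characteristic agree for each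
additive invariant of idempotents up to equivalence. -/
theorem sum_map_eq_of_charPoly_eq [CharZero κ] (hD : Fintype.card ι ≤ Fintype.card D)
    {M : Type*} [AddCommGroup M] (c : MonoidAlgebra κ (Perm ι) → M)
    (hadd : ∀ e f, e * e = e → f * f = f → e * f = 0 → f * e = 0 → c (e + f) = c e + c f)
    (hmul : ∀ u v, u * v * u = u → v * u * v = v → c (u * v) = c (v * u))
    (s t : Multiset (MonoidAlgebra κ (Perm ι))) (hs : ∀ e ∈ s, e * e = e)
    (ht : ∀ f ∈ t, f * f = f) (h : charPoly κ D s.sum = charPoly κ D t.sum) :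
    (s.map c).sum = (t.map c).sum := by
  have : NeZero (Nat.card (Perm ι) : κ) := ⟨by simp [Fintype.card_ne_zero]⟩
  refine sum_map_eq_of_traceLR_eq κ c hadd hmul s t hs ht fun x => ?_
  rw [← sub_eq_zero, ← map_sub]
  exact traceLR_eq_zero_of_charPoly hD (by rw [map_sub, h, sub_self]) x

end Characters

/-! ### The characters of symmetric, exterior and iterated exterior powers -/

section PowerCharacters

/-- The generating function of the elementary symmetric functions of a finite family. -/
theorem coeff_prod_one_add {R I : Type*} [CommRing R] (s : Finset I) (a : I → R) (k : ℕ) :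
    PowerSeries.coeff k (∏ i ∈ s, (1 + PowerSeries.C (a i) * PowerSeries.X)) =
      ∑ S ∈ s.powersetCard k, ∏ i ∈ S, a i := by
  classical
  rw [Finset.prod_one_add, map_sum]
  have h : ∀ S : Finset I, PowerSeries.coeff k (∏ i ∈ S, (PowerSeries.C (a i) * PowerSeries.X)) =
      if S.card = k then ∏ i ∈ S, a i else 0 := by
    intro S
    rw [Finset.prod_mul_distrib, Finset.prod_const, ← map_prod, PowerSeries.coeff_C_mul,
      PowerSeries.coeff_X_pow]
    simp [eq_comm]
  simp only [h]
  rw [← Finset.sum_filter]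
  exact Finset.sum_congr (by ext; simp [Finset.mem_powersetCard]) fun _ _ => rfl

section Average

variable (κ : Type w) [Field κ] {G H : Type*} [Group G] [Group H]

theorem mapDomainAlgHom_of (f : G →* H) (g : G) :
    MonoidAlgebra.mapDomainAlgHom κ κ f (MonoidAlgebra.of κ G g) = MonoidAlgebra.of κ H (f g) := by
  simp

variable [Fintype G]

/-- The idempotent of the group algebra attached to a sign character. -/
noncomputable def avgElt (χ : G →* ℤˣ) : MonoidAlgebra κ G :=
  (Fintype.card G : κ)⁻¹ • ∑ g, ((χ g : ℤ) : κ) • MonoidAlgebra.of κ G g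

theorem of_mul_avgElt (χ : G →* ℤˣ) (h : G) :
    MonoidAlgebra.of κ G h * avgElt κ χ = ((χ h : ℤ) : κ) • avgElt κ χ := by
  rw [avgElt, mul_smul_comm, smul_comm ((χ h : ℤ) : κ)]
  congr 1
  rw [Finset.mul_sum, Finset.smul_sum,
    ← Equiv.sum_comp (Equiv.mulLeft h) fun g => ((χ h : ℤ) : κ) • ((χ g : ℤ) : κ) •
      MonoidAlgebra.of κ G g]
  refine Finset.sum_congr rfl fun g _ => ?_
  have h4 : ((χ h : ℤ)) * (χ h : ℤ) = 1 := by
    rw [← Units.val_mul, Int.units_mul_self, Units.val_one]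
  rw [Equiv.coe_mulLeft, map_mul χ, map_mul, Units.val_mul, Int.cast_mul, smul_smul, ← mul_assoc,
    ← Int.cast_mul, h4, Int.cast_one, one_mul, mul_smul_comm]

theorem avgElt_mul_self [CharZero κ] (χ : G →* ℤˣ) : avgElt κ χ * avgElt κ χ = avgElt κ χ := by
  have h : ∀ g, (((χ g : ℤ) : κ) • MonoidAlgebra.of κ G g) * avgElt κ χ = avgElt κ χ := by
    intro g
    rw [smul_mul_assoc, of_mul_avgElt, smul_smul, ← Int.cast_mul, ← Units.val_mul,
      Int.units_mul_self, Units.val_one, Int.cast_one, one_smul]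
  conv_lhs => enter [1]; rw [avgElt]
  rw [smul_mul_assoc, Finset.sum_mul, Finset.sum_congr rfl fun g _ => h g, Finset.sum_const,
    Finset.card_univ, ← Nat.cast_smul_eq_nsmul κ, smul_smul, inv_mul_cancel₀, one_smul]
  exact Nat.cast_ne_zero.mpr Fintype.card_ne_zero

theorem mapDomainAlgHom_avgElt (f : G →* H) (χ : G →* ℤˣ) :
    MonoidAlgebra.mapDomainAlgHom κ κ f (avgElt κ χ) =
      (Fintype.card G : κ)⁻¹ • ∑ g, ((χ g : ℤ) : κ) • MonoidAlgebra.of κ H (f g) := by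
  rw [avgElt, map_smul, map_sum]
  simp only [map_smul, mapDomainAlgHom_of]

end Average

variable (κ : Type w) [Field κ] {ι ι' : Type*} [Fintype ι] [DecidableEq ι]
  [Fintype ι'] [DecidableEq ι'] (D : Type*) [Fintype D] [DecidableEq D]

theorem permChar_conj (e : ι ≃ ι') (σ : Perm ι) :
    permChar κ D (e.permCongrHom σ) = permChar κ D σ := by
  rw [permChar, permChar]
  refine Finset.sum_bij' (fun w _ => w ∘ e) (fun w _ => w ∘ e.symm) ?_ ?_ ?_ ?_ ?_
  · intro w hw
    simp only [Finset.mem_filter, Finset.mem_univ, true_and] at hw ⊢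
    ext i
    simpa using congrArg (fun f => f (e i)) hw
  · intro w hw
    simp only [Finset.mem_filter, Finset.mem_univ, true_and] at hw ⊢
    ext i
    simpa using congrArg (fun f => f (e.symm i)) hw
  · intro w _; ext; simp
  · intro w _; ext; simp
  · intro w _
    exact (Equiv.prod_comp e fun j => (MvPolynomial.X (w j) : MvPolynomial D κ)).symm

theorem charPoly_conj (e : ι ≃ ι') (z : MonoidAlgebra κ (Perm ι)) :
    charPoly κ D (MonoidAlgebra.mapDomainAlgHom κ κ e.permCongrHom.toMonoidHom z) =
      charPoly κ D z := by
  induction z using MonoidAlgebra.induction_on with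
  | of σ => rw [mapDomainAlgHom_of, charPoly_of, charPoly_of]; exact permChar_conj κ D e σ
  | add x y hx hy => simp only [map_add, hx, hy]
  | smul r x hx => simp only [map_smul, hx]

theorem permChar_sumCongr (σ : Perm ι) (τ : Perm ι') :
    permChar κ D (Perm.sumCongr σ τ) = permChar κ D σ * permChar κ D τ := by
  rw [permChar, permChar, permChar, Finset.sum_mul_sum, ← Finset.sum_product']
  refine Finset.sum_bij' (fun w _ => (w ∘ Sum.inl, w ∘ Sum.inr)) (fun p _ => Sum.elim p.1 p.2)
    ?_ ?_ ?_ ?_ ?_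
  · intro w hw
    simp only [Finset.mem_filter, Finset.mem_univ, true_and, Finset.mem_product] at hw ⊢
    exact ⟨funext fun i => congrFun hw (Sum.inl i), funext fun i => congrFun hw (Sum.inr i)⟩
  · intro p hp
    simp only [Finset.mem_filter, Finset.mem_univ, true_and, Finset.mem_product] at hp ⊢
    ext (i | i)
    · exact congrFun hp.1 i
    · exact congrFun hp.2 i
  · intro w _; ext (i | i) <;> rfl
  · intro p _; rfl
  · intro w _; exact Fintype.prod_sum_type _

/-- The juxtaposition `κ[S_ι] × κ[S_ι'] → κ[S_{ι ⊕ ι'}]`. -/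
noncomputable def juxt (x : MonoidAlgebra κ (Perm ι)) (y : MonoidAlgebra κ (Perm ι')) :
    MonoidAlgebra κ (Perm (ι ⊕ ι')) :=
  MonoidAlgebra.mapDomainAlgHom κ κ
    ((Perm.sumCongrHom ι ι').comp (MonoidHom.inl (Perm ι) (Perm ι'))) x *
  MonoidAlgebra.mapDomainAlgHom κ κ
    ((Perm.sumCongrHom ι ι').comp (MonoidHom.inr (Perm ι) (Perm ι'))) y

theorem juxt_of (σ : Perm ι) (τ : Perm ι') :
    juxt κ (MonoidAlgebra.of κ _ σ) (MonoidAlgebra.of κ _ τ) =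
      MonoidAlgebra.of κ _ (Perm.sumCongr σ τ) := by
  rw [juxt, mapDomainAlgHom_of, mapDomainAlgHom_of, ← map_mul]
  simp

theorem charPoly_juxt (x : MonoidAlgebra κ (Perm ι)) (y : MonoidAlgebra κ (Perm ι')) :
    charPoly κ D (juxt κ x y) = charPoly κ D x * charPoly κ D y := by
  induction x using MonoidAlgebra.induction_on with
  | of σ =>
    induction y using MonoidAlgebra.induction_on with
    | of τ => rw [juxt_of, charPoly_of, charPoly_of, charPoly_of, permChar_sumCongr]
    | add x y hx hy => simp only [juxt, map_add, mul_add] at *; rw [hx, hy]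
    | smul r x hx =>
      simp only [juxt, map_smul, mul_smul_comm] at *; rw [hx]
  | add x y hx hy => simp only [juxt, map_add, add_mul] at *; rw [hx, hy]
  | smul r x hx => simp only [juxt, map_smul, smul_mul_assoc] at *; rw [hx]

theorem juxt_mul_juxt (x x' : MonoidAlgebra κ (Perm ι)) (y y' : MonoidAlgebra κ (Perm ι')) :
    juxt κ x y * juxt κ x' y' = juxt κ (x * x') (y * y') := by
  have h : Commute
      (MonoidAlgebra.mapDomainAlgHom κ κ
        ((Perm.sumCongrHom ι ι').comp (MonoidHom.inl (Perm ι) (Perm ι'))) x')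
      (MonoidAlgebra.mapDomainAlgHom κ κ
        ((Perm.sumCongrHom ι ι').comp (MonoidHom.inr (Perm ι) (Perm ι'))) y) := by
    induction x' using MonoidAlgebra.induction_on with
    | of σ =>
      induction y using MonoidAlgebra.induction_on with
      | of τ =>
        rw [mapDomainAlgHom_of, mapDomainAlgHom_of, commute_iff_eq, ← map_mul, ← map_mul]
        simp
      | add x y hx hy => rw [map_add]; exact hx.add_right hy
      | smul r x hx => rw [map_smul]; exact hx.smul_right r
    | add x y hx hy => rw [map_add]; exact hx.add_left hy
    | smul r x hx => rw [map_smul]; exact hx.smul_left r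
  rw [juxt, juxt, juxt, map_mul, map_mul, mul_assoc, mul_assoc, ← mul_assoc _ _
    (MonoidAlgebra.mapDomainAlgHom κ κ _ y'), ← h.eq, mul_assoc]

open MvPolynomial in
/-- The characteristic as a sum over words, each weighted by the sum of the coefficients of the
permutations fixing it. -/
theorem charPoly_eq_sum_words (z : MonoidAlgebra κ (Perm ι)) :
    charPoly κ D z = ∑ w : ι → D, (∑ σ ∈ wordStab w, z.coeff σ) • ∏ j, X (w j) := by
  rw [charPoly_apply]
  simp only [permChar, Finset.smul_sum, Finset.sum_smul, Finset.sum_filter, wordStab]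
  rw [Finset.sum_comm]
  refine Finset.sum_congr rfl fun w _ => Finset.sum_congr rfl fun σ _ => ?_
  split_ifs <;> simp

theorem coeff_avgElt {G : Type*} [Group G] [Fintype G] (χ : G →* ℤˣ) (g : G) :
    (avgElt κ χ).coeff g = (Fintype.card G : κ)⁻¹ * ((χ g : ℤ) : κ) := by
  classical
  rw [avgElt]
  simp [MonoidAlgebra.of_apply, Finsupp.single_apply]

section Words

variable {D}

/-- The alternating sum over the permutations transforming the word `u` into the word `v`. -/
def wordSign (u v : ι → D) : ℤ :=
  ∑ σ : Perm ι, if u ∘ ⇑σ = v then (Perm.sign σ : ℤ) else 0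

omit [Fintype D] in
theorem wordSign_comp (u v : ι → D) (π : Perm ι) :
    wordSign (u ∘ π) v = Perm.sign π * wordSign u v := by
  rw [wordSign, wordSign, Finset.mul_sum, ← Equiv.sum_comp (Equiv.mulLeft π) fun σ =>
    (Perm.sign π : ℤ) * if u ∘ ⇑σ = v then (Perm.sign σ : ℤ) else 0]
  refine Finset.sum_congr rfl fun σ _ => ?_
  have h4 : (Perm.sign π : ℤ) * (Perm.sign π : ℤ) = 1 := by
    rw [← Units.val_mul, Int.units_mul_self, Units.val_one]
  rw [Equiv.coe_mulLeft, Perm.coe_mul, ← Function.comp_assoc]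
  split_ifs
  · rw [map_mul, Units.val_mul, ← mul_assoc, h4, one_mul]
  · rw [mul_zero]

omit [Fintype D] in
theorem wordSign_eq_zero {u : ι → D} (hu : ¬ Function.Injective u) (v : ι → D) :
    wordSign u v = 0 := by
  simp only [Function.Injective] at hu
  push Not at hu
  obtain ⟨i, j, hij, hne⟩ := hu
  have h := wordSign_comp u v (swap i j)
  have h1 : u ∘ swap i j = u := by
    ext k
    rw [Function.comp_apply, swap_apply_def]
    split_ifs with h1 h2
    · rw [h1, hij]
    · rw [h2, hij]
    · rfl
  rw [h1, Perm.sign_swap hne] at h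
  simp only [Units.val_neg, Units.val_one, neg_mul, one_mul] at h
  omega

omit [Fintype D] in
theorem wordSign_self {u : ι → D} (hu : Function.Injective u) : wordSign u u = 1 := by
  rw [wordSign, Finset.sum_eq_single 1]
  · simp
  · intro σ _ hσ
    rw [if_neg]
    intro h
    exact hσ (Equiv.ext fun i => hu (congrFun h i))
  · simp

omit [Fintype D] in
theorem wordSign_of_image_ne {u v : ι → D}
    (h : Finset.univ.image u ≠ Finset.univ.image v) : wordSign u v = 0 := by
  refine Finset.sum_eq_zero fun σ _ => if_neg fun h1 => h ?_
  rw [← h1, ← Finset.image_image, Finset.image_univ_equiv]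

/-- The injective words. -/
def injWords (ι D : Type*) [Fintype ι] [DecidableEq ι] [Fintype D] [DecidableEq D] :
    Finset (ι → D) :=
  Finset.univ.filter Function.Injective

theorem mem_injWords {w : ι → D} : w ∈ injWords ι D ↔ Function.Injective w := by
  simp [injWords]

theorem exists_perm_of_image_eq {u v : ι → D}
    (hv : Function.Injective v) (h : Finset.univ.image u = Finset.univ.image v) :
    ∃ π : Perm ι, u ∘ π = v := by
  have h1 : ∀ i, ∃ j, u j = v i := fun i => by
    have : v i ∈ Finset.univ.image u := by
      rw [h]; exact Finset.mem_image_of_mem _ (Finset.mem_univ i)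
    obtain ⟨j, _, hj⟩ := Finset.mem_image.mp this
    exact ⟨j, hj⟩
  choose f hf using h1
  have hinj : Function.Injective f := fun i j hij => hv (by rw [← hf i, ← hf j, hij])
  exact ⟨Equiv.ofBijective f (Finite.injective_iff_bijective.mp hinj), funext hf⟩

theorem card_injWords_image {S : Finset D} (hS : S.card = Fintype.card ι) :
    ((injWords ι D).filter fun w => Finset.univ.image w = S).card = (Fintype.card ι).factorial := by
  let e : ι ≃ S := Fintype.equivOfCardEq (by rw [Fintype.card_coe, hS])
  let w₀ : ι → D := fun i => e i
  have hw₀ : Function.Injective w₀ := fun i j h => e.injective (Subtype.ext h)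
  have himg : Finset.univ.image w₀ = S := by
    ext d
    simp only [Finset.mem_image, Finset.mem_univ, true_and]
    constructor
    · rintro ⟨i, rfl⟩; exact (e i).2
    · intro hd; exact ⟨e.symm ⟨d, hd⟩, by simp [w₀]⟩
  have h : ((injWords ι D).filter fun w => Finset.univ.image w = S) =
      Finset.univ.image fun y : Perm ι => w₀ ∘ y := by
    ext w
    simp only [Finset.mem_filter, mem_injWords, Finset.mem_image, Finset.mem_univ, true_and]
    constructor
    · rintro ⟨hw, hwS⟩
      exact exists_perm_of_image_eq hw (himg.trans hwS.symm)
    · rintro ⟨y, rfl⟩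
      exact ⟨hw₀.comp y.injective, by
        rw [← Finset.image_image, Finset.image_univ_equiv, himg]⟩
  rw [h, Finset.card_image_of_injective, Finset.card_univ, Fintype.card_perm]
  intro y y' hyy
  exact Equiv.ext fun i => hw₀ (congrFun hyy i)

theorem image_mem_powersetCard {w : ι → D} (hw : w ∈ injWords ι D) :
    Finset.univ.image w ∈ Finset.univ.powersetCard (Fintype.card ι) := by
  rw [Finset.mem_powersetCard, Finset.card_image_of_injective _ (mem_injWords.mp hw),
    Finset.card_univ]
  exact ⟨Finset.subset_univ _, rfl⟩

/-- An injective word is determined by its set of letters up to one of the `|ι|!` orderings. -/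
theorem sum_injWords {M : Type*} [AddCommMonoid M] (F : Finset D → M) :
    ∑ w ∈ injWords ι D, F (Finset.univ.image w) = (Fintype.card ι).factorial •
      ∑ S ∈ Finset.univ.powersetCard (Fintype.card ι), F S := by
  rw [← Finset.sum_fiberwise_of_maps_to (fun w hw => image_mem_powersetCard hw), Finset.smul_sum]
  refine Finset.sum_congr rfl fun S hS => ?_
  rw [Finset.sum_congr rfl (g := fun _ => F S)
    (fun w hw => by rw [(Finset.mem_filter.mp hw).2]), Finset.sum_const,
    card_injWords_image (Finset.mem_powersetCard.mp hS).2]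

/-- The version of `sum_injWords` for families of injective words. -/
theorem sum_pi_injWords {α M : Type*} [Fintype α] [DecidableEq α] [AddCommMonoid M]
    (F : (α → Finset D) → M) :
    ∑ w ∈ Fintype.piFinset fun _ : α => injWords ι D, F (fun a => Finset.univ.image (w a)) =
      (Fintype.card ι).factorial ^ Fintype.card α •
      ∑ S ∈ Fintype.piFinset fun _ : α => Finset.univ.powersetCard (Fintype.card ι), F S := by
  rw [← Finset.sum_fiberwise_of_maps_to
    (g := fun (w : α → ι → D) a => Finset.univ.image (w a)) (fun w hw => by
      rw [Fintype.mem_piFinset] at hw ⊢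
      exact fun a => image_mem_powersetCard (hw a)), Finset.smul_sum]
  refine Finset.sum_congr rfl fun S hS => ?_
  rw [Finset.sum_congr rfl (g := fun _ => F S)
    (fun w hw => by rw [← (Finset.mem_filter.mp hw).2]), Finset.sum_const]
  congr 1
  rw [Fintype.mem_piFinset] at hS
  have h : ((Fintype.piFinset fun _ : α => injWords ι D).filter
      fun w => (fun a => Finset.univ.image (w a)) = S) =
      Fintype.piFinset fun a => (injWords ι D).filter fun w => Finset.univ.image w = S a := by
    ext w
    simp only [Finset.mem_filter, Fintype.mem_piFinset, funext_iff]
    exact forall_and.symm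
  rw [h, Fintype.card_piFinset, Finset.prod_congr rfl (fun a _ =>
    card_injWords_image (Finset.mem_powersetCard.mp (hS a)).2), Finset.prod_const, Finset.card_univ]

end Words

variable [CharZero κ]

open MvPolynomial

/-- The Frobenius characteristic of the sign representation. -/
theorem charPoly_sign : charPoly κ D (avgElt κ (Perm.sign : Perm ι →* ℤˣ)) =
    esymm D κ (Fintype.card ι) := by
  -- only the injective words contribute, each with the coefficient `1 / |ι|!`
  have h1 : ∀ w : ι → D, (∑ σ ∈ wordStab w, (avgElt κ (Perm.sign : Perm ι →* ℤˣ)).coeff σ) •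
      ∏ j, (X (w j) : MvPolynomial D κ) = if w ∈ injWords ι D then
        ((Fintype.card ι).factorial : κ)⁻¹ • ∏ d ∈ Finset.univ.image w, (X d : MvPolynomial D κ)
        else 0 := by
    intro w
    have h2 : ∑ σ ∈ wordStab w, (avgElt κ (Perm.sign : Perm ι →* ℤˣ)).coeff σ =
        ((Fintype.card ι).factorial : κ)⁻¹ * (wordSign w w : ℤ) := by
      simp only [coeff_avgElt, ← Finset.mul_sum, Fintype.card_perm]
      rw [wordSign, wordStab, Finset.sum_filter]
      push_cast
      rfl
    rw [h2]
    split_ifs with h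
    · rw [mem_injWords] at h
      rw [wordSign_self h, Int.cast_one, mul_one, Finset.prod_image fun i _ j _ hij => h hij]
    · rw [mem_injWords] at h
      rw [wordSign_eq_zero h, Int.cast_zero, mul_zero, zero_smul]
  rw [charPoly_eq_sum_words, Finset.sum_congr rfl fun w _ => h1 w, ← Finset.sum_filter,
    Finset.filter_mem_eq_inter, Finset.univ_inter, ← Finset.smul_sum,
    sum_injWords (fun S => ∏ d ∈ S, (X d : MvPolynomial D κ)), esymm,
    ← Nat.cast_smul_eq_nsmul κ, smul_smul, inv_mul_cancel₀, one_smul]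
  exact Nat.cast_ne_zero.mpr (Nat.factorial_ne_zero _)

/-- The Frobenius characteristic of the trivial representation is the complete homogeneous symmetric
polynomial. -/
theorem charPoly_triv : charPoly κ D (avgElt κ (1 : Perm ι →* ℤˣ)) =
    ∑ μ ∈ Finset.univ.finsuppAntidiag (Fintype.card ι), monomial μ 1 := by
  have h1 : ∀ w : ι → D, (∑ σ ∈ wordStab w, (avgElt κ (1 : Perm ι →* ℤˣ)).coeff σ) =
      ((Fintype.card ι).factorial : κ)⁻¹ * (wordStab w).card := by
    intro w
    simp [coeff_avgElt, Fintype.card_perm, mul_comm]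
  have hmaps : ∀ w : ι → D, content w ∈ Finset.univ.finsuppAntidiag (Fintype.card ι) := by
    intro w
    rw [Finset.mem_finsuppAntidiag]
    refine ⟨?_, Finset.subset_univ _⟩
    simp only [content_apply, Fintype.card_subtype]
    rw [← Finset.card_eq_sum_card_fiberwise (fun _ _ => Finset.mem_univ _), Finset.card_univ]
  rw [charPoly_eq_sum_words, ← Finset.sum_fiberwise_of_maps_to (fun w _ => hmaps w)]
  refine Finset.sum_congr rfl fun μ hμ => ?_
  -- the words of given content are permuted transitively, and each orbit contributes its monomial once,
  -- by the orbit-stabilizer theorem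
  obtain ⟨w₀, rfl⟩ : ∃ w₀ : ι → D, content w₀ = μ := by
    rw [Finset.mem_finsuppAntidiag] at hμ
    let e : ι ≃ Σ d : D, Fin (μ d) := Fintype.equivOfCardEq (by
      rw [Fintype.card_sigma]
      simp only [Fintype.card_fin]
      exact hμ.1.symm)
    refine ⟨fun i => (e i).1, Finsupp.ext fun d => ?_⟩
    rw [content_apply, Fintype.card_congr (e.subtypeEquiv (q := fun x => x.1 = d) fun i => Iff.rfl),
      Fintype.card_congr (Equiv.sigmaSubtype d)]
    simp
  have h2 := sum_comp_perm w₀ fun w => ∏ j, (X (w j) : MvPolynomial D κ)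
  have h3 : ∀ y : Perm ι, ∏ j, (X ((w₀ ∘ y) j) : MvPolynomial D κ) = ∏ j, X (w₀ j) := fun y =>
    Equiv.prod_comp y fun j => (X (w₀ j) : MvPolynomial D κ)
  rw [Finset.sum_congr rfl fun y _ => h3 y, Finset.sum_const, Finset.card_univ,
    Fintype.card_perm] at h2
  have h4 : ∀ w : ι → D, content w = content w₀ → (wordStab w).card = (wordStab w₀).card := by
    intro w hw
    obtain ⟨y, rfl⟩ := exists_perm_of_content_eq hw
    refine Finset.card_bij' (fun σ _ => y * σ * y⁻¹) (fun σ _ => y⁻¹ * σ * y) ?_ ?_ ?_ ?_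
    · intro σ hσ
      rw [mem_wordStab] at hσ ⊢
      rw [Perm.coe_mul, Perm.coe_mul, ← Function.comp_assoc, ← Function.comp_assoc, hσ,
        Function.comp_assoc, ← Perm.coe_mul, mul_inv_cancel, Perm.coe_one, Function.comp_id]
    · intro σ hσ
      rw [mem_wordStab] at hσ ⊢
      rw [Function.comp_assoc, ← Perm.coe_mul, ← mul_assoc, ← mul_assoc, mul_inv_cancel, one_mul,
        Perm.coe_mul, ← Function.comp_assoc, hσ]
    · intro σ _; simp [mul_assoc]
    · intro σ _; simp [mul_assoc]
  rw [Finset.sum_congr rfl (g := fun w => ((Fintype.card ι).factorial : κ)⁻¹ •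
    (wordStab w₀).card • ∏ j, (X (w j) : MvPolynomial D κ)) (fun w hw => by
      rw [h1, h4 w (Finset.mem_filter.mp hw).2, mul_smul, Nat.cast_smul_eq_nsmul]),
    ← Finset.smul_sum, ← Finset.smul_sum, ← h2, ← Nat.cast_smul_eq_nsmul κ, smul_smul,
    inv_mul_cancel₀ (Nat.cast_ne_zero.mpr (Nat.factorial_ne_zero _)), one_smul, prod_X_eq_monomial]

end PowerCharacters

/-! ### The Koszul relation and the plethysm of elementary symmetric polynomials -/

section WreathCharacters

open MvPolynomial

variable (κ : Type w) [Field κ] (D : Type*) [Fintype D] [DecidableEq D]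

/-- The Koszul relation between complete homogeneous and elementary symmetric polynomials. -/
theorem sum_homogeneous_mul_esymm {n : ℕ} (hn : n ≠ 0) :
    ∑ ij ∈ Finset.HasAntidiagonal.antidiagonal n, (-1) ^ ij.1 * esymm D κ ij.1 *
      (∑ μ ∈ Finset.univ.finsuppAntidiag ij.2, monomial μ 1 : MvPolynomial D κ) = 0 := by
  -- compare coefficients in `∏ (1 - x_d t) · ∏ (1 - x_d t)⁻¹ = 1`
  have hH : ∀ k, PowerSeries.coeff k
      (∏ d : D, PowerSeries.mk fun i => (X d : MvPolynomial D κ) ^ i) =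
      ∑ μ ∈ Finset.univ.finsuppAntidiag k, monomial μ 1 := by
    intro k
    rw [PowerSeries.coeff_prod]
    refine Finset.sum_congr rfl fun μ _ => ?_
    rw [monomial_eq, C_1, one_mul, Finsupp.prod_fintype _ _ fun d => pow_zero _]
    simp only [PowerSeries.coeff_mk]
  have hE : ∀ k, PowerSeries.coeff k
      (∏ d : D, (1 + PowerSeries.C (-X d : MvPolynomial D κ) * PowerSeries.X)) =
      (-1) ^ k * esymm D κ k := by
    intro k
    rw [coeff_prod_one_add, esymm, Finset.mul_sum]
    refine Finset.sum_congr rfl fun S hS => ?_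
    rw [Finset.prod_neg, (Finset.mem_powersetCard.mp hS).2]
  have h1 : (∏ d : D, (1 + PowerSeries.C (-X d : MvPolynomial D κ) * PowerSeries.X)) *
      (∏ d : D, PowerSeries.mk fun i => (X d : MvPolynomial D κ) ^ i) = 1 := by
    rw [← Finset.prod_mul_distrib]
    refine Finset.prod_eq_one fun d _ => ?_
    ext k
    rw [add_mul, one_mul, map_add, mul_assoc, PowerSeries.coeff_C_mul, PowerSeries.coeff_mk]
    rcases k with - | k
    · simp
    · rw [PowerSeries.coeff_succ_X_mul, PowerSeries.coeff_mk, PowerSeries.coeff_one,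
        if_neg (Nat.succ_ne_zero k), pow_succ]
      congr 1
      ring
  have h2 := congrArg (PowerSeries.coeff n) h1
  rw [PowerSeries.coeff_mul, PowerSeries.coeff_one, if_neg hn] at h2
  rw [← h2]
  exact Finset.sum_congr rfl fun ij _ => by rw [hE, hH]

variable {α β : Type*} [Fintype α] [DecidableEq α] [Fintype β] [DecidableEq β]

/-- The permutations of the blocks `{a} × β` of `α × β`. -/
def blockHom (α β : Type*) : Perm α →* Perm (α × β) where
  toFun τ := τ.prodCongr (Equiv.refl β)
  map_one' := rfl
  map_mul' _ _ := rfl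

/-- The permutations inside the blocks `{a} × β` of `α × β`. -/
def fiberHom (α β : Type*) : (α → Perm β) →* Perm (α × β) where
  toFun σ := Equiv.prodCongrRight σ
  map_one' := rfl
  map_mul' _ _ := rfl

@[simp] theorem blockHom_apply (τ : Perm α) (p : α × β) : blockHom α β τ p = (τ p.1, p.2) := rfl

@[simp] theorem fiberHom_apply (σ : α → Perm β) (p : α × β) :
    fiberHom α β σ p = (p.1, σ p.1 p.2) := rfl

/-- The product of the signs. -/
def piSign (α β : Type*) [Fintype α] [Fintype β] [DecidableEq β] : (α → Perm β) →* ℤˣ where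
  toFun σ := ∏ a, Perm.sign (σ a)
  map_one' := by simp
  map_mul' _ _ := by simp [Finset.prod_mul_distrib]

/-- The alternation of the blocks. -/
noncomputable def blockAlt (α β : Type*) [Fintype α] [DecidableEq α] :
    MonoidAlgebra κ (Perm (α × β)) :=
  MonoidAlgebra.mapDomainAlgHom κ κ (blockHom α β) (avgElt κ Perm.sign)

/-- The alternation inside each block. -/
noncomputable def fiberAlt (α β : Type*) [Fintype α] [DecidableEq α] [Fintype β] [DecidableEq β] :
    MonoidAlgebra κ (Perm (α × β)) :=
  MonoidAlgebra.mapDomainAlgHom κ κ (fiberHom α β) (avgElt κ (piSign α β))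

theorem blockAlt_fiberAlt_comm : Commute (blockAlt κ α β) (fiberAlt κ α β) := by
  have h : ∀ τ : Perm α, Commute (MonoidAlgebra.of κ _ (blockHom α β τ)) (fiberAlt κ α β) := by
    intro τ
    rw [fiberAlt, mapDomainAlgHom_avgElt]
    refine Commute.smul_right ?_ _
    rw [commute_iff_eq, Finset.mul_sum, Finset.sum_mul]
    refine Finset.sum_bij' (fun σ _ => σ ∘ τ.symm) (fun σ _ => σ ∘ τ) ?_ ?_ ?_ ?_ ?_
    · intro σ _; exact Finset.mem_univ _
    · intro σ _; exact Finset.mem_univ _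
    · intro σ _; ext; simp
    · intro σ _; ext; simp
    · intro σ _
      have h1 : piSign α β (σ ∘ τ.symm) = piSign α β σ :=
        Equiv.prod_comp τ.symm fun a => Perm.sign (σ a)
      have h2 : blockHom α β τ * fiberHom α β σ = fiberHom α β (σ ∘ τ.symm) * blockHom α β τ := by
        ext ⟨a, b⟩ <;> simp
      rw [h1, mul_smul_comm, smul_mul_assoc, ← map_mul, ← map_mul, h2]
  rw [blockAlt, mapDomainAlgHom_avgElt]
  refine Commute.smul_left ?_ _
  exact Commute.sum_left _ _ _ fun τ _ => (h τ).smul_left _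

variable (α β) in
/-- The idempotent of the sign character of the wreath product of `S_β` and `S_α`. -/
noncomputable def wreathElt : MonoidAlgebra κ (Perm (α × β)) := blockAlt κ α β * fiberAlt κ α β

theorem wreathElt_mul_self [CharZero κ] :
    wreathElt κ α β * wreathElt κ α β = wreathElt κ α β := by
  rw [wreathElt, mul_assoc, ← mul_assoc _ (blockAlt κ α β), ← (blockAlt_fiberAlt_comm κ).eq,
    mul_assoc, ← mul_assoc (blockAlt κ α β) (blockAlt κ α β)]
  congr 1
  · rw [blockAlt, ← map_mul, avgElt_mul_self]
  · rw [fiberAlt, ← map_mul, avgElt_mul_self]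

/-- The matrix of alternating sums of a family of words. Its determinant is the contribution of the
family to the character of `wreathElt`. -/
def wordMatrix (w : α → β → D) : Matrix α α ℤ := Matrix.of fun a b => wordSign (w a) (w b)

variable {D} in
omit [Fintype D] in
theorem det_wordMatrix (w : α → β → D) : (wordMatrix D w).det =
    ∑ τ : Perm α, ∑ σ : α → Perm β,
      if w.uncurry ∘ (blockHom α β τ * fiberHom α β σ) = w.uncurry then
        (Perm.sign τ : ℤ) * (piSign α β σ : ℤ) else 0 := by
  rw [Matrix.det_apply]
  refine Finset.sum_congr rfl fun τ _ => ?_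
  simp only [wordMatrix, Matrix.of_apply, wordSign]
  rw [Finset.prod_univ_sum, Fintype.piFinset_univ, Finset.smul_sum]
  refine Finset.sum_congr rfl fun σ _ => ?_
  have h : w.uncurry ∘ (blockHom α β τ * fiberHom α β σ) = w.uncurry ↔
      ∀ a, w (τ a) ∘ (σ a) = w a := by
    simp only [funext_iff, Prod.forall]
    rfl
  by_cases h1 : ∀ a, w (τ a) ∘ (σ a) = w a
  · rw [if_pos (h.mpr h1), Finset.prod_congr rfl fun a _ => if_pos (h1 a)]
    simp [piSign, Units.smul_def]
  · rw [if_neg (fun h2 => h1 (h.mp h2))]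
    push Not at h1
    obtain ⟨a, ha⟩ := h1
    rw [Finset.prod_eq_zero (Finset.mem_univ a) (if_neg ha), smul_zero]

variable {D} in
/-- If all words are injective with distinct sets of letters, the matrix is the identity. Otherwise
a row vanishes, or two rows are proportional. -/
theorem det_wordMatrix_eq (w : α → β → D) : (wordMatrix D w).det =
    if (w ∈ Fintype.piFinset fun _ => injWords β D) ∧
      Function.Injective (fun a => Finset.univ.image (w a)) then 1 else 0 := by
  split_ifs with h
  · obtain ⟨h1, h2⟩ := h
    rw [Fintype.mem_piFinset] at h1
    have : wordMatrix D w = 1 := by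
      ext a b
      rw [wordMatrix, Matrix.of_apply]
      by_cases hab : a = b
      · subst hab
        rw [wordSign_self (mem_injWords.mp (h1 a)), Matrix.one_apply_eq]
      · rw [wordSign_of_image_ne (fun h3 => hab (h2 h3)), Matrix.one_apply_ne hab]
    rw [this, Matrix.det_one]
  · by_cases h1 : w ∈ Fintype.piFinset fun _ => injWords β D
    · have h2 : ¬ Function.Injective (fun a => Finset.univ.image (w a)) := fun h2 => h ⟨h1, h2⟩
      rw [Fintype.mem_piFinset] at h1
      simp only [Function.Injective] at h2
      push Not at h2
      obtain ⟨a, b, hab, hne⟩ := h2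
      obtain ⟨π, hπ⟩ := exists_perm_of_image_eq (mem_injWords.mp (h1 b)) hab
      have h3 : wordMatrix D w = (wordMatrix D w).updateRow b
          ((Perm.sign π : ℤ) • wordMatrix D w a) := by
        ext c d
        rw [Matrix.updateRow_apply]
        split_ifs with hc
        · subst hc
          simp only [wordMatrix, Matrix.of_apply, Pi.smul_apply, smul_eq_mul]
          rw [← hπ, wordSign_comp]
        · rfl
      rw [h3, Matrix.det_updateRow_smul, Matrix.det_zero_of_row_eq hne, mul_zero]
      rw [Matrix.updateRow_self, Matrix.updateRow_ne hne]
    · rw [Fintype.mem_piFinset] at h1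
      push Not at h1
      obtain ⟨a, ha⟩ := h1
      refine Matrix.det_eq_zero_of_row_eq_zero a fun b => ?_
      exact wordSign_eq_zero (fun h => ha (mem_injWords.mpr h)) _

/-- The Frobenius characteristic of the wreath product of sign characters is the plethysm of
elementary symmetric polynomials. -/
theorem charPoly_wreathElt [CharZero κ] : charPoly κ D (wreathElt κ α β) =
    ∑ S ∈ (Finset.univ.powersetCard (Fintype.card β) : Finset (Finset D)).powersetCard
      (Fintype.card α), ∏ s ∈ S, ∏ d ∈ s, (X d : MvPolynomial D κ) := by
  -- a word on `α × β` is a family of words on `β`; it contributes the determinant of its word matrix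
  have h1 : charPoly κ D (wreathElt κ α β) =
      ((Fintype.card α).factorial : κ)⁻¹ • ((Fintype.card β).factorial ^ Fintype.card α : κ)⁻¹ •
      ∑ w : α → β → D, ((wordMatrix D w).det : κ) • ∏ a, ∏ b, (X (w a b) : MvPolynomial D κ) := by
    rw [wreathElt, blockAlt, fiberAlt, mapDomainAlgHom_avgElt, mapDomainAlgHom_avgElt,
      smul_mul_smul_comm, map_smul, mul_smul, Fintype.card_perm, Fintype.card_pi,
      Finset.prod_const, Finset.card_univ, Fintype.card_perm]
    rw [Nat.cast_pow]
    congr 2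
    rw [Finset.sum_mul_sum]
    simp only [smul_mul_smul_comm, ← map_mul, map_sum, map_smul, charPoly_of, permChar]
    simp only [det_wordMatrix, Finset.sum_filter, Int.cast_sum, Finset.sum_smul, Finset.smul_sum]
    rw [Finset.sum_congr rfl fun τ _ => Finset.sum_comm, Finset.sum_comm]
    refine Fintype.sum_equiv (Equiv.curry α β D) _ _ fun w => ?_
    refine Finset.sum_congr rfl fun τ _ => Finset.sum_congr rfl fun σ _ => ?_
    rw [Equiv.curry_apply, Function.uncurry_curry, Fintype.prod_prod_type]
    split_ifs
    · push_cast; rfl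
    · simp
  have h2 : ∀ w : α → β → D, ((wordMatrix D w).det : κ) •
      ∏ a, ∏ b, (X (w a b) : MvPolynomial D κ) =
      if w ∈ (Fintype.piFinset fun _ => injWords β D) then
        (fun T : α → Finset D => if Function.Injective T then ∏ a, ∏ d ∈ T a, X d else 0)
          (fun a => Finset.univ.image (w a)) else 0 := by
    intro w
    rw [det_wordMatrix_eq]
    by_cases h3 : w ∈ (Fintype.piFinset fun _ => injWords β D)
    · rw [if_pos h3]
      by_cases h4 : Function.Injective (fun a => Finset.univ.image (w a))
      · rw [if_pos ⟨h3, h4⟩, Int.cast_one, one_smul]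
        simp only [if_pos h4]
        refine Finset.prod_congr rfl fun a _ => ?_
        rw [Fintype.mem_piFinset] at h3
        rw [Finset.prod_image fun i _ j _ hij => mem_injWords.mp (h3 a) hij]
      · rw [if_neg (fun h => h4 h.2), Int.cast_zero, zero_smul]
        simp only [if_neg h4]
    · rw [if_neg (fun h => h3 h.1), if_neg h3, Int.cast_zero, zero_smul]
  rw [h1, Finset.sum_congr rfl fun w _ => h2 w, ← Finset.sum_filter, Finset.filter_mem_eq_inter,
    Finset.univ_inter, sum_pi_injWords (fun T : α → Finset D => if Function.Injective T then
      ∏ a, ∏ d ∈ T a, (X d : MvPolynomial D κ) else 0)]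
  -- a family of `α` distinct `β`-subsets is an ordering of a set of such subsets
  have h3 : (∑ T ∈ Fintype.piFinset fun _ : α => Finset.univ.powersetCard (Fintype.card β),
      if Function.Injective T then ∏ a, ∏ d ∈ T a, (X d : MvPolynomial D κ) else 0) =
      (Fintype.card α).factorial •
      ∑ S ∈ (Finset.univ.powersetCard (Fintype.card β) : Finset (Finset D)).powersetCard
      (Fintype.card α), ∏ s ∈ S, ∏ d ∈ s, (X d : MvPolynomial D κ) := by
    have h4 := sum_injWords (ι := α) (fun S : Finset (Finset D) =>
      if S ⊆ Finset.univ.powersetCard (Fintype.card β) then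
        ∏ s ∈ S, ∏ d ∈ s, (X d : MvPolynomial D κ) else 0)
    have h5 : (Finset.univ.powersetCard (Fintype.card β) : Finset (Finset D)).powersetCard
      (Fintype.card α) = (Finset.univ.powersetCard (Fintype.card α)).filter fun S =>
        S ⊆ (Finset.univ.powersetCard (Fintype.card β) : Finset (Finset D)) := by
      ext S
      simp only [Finset.mem_powersetCard, Finset.mem_filter, Finset.subset_univ, true_and]
      exact and_comm
    rw [h5, Finset.sum_filter, ← h4, ← Finset.sum_filter, ← Finset.sum_filter]
    refine Finset.sum_congr ?_ fun T hT => ?_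
    · ext T
      simp only [Finset.mem_filter, Fintype.mem_piFinset, mem_injWords, Finset.image_subset_iff,
        Finset.mem_univ, true_implies]
      exact and_comm
    · rw [Finset.prod_image fun i _ j _ hij => mem_injWords.mp (Finset.mem_filter.mp hT).1 hij]
  rw [h3, ← Nat.cast_smul_eq_nsmul κ, ← Nat.cast_smul_eq_nsmul κ, Nat.cast_pow,
    smul_smul _ ((Fintype.card β).factorial ^ Fintype.card α : κ), inv_mul_cancel₀, one_smul,
    smul_smul, inv_mul_cancel₀, one_smul]
  · exact Nat.cast_ne_zero.mpr (Nat.factorial_ne_zero _)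
  · exact pow_ne_zero _ (Nat.cast_ne_zero.mpr (Nat.factorial_ne_zero _))

end WreathCharacters

/-! ### Coherence for permutations of tensor factors -/

section Coherence

variable {C : Type u} [Category.{v} C] [MonoidalCategory C] [SymmetricCategory C]

/-- The symmetry of tensor powers attached to a bijection; the source and the target are tensor
powers whose exponents are equal, but perhaps not definitionally so. -/
def permHom (X : C) {n n' : ℕ} (σ : Fin n ≃ Fin n') : tpow X n ⟶ tpow X n' :=
  permMor X n (σ.trans (finCongr (Fin.equiv_iff_eq.mp ⟨σ⟩).symm)) ≫
    eqToHom (by rw [Fin.equiv_iff_eq.mp ⟨σ⟩])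

theorem permHom_perm (X : C) {n : ℕ} (σ : Perm (Fin n)) : permHom X σ = permMor X n σ := by
  simp only [permHom, eqToHom_refl, Category.comp_id]
  rfl

theorem permHom_trans (X : C) {n n' n'' : ℕ} (σ : Fin n ≃ Fin n') (τ : Fin n' ≃ Fin n'') :
    permHom X σ ≫ permHom X τ = permHom X (σ.trans τ) := by
  obtain rfl := Fin.equiv_iff_eq.mp ⟨σ⟩
  obtain rfl := Fin.equiv_iff_eq.mp ⟨τ⟩
  rw [permHom_perm, permHom_perm, permHom_perm, ← permMor_mul]
  rfl

theorem permHom_trans_assoc (X : C) {n n' n'' : ℕ} (σ : Fin n ≃ Fin n') (τ : Fin n' ≃ Fin n'')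
    {Z : C} (h : tpow X n'' ⟶ Z) :
    permHom X σ ≫ permHom X τ ≫ h = permHom X (σ.trans τ) ≫ h := by
  rw [← permHom_trans, Category.assoc]

theorem permHom_refl (X : C) (n : ℕ) : permHom X (Equiv.refl (Fin n)) = 𝟙 _ := by
  rw [permHom_perm]; exact permMor_one X n

/-- `permHom` as an isomorphism. -/
@[simps] def permIso (X : C) {n n' : ℕ} (σ : Fin n ≃ Fin n') : tpow X n ≅ tpow X n' where
  hom := permHom X σ
  inv := permHom X σ.symm
  hom_inv_id := by rw [permHom_trans, Equiv.self_trans_symm, permHom_refl]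
  inv_hom_id := by rw [permHom_trans, Equiv.symm_trans_self, permHom_refl]

theorem whiskerLeft_permHom (X : C) {n n' : ℕ} (σ : Fin n ≃ Fin n')
    (τ : Fin (n + 1) ≃ Fin (n' + 1)) (h0 : τ 0 = 0) (hs : ∀ j, τ j.succ = (σ j).succ) :
    X ◁ permHom X σ = permHom X τ := by
  obtain rfl := Fin.equiv_iff_eq.mp ⟨σ⟩
  rw [permHom_perm, permHom_perm, permMor, tailPerm_eq τ σ (by simpa [h0] using hs), h0]
  cases n <;> exact (Category.comp_id _).symm

/-- The isomorphism `X^{⊗ n} ⊗ X^{⊗ m} ≅ X^{⊗ (n + m)}`. -/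
def tpowAdd (X : C) : (n m : ℕ) → (tpow X n ⊗ tpow X m ≅ tpow X (n + m))
  | 0, m => λ_ _ ≪≫ permIso X (finCongr (zero_add m).symm)
  | n + 1, m => α_ _ _ _ ≪≫ whiskerLeftIso X (tpowAdd X n m) ≪≫
      permIso X (finCongr (by omega : n + m + 1 = n + 1 + m))

theorem tpowAdd_zero_hom (X : C) (m : ℕ) :
    (tpowAdd X 0 m).hom = (λ_ _).hom ≫ permHom X (finCongr (zero_add m).symm) := rfl

theorem tpowAdd_succ_hom (X : C) (n m : ℕ) :
    (tpowAdd X (n + 1) m).hom = (α_ X (tpow X n) (tpow X m)).hom ≫ X ◁ (tpowAdd X n m).hom ≫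
      permHom X (finCongr (by omega : n + m + 1 = n + 1 + m)) := rfl

/-- The juxtaposition of bijections. -/
def sumFin {n n' m m' : ℕ} (σ : Fin n ≃ Fin n') (τ : Fin m ≃ Fin m') :
    Fin (n + m) ≃ Fin (n' + m') :=
  finSumFinEquiv.symm.trans ((σ.sumCongr τ).trans finSumFinEquiv)

@[simp] theorem sumFin_castAdd {n n' m m' : ℕ} (σ : Fin n ≃ Fin n') (τ : Fin m ≃ Fin m')
    (i : Fin n) : sumFin σ τ (Fin.castAdd m i) = Fin.castAdd m' (σ i) := by
  simp [sumFin]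

@[simp] theorem sumFin_natAdd {n n' m m' : ℕ} (σ : Fin n ≃ Fin n') (τ : Fin m ≃ Fin m')
    (i : Fin m) : sumFin σ τ (Fin.natAdd n i) = Fin.natAdd n' (τ i) := by
  simp [sumFin]

theorem sumFin_swap {n m : ℕ} (a b : Fin n) : sumFin (swap a b) (Equiv.refl (Fin m)) =
    swap (Fin.castAdd m a) (Fin.castAdd m b) := by
  ext j
  induction j using Fin.addCases with
  | left i =>
    rw [sumFin_castAdd]
    simp only [swap_apply_def, Fin.ext_iff, Fin.val_castAdd]
    split_ifs <;> rfl
  | right i =>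
    rw [sumFin_natAdd, swap_apply_of_ne_of_ne, Equiv.refl_apply]
    · simp [Fin.ext_iff]; omega
    · simp [Fin.ext_iff]; omega

theorem sumFin_cast_zero {m m' : ℕ} (σ : Fin 0 ≃ Fin 0) (τ : Fin m ≃ Fin m') (j : Fin m) :
    sumFin σ τ (Fin.cast (zero_add m).symm j) = Fin.cast (zero_add m').symm (τ j) := by
  have := sumFin_natAdd σ τ j
  rwa [show (Fin.natAdd 0 j) = Fin.cast (zero_add m).symm j from Fin.ext (by simp),
    show (Fin.natAdd 0 (τ j)) = Fin.cast (zero_add m').symm (τ j) from Fin.ext (by simp)] at this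

theorem sumFin_cast_succ {n n' m m' : ℕ} (σ : Fin n ≃ Fin n') (τ : Fin m ≃ Fin m')
    (ρ : Fin (n + 1) ≃ Fin (n' + 1)) (h0 : ρ 0 = 0) (hs : ∀ j, ρ j.succ = (σ j).succ)
    (π : Fin (n + m + 1) ≃ Fin (n' + m' + 1)) (h0' : π 0 = 0)
    (hs' : ∀ j, π j.succ = (sumFin σ τ j).succ) (j : Fin (n + m + 1)) :
    sumFin ρ τ (Fin.cast (by omega) j) = Fin.cast (by omega) (π j) := by
  induction j using Fin.cases with
  | zero =>
    rw [h0', show (Fin.cast (by omega) (0 : Fin (n + m + 1)) : Fin (n + 1 + m)) =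
      Fin.castAdd m 0 from Fin.ext (by simp), sumFin_castAdd, h0]
    exact Fin.ext (by simp)
  | succ j =>
    rw [hs']
    induction j using Fin.addCases with
    | left i =>
      rw [show (Fin.cast (by omega) (Fin.castAdd m i).succ : Fin (n + 1 + m)) =
        Fin.castAdd m i.succ from Fin.ext (by simp), sumFin_castAdd, hs, sumFin_castAdd]
      exact Fin.ext (by simp)
    | right i =>
      rw [show (Fin.cast (by omega) (Fin.natAdd n i).succ : Fin (n + 1 + m)) =
        Fin.natAdd (n + 1) i from Fin.ext (by simp; omega), sumFin_natAdd, sumFin_natAdd]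
      exact Fin.ext (by simp; omega)

/-- The extension of a bijection by `0 ↦ 0`. -/
def consFin {n n' : ℕ} (σ : Fin n ≃ Fin n') : Fin (n + 1) ≃ Fin (n' + 1) :=
  (finSuccEquiv n).trans ((Equiv.optionCongr σ).trans (finSuccEquiv n').symm)

@[simp] theorem consFin_zero {n n' : ℕ} (σ : Fin n ≃ Fin n') : consFin σ 0 = 0 := by
  simp [consFin]

@[simp] theorem consFin_succ {n n' : ℕ} (σ : Fin n ≃ Fin n') (j : Fin n) :
    consFin σ j.succ = (σ j).succ := by
  simp [consFin]

theorem whiskerLeft_permHom' (X : C) {n n' : ℕ} (σ : Fin n ≃ Fin n') :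
    X ◁ permHom X σ = permHom X (consFin σ) :=
  whiskerLeft_permHom X σ _ (consFin_zero σ) (consFin_succ σ)

/-- Naturality of `tpowAdd` in the second factor. -/
theorem whiskerLeft_tpowAdd (X : C) : ∀ (n : ℕ) {m m' : ℕ} (τ : Fin m ≃ Fin m'),
    tpow X n ◁ permHom X τ ≫ (tpowAdd X n m').hom =
      (tpowAdd X n m).hom ≫ permHom X (sumFin (Equiv.refl _) τ)
  | 0, m, m', τ => by
    rw [tpowAdd_zero_hom, tpowAdd_zero_hom, Category.assoc, permHom_trans]
    erw [leftUnitor_naturality_assoc]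
    rw [permHom_trans]
    congr 2
    ext j
    simp [sumFin_cast_zero]
  | n + 1, m, m', τ => by
    have ih := whiskerLeft_tpowAdd X n τ
    have h1 : tpow X (n + 1) ◁ permHom X τ ≫ (α_ X (tpow X n) (tpow X m')).hom =
      (α_ X (tpow X n) (tpow X m)).hom ≫ X ◁ (tpow X n ◁ permHom X τ) := by simp
    rw [tpowAdd_succ_hom, tpowAdd_succ_hom, reassoc_of% h1, ← whiskerLeft_comp_assoc, ih,
      whiskerLeft_comp, Category.assoc, Category.assoc, Category.assoc, whiskerLeft_permHom',
      permHom_trans, permHom_trans]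
    congr 3
    ext j
    have := sumFin_cast_succ (Equiv.refl (Fin n)) τ (Equiv.refl _) rfl (fun _ => rfl) _
      (consFin_zero _) (consFin_succ _) j
    simp only [Equiv.trans_apply, finCongr_apply]
    rw [this]

theorem swapFirst_eq_permHom (X : C) (n : ℕ) :
    swapFirst X (tpow X n) = permHom X (swap (0 : Fin (n + 2)) 1) := by
  rw [permHom_perm]
  exact (permMor_swap X (n + 2) 0 (by omega)).symm

/-- Naturality of `tpowAdd` in the first factor, for the adjacent transpositions, which generate the
symmetric group. -/
theorem adj_whiskerRight_tpowAdd (X : C) : ∀ (n i : ℕ) (h : i + 1 < n) (m : ℕ),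
    adj X n i ▷ tpow X m ≫ (tpowAdd X n m).hom =
      (tpowAdd X n m).hom ≫ permHom X (sumFin (swap ⟨i, by omega⟩ ⟨i + 1, h⟩) (Equiv.refl _))
  | n + 2, 0, h, m => by
    have h1 : swapFirst X (tpow X n) ▷ tpow X m ≫ (α_ X (X ⊗ tpow X n) (tpow X m)).hom ≫
        X ◁ (α_ X (tpow X n) (tpow X m)).hom =
        (α_ X (X ⊗ tpow X n) (tpow X m)).hom ≫ X ◁ (α_ X (tpow X n) (tpow X m)).hom ≫
        swapFirst X (tpow X n ⊗ tpow X m) := by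
      simp only [swapFirst]
      monoidal
    have h2 := swapFirst_natural X (tpowAdd X n m).hom
    have h3 : adj X (n + 2) 0 = swapFirst X (tpow X n) := rfl
    rw [tpowAdd_succ_hom, tpowAdd_succ_hom, h3, whiskerLeft_comp, whiskerLeft_comp]
    simp only [Category.assoc]
    rw [reassoc_of% h1, ← reassoc_of% h2, swapFirst_eq_permHom, whiskerLeft_permHom',
      permHom_trans, permHom_trans, permHom_trans, permHom_trans]
    congr 4
    ext j
    simp only [Equiv.trans_apply, finCongr_apply, sumFin_swap]
    -- check the equality of permutations on the two exchanged positions and on the others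
    obtain ⟨j, rfl⟩ | ⟨j, rfl⟩ : (∃ k : Fin (n + m), j = k.succ.succ) ∨
      ∃ k : Fin 2, j = Fin.castLE (by omega) k := by
      rcases Nat.lt_or_ge j.val 2 with h2 | h2
      · exact Or.inr ⟨⟨j, h2⟩, rfl⟩
      · exact Or.inl ⟨⟨j - 2, by omega⟩, Fin.ext (by simp; omega)⟩
    · rw [swap_apply_of_ne_of_ne, consFin_succ, swap_apply_of_ne_of_ne] <;>
        simp [Fin.ext_iff]
    · have h5 : ∀ h : n + m + 1 = n + 1 + m, consFin (finCongr h) 1 =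
          Fin.cast (by omega) (1 : Fin (n + m + 2)) := fun h => by
        rw [show (1 : Fin (n + m + 2)) = (0 : Fin (n + m + 1)).succ from rfl, consFin_succ]
        exact Fin.ext (by simp)
      obtain rfl | rfl : j = 0 ∨ j = 1 := by omega
      · rw [show Fin.castLE (by omega) (0 : Fin 2) = (0 : Fin (n + m + 2)) from rfl,
          swap_apply_left, h5, consFin_zero]
        erw [swap_apply_left]
        rfl
      · rw [show Fin.castLE (by omega) (1 : Fin 2) = (1 : Fin (n + m + 2)) from rfl,
          swap_apply_right, h5, consFin_zero]
        erw [swap_apply_right]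
        rfl
  | n + 1, i + 1, h, m => by
    have ih := adj_whiskerRight_tpowAdd X n i (by omega) m
    have h0 : adj X (n + 1) (i + 1) = X ◁ adj X n i := rfl
    have h1 : (X ◁ adj X n i) ▷ tpow X m ≫ (α_ X (tpow X n) (tpow X m)).hom =
      (α_ X (tpow X n) (tpow X m)).hom ≫ X ◁ (adj X n i ▷ tpow X m) := by simp
    rw [tpowAdd_succ_hom, h0, reassoc_of% h1, ← whiskerLeft_comp_assoc, ih,
      whiskerLeft_comp, Category.assoc, Category.assoc, Category.assoc, whiskerLeft_permHom',
      permHom_trans, permHom_trans]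
    congr 3
    ext j
    have := sumFin_cast_succ (swap ⟨i, by omega⟩ ⟨i + 1, by omega⟩ : Perm (Fin n))
      (Equiv.refl (Fin m)) (swap ⟨i + 1, by omega⟩ ⟨i + 1 + 1, h⟩)
      (swap_apply_of_ne_of_ne (by simp [Fin.ext_iff]) (by simp [Fin.ext_iff]))
      (fun j => by
        simp only [swap_apply_def, Fin.ext_iff, Fin.val_succ]
        split_ifs <;> simp_all) _
      (consFin_zero _) (consFin_succ _) j
    simp only [Equiv.trans_apply, finCongr_apply]
    rw [this]

end Coherence

/-! ### Tensor powers with labelled factors -/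

section Labels

variable {C : Type u} [Category.{v} C] [MonoidalCategory C] [SymmetricCategory C]

theorem sumFin_trans {n n' n'' m m' m'' : ℕ} (σ : Fin n ≃ Fin n') (σ' : Fin n' ≃ Fin n'')
    (τ : Fin m ≃ Fin m') (τ' : Fin m' ≃ Fin m'') :
    (sumFin σ τ).trans (sumFin σ' τ') = sumFin (σ.trans σ') (τ.trans τ') := by
  refine Equiv.ext fun j => ?_
  induction j using Fin.addCases <;> simp

theorem sumFin_finCongr {n n' m m' : ℕ} (h : n = n') (h' : m = m') :
    sumFin (finCongr h) (finCongr h') = finCongr (by rw [h, h']) := by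
  subst h h'
  refine Equiv.ext fun j => ?_
  induction j using Fin.addCases <;> simp

theorem sumFin_refl {n m : ℕ} :
    sumFin (Equiv.refl (Fin n)) (Equiv.refl (Fin m)) = Equiv.refl _ :=
  sumFin_finCongr rfl rfl

theorem permMor_whiskerRight_tpowAdd (X : C) (n m : ℕ) (σ : Perm (Fin n)) :
    permMor X n σ ▷ tpow X m ≫ (tpowAdd X n m).hom =
      (tpowAdd X n m).hom ≫ permHom X (sumFin σ (Equiv.refl _)) := by
  rcases n with - | n
  · rw [Subsingleton.elim σ 1, permMor_one, id_whiskerRight, Category.id_comp]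
    erw [sumFin_refl, permHom_refl, Category.comp_id]
  have hσ : σ ∈ Submonoid.closure (Set.range fun i : Fin n => swap i.castSucc i.succ) := by
    rw [Perm.mclosure_swap_castSucc_succ]; trivial
  induction hσ using Submonoid.closure_induction with
  | mem x hx =>
    obtain ⟨i, rfl⟩ := hx
    have h1 := adj_whiskerRight_tpowAdd X (n + 1) i (by omega) m
    rw [← permMor_swap X (n + 1) i (by omega)] at h1
    exact h1
  | one =>
    rw [permMor_one, id_whiskerRight, Category.id_comp]
    erw [sumFin_refl, permHom_refl, Category.comp_id]
  | mul x y _ _ hx hy =>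
    rw [permMor_mul, comp_whiskerRight, Category.assoc, hx, reassoc_of% hy, permHom_trans,
      sumFin_trans]
    rfl

theorem tensor_permHom (X : C) {n n' m m' : ℕ} (σ : Fin n ≃ Fin n') (τ : Fin m ≃ Fin m') :
    (permHom X σ ⊗ₘ permHom X τ) ≫ (tpowAdd X n' m').hom =
      (tpowAdd X n m).hom ≫ permHom X (sumFin σ τ) := by
  obtain rfl := Fin.equiv_iff_eq.mp ⟨σ⟩
  rw [MonoidalCategory.tensorHom_def, Category.assoc, whiskerLeft_tpowAdd, permHom_perm,
    reassoc_of% permMor_whiskerRight_tpowAdd X n m σ, permHom_trans, sumFin_trans]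
  rfl

theorem permHom_finCongr_whiskerRight (X : C) {n n' : ℕ} (h : n = n') (m : ℕ) :
    permHom X (finCongr h) ▷ tpow X m ≫ (tpowAdd X n' m).hom =
      (tpowAdd X n m).hom ≫ permHom X (finCongr (by rw [h])) := by
  subst h
  have h1 : ∀ k, permHom X (finCongr (rfl : k = k)) = 𝟙 _ := permHom_refl X
  rw [h1, h1, id_whiskerRight, Category.id_comp, Category.comp_id]

theorem tpowAdd_assoc (X : C) : ∀ n m k : ℕ,
    (tpowAdd X n m).hom ▷ tpow X k ≫ (tpowAdd X (n + m) k).hom =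
      (α_ _ _ _).hom ≫ tpow X n ◁ (tpowAdd X m k).hom ≫ (tpowAdd X n (m + k)).hom ≫
        permHom X (finCongr (add_assoc n m k).symm)
  | 0, m, k => by
    rw [tpowAdd_zero_hom, tpowAdd_zero_hom, comp_whiskerRight, Category.assoc,
      permHom_finCongr_whiskerRight]
    have h1 : tpow X 0 ◁ (tpowAdd X m k).hom ≫ (λ_ (tpow X (m + k))).hom =
      (λ_ _).hom ≫ (tpowAdd X m k).hom := leftUnitor_naturality _
    rw [Category.assoc, reassoc_of% h1, permHom_trans]
    have h2 : (λ_ (tpow X m)).hom ▷ tpow X k =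
      (α_ (tpow X 0) (tpow X m) (tpow X k)).hom ≫ (λ_ _).hom := by
        exact leftUnitor_whiskerRight _ _
    rw [h2, Category.assoc]
    rfl
  | n + 1, m, k => by
    have ih := tpowAdd_assoc X n m k
    rw [tpowAdd_succ_hom, comp_whiskerRight, comp_whiskerRight, Category.assoc, Category.assoc,
      permHom_finCongr_whiskerRight, tpowAdd_succ_hom, tpowAdd_succ_hom]
    have h1 : (X ◁ (tpowAdd X n m).hom) ▷ tpow X k ≫ (α_ X (tpow X (n + m)) (tpow X k)).hom =
      (α_ X (tpow X n ⊗ tpow X m) (tpow X k)).hom ≫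
        X ◁ ((tpowAdd X n m).hom ▷ tpow X k) := by simp
    have h2 : tpow X (n + 1) ◁ (tpowAdd X m k).hom ≫ (α_ X (tpow X n) (tpow X (m + k))).hom =
      (α_ X (tpow X n) (tpow X m ⊗ tpow X k)).hom ≫
        X ◁ (tpow X n ◁ (tpowAdd X m k).hom) := by simp
    have h3 : (α_ X (tpow X n) (tpow X m)).hom ▷ tpow X k ≫
        (α_ X (tpow X n ⊗ tpow X m) (tpow X k)).hom ≫
        X ◁ (α_ (tpow X n) (tpow X m) (tpow X k)).hom =
        (α_ (tpow X (n + 1)) (tpow X m) (tpow X k)).hom ≫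
        (α_ X (tpow X n) (tpow X m ⊗ tpow X k)).hom := by
      exact pentagon _ _ _ _
    simp only [Category.assoc]
    rw [reassoc_of% h1, reassoc_of% h2, ← whiskerLeft_comp_assoc, ih]
    simp only [whiskerLeft_comp, Category.assoc]
    rw [reassoc_of% h3, whiskerLeft_permHom', permHom_trans, permHom_trans, permHom_trans]
    congr 5
    ext j
    induction j using Fin.cases <;> simp

theorem tpowAdd_zero_right (X : C) : ∀ n : ℕ, (tpowAdd X n 0).hom = (ρ_ (tpow X n)).hom
  | 0 => by
    rw [tpowAdd_zero_hom]
    erw [permHom_refl X 0, Category.comp_id]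
    exact unitors_equal
  | n + 1 => by
    rw [tpowAdd_succ_hom, tpowAdd_zero_right X n]
    erw [permHom_refl X (n + 1), Category.comp_id]
    simp

/-- An identification of `P` with the tensor product of copies of `X` indexed by `ι`. Since the
monoidal category is not strict, tensor products such as `X^{⊗ n} ⊗ X^{⊗ m}` or `(X^{⊗ r})^{⊗ m}`
are not tensor powers of `X`; the labelling keeps track of the factors through such
identifications, and the structure morphisms become bijections of the labels. -/
structure Label (X P : C) (ι : Type*) where
  /-- the number of factors -/
  n : ℕ
  /-- the enumeration of the factors -/
  e : ι ≃ Fin n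
  /-- the identification -/
  iso : P ≅ tpow X n

namespace Label

variable {X P Q R P' Q' : C} {ι ι' ι'' κ κ' : Type*}

/-- The morphism between labelled objects that permutes the tensor factors as prescribed. -/
def map (L : Label X P ι) (M : Label X Q ι') (σ : ι ≃ ι') : P ⟶ Q :=
  L.iso.hom ≫ permHom X (L.e.symm.trans (σ.trans M.e)) ≫ M.iso.inv

theorem symm_trans_eq {α β γ : Type*} {e : α ≃ β} {f : α ≃ γ} {g : β ≃ γ}
    (h : ∀ x, f x = g (e x)) : e.symm.trans f = g :=
  Equiv.ext fun y => by simp [h]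

theorem map_trans (L : Label X P ι) (M : Label X Q ι') (N : Label X R ι'') (σ : ι ≃ ι')
    (τ : ι' ≃ ι'') : L.map M σ ≫ M.map N τ = L.map N (σ.trans τ) := by
  simp only [map, Category.assoc, Iso.inv_hom_id_assoc, permHom_trans_assoc]
  congr 3
  ext j
  simp

theorem map_refl (L : Label X P ι) : L.map L (Equiv.refl ι) = 𝟙 P := by
  rw [map, show L.e.symm.trans ((Equiv.refl ι).trans L.e) = Equiv.refl _ by ext; simp,
    permHom_refl, Category.id_comp, Iso.hom_inv_id]

theorem map_symm_eq (L : Label X P ι) (M : Label X Q ι') (σ : ι ≃ ι') {f : P ≅ Q}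
    (hf : f.hom = L.map M σ) : f.inv = M.map L σ.symm := by
  rw [← cancel_epi f.hom, Iso.hom_inv_id, hf, map_trans, Equiv.self_trans_symm, map_refl]

/-- The labelling of a tensor product. -/
def tensor (L : Label X P ι) (M : Label X Q κ) : Label X (P ⊗ Q) (ι ⊕ κ) where
  n := L.n + M.n
  e := (L.e.sumCongr M.e).trans finSumFinEquiv
  iso := (L.iso ⊗ᵢ M.iso) ≪≫ tpowAdd X L.n M.n

/-- The tensor product of two permutations of factors acts on the disjoint union of the labels. -/
theorem map_tensor (L : Label X P ι) (L' : Label X P' ι') (M : Label X Q κ) (M' : Label X Q' κ')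
    (σ : ι ≃ ι') (τ : κ ≃ κ') : (L.map L' σ ⊗ₘ M.map M' τ) =
      (L.tensor M).map (L'.tensor M') (σ.sumCongr τ) := by
  have h : (L.tensor M).e.symm.trans ((σ.sumCongr τ).trans (L'.tensor M').e) =
      sumFin (L.e.symm.trans (σ.trans L'.e)) (M.e.symm.trans (τ.trans M'.e)) := by
    refine symm_trans_eq ?_
    rintro (i | i)
    · change finSumFinEquiv (Sum.inl (L'.e (σ i))) = sumFin _ _ (finSumFinEquiv (Sum.inl (L.e i)))
      simp
    · change finSumFinEquiv (Sum.inr (M'.e (τ i))) = sumFin _ _ (finSumFinEquiv (Sum.inr (M.e i)))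
      simp
  conv_rhs => rw [map, h]
  simp only [map, tensor, Iso.trans_hom, Iso.trans_inv, Category.assoc, tensorIso_hom,
    tensorIso_inv]
  rw [← reassoc_of% tensor_permHom X, Iso.hom_inv_id_assoc]
  simp

theorem map_whiskerRight (L : Label X P ι) (L' : Label X P' ι') (M : Label X Q κ) (σ : ι ≃ ι') :
    L.map L' σ ▷ Q = (L.tensor M).map (L'.tensor M) (σ.sumCongr (Equiv.refl κ)) := by
  rw [← map_tensor, map_refl, tensorHom_id]

theorem map_whiskerLeft (L : Label X P ι) (M : Label X Q κ) (M' : Label X Q' κ') (τ : κ ≃ κ') :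
    P ◁ M.map M' τ = (L.tensor M).map (L.tensor M') ((Equiv.refl ι).sumCongr τ) := by
  rw [← map_tensor, map_refl, id_tensorHom]

/-- The associator is the permutation of factors given by the associativity of disjoint unions. -/
theorem associator_hom_eq (L : Label X P ι) (M : Label X Q ι') (N : Label X R ι'') :
    (α_ P Q R).hom =
      ((L.tensor M).tensor N).map (L.tensor (M.tensor N)) (Equiv.sumAssoc ι ι' ι'') := by
  have h : ((L.tensor M).tensor N).e.symm.trans
      ((Equiv.sumAssoc ι ι' ι'').trans (L.tensor (M.tensor N)).e) =
      finCongr (add_assoc L.n M.n N.n) := by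
    refine symm_trans_eq ?_
    rintro ((i | i) | i)
    · exact Fin.ext rfl
    · exact Fin.ext rfl
    · exact Fin.ext (add_assoc _ _ _).symm
  have h1 := tpowAdd_assoc X L.n M.n N.n
  have h2 : (tpowAdd X L.n M.n).hom ▷ tpow X N.n ≫ (tpowAdd X (L.n + M.n) N.n).hom ≫
      permHom X (finCongr (add_assoc L.n M.n N.n)) =
      (α_ _ _ _).hom ≫ tpow X L.n ◁ (tpowAdd X M.n N.n).hom ≫ (tpowAdd X L.n (M.n + N.n)).hom := by
    rw [reassoc_of% h1, permHom_trans]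
    erw [permHom_refl, Category.comp_id]
  rw [map, h, ← Category.assoc, Iso.eq_comp_inv]
  change (α_ P Q R).hom ≫ (L.iso.hom ⊗ₘ ((M.iso.hom ⊗ₘ N.iso.hom) ≫ (tpowAdd X M.n N.n).hom)) ≫
    (tpowAdd X L.n (M.n + N.n)).hom = ((((L.iso.hom ⊗ₘ M.iso.hom) ≫ (tpowAdd X L.n M.n).hom) ⊗ₘ
    N.iso.hom) ≫ (tpowAdd X (L.n + M.n) N.n).hom) ≫ permHom X (finCongr (add_assoc L.n M.n N.n))
  have h3 : (L.iso.hom ⊗ₘ ((M.iso.hom ⊗ₘ N.iso.hom) ≫ (tpowAdd X M.n N.n).hom)) =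
      (L.iso.hom ⊗ₘ (M.iso.hom ⊗ₘ N.iso.hom)) ≫ tpow X L.n ◁ (tpowAdd X M.n N.n).hom := by
    simp [MonoidalCategory.tensorHom_def]
  have h4 : (((L.iso.hom ⊗ₘ M.iso.hom) ≫ (tpowAdd X L.n M.n).hom) ⊗ₘ N.iso.hom) =
      ((L.iso.hom ⊗ₘ M.iso.hom) ⊗ₘ N.iso.hom) ≫ (tpowAdd X L.n M.n).hom ▷ tpow X N.n := by
    rw [← tensorHom_id, tensorHom_comp_tensorHom, Category.comp_id]
  rw [h3, h4, Category.assoc, Category.assoc, Category.assoc, h2, ← associator_naturality_assoc]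

/-- Transport of a labelling along a bijection of the index sets. -/
def reindex (L : Label X P ι) (ρ : ι ≃ ι') : Label X P ι' := ⟨L.n, ρ.symm.trans L.e, L.iso⟩

theorem map_reindex (L : Label X P ι) (M : Label X Q κ) (ρ : ι ≃ ι') (π : κ ≃ κ') (σ : ι' ≃ κ') :
    (L.reindex ρ).map (M.reindex π) σ = L.map M ((ρ.trans σ).trans π.symm) := by
  rw [map, map]
  rfl

/-- The tautological labelling of a tensor power. -/
def std (X : C) (n : ℕ) : Label X (tpow X n) (Fin n) := ⟨n, Equiv.refl _, Iso.refl _⟩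

theorem map_std (X : C) {n m : ℕ} (σ : Fin n ≃ Fin m) :
    (std X n).map (std X m) σ = permHom X σ := by
  simp only [map, std, Iso.refl_hom, Iso.refl_inv, Category.comp_id]
  erw [Category.id_comp]
  rfl

/-- The labelling of the unit object by an empty set. -/
def unit (X : C) (ι : Type*) [IsEmpty ι] : Label X (𝟙_ C) ι := ⟨0, Equiv.equivOfIsEmpty _ _, Iso.refl _⟩

/-- The labelling of `X` itself. -/
def single (X : C) : Label X X Unit := ⟨1, Equiv.ofUnique _ _, (ρ_ X).symm⟩

theorem leftUnitor_hom_eq (L : Label X P ι) (κ : Type*) [IsEmpty κ] :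
    (λ_ P).hom = ((unit X κ).tensor L).map L (Equiv.emptySum κ ι) := by
  have h : ((unit X κ).tensor L).e.symm.trans ((Equiv.emptySum κ ι).trans L.e) =
      finCongr (zero_add L.n) := by
    refine symm_trans_eq ?_
    rintro (i | i)
    · exact isEmptyElim i
    · refine Fin.ext ?_
      change (L.e i).val = 0 + (L.e i).val
      rw [zero_add]
  rw [map, h, ← Category.assoc, Iso.eq_comp_inv]
  change _ = ((𝟙 (𝟙_ C) ⊗ₘ L.iso.hom) ≫ (λ_ _).hom ≫ permHom X _) ≫ permHom X _
  rw [Category.assoc, Category.assoc, permHom_trans]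
  erw [permHom_refl, Category.comp_id]
  simp

theorem rightUnitor_hom_eq (L : Label X P ι) (κ : Type*) [IsEmpty κ] :
    (ρ_ P).hom = (L.tensor (unit X κ)).map L (Equiv.sumEmpty ι κ) := by
  have h : (L.tensor (unit X κ)).e.symm.trans ((Equiv.sumEmpty ι κ).trans L.e) =
      Equiv.refl (Fin L.n) := by
    refine symm_trans_eq ?_
    rintro (i | i)
    · exact Fin.ext rfl
    · exact isEmptyElim i
  rw [map, h, ← Category.assoc, Iso.eq_comp_inv]
  change _ = ((L.iso.hom ⊗ₘ 𝟙 (𝟙_ C)) ≫ (tpowAdd X L.n 0).hom) ≫ permHom X _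
  rw [tpowAdd_zero_right]
  erw [permHom_refl, Category.comp_id]
  simp

theorem tpowAdd_one (X : C) (m : ℕ) : (ρ_ X).inv ▷ tpow X m ≫ (tpowAdd X 1 m).hom =
    permHom X (finCongr (add_comm m 1)) := by
  rw [tpowAdd_succ_hom, tpowAdd_zero_hom, whiskerLeft_comp, whiskerLeft_permHom', Category.assoc,
    permHom_trans]
  have h : (ρ_ X).inv ▷ tpow X m ≫ (α_ X (tpow X 0) (tpow X m)).hom ≫ X ◁ (λ_ (tpow X m)).hom =
      𝟙 _ := by simp
  erw [reassoc_of% h]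
  congr 1
  ext j
  induction j using Fin.cases <;> simp

/-- The bijection underlying `X ⊗ X^{⊗ n} = X^{⊗ (n + 1)}`. -/
def unitSumFin (n : ℕ) : Unit ⊕ Fin n ≃ Fin (n + 1) :=
  ((Equiv.ofUnique Unit (Fin 1)).sumCongr (Equiv.refl _)).trans
    (finSumFinEquiv.trans (finCongr (add_comm 1 n)))

theorem map_std_succ (X : C) (n : ℕ) :
    ((single X).tensor (std X n)).map (std X (n + 1)) (unitSumFin n) = 𝟙 _ := by
  have h : ((single X).tensor (std X n)).e.symm.trans
      ((unitSumFin n).trans (std X (n + 1)).e) = finCongr (add_comm 1 n) := by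
    refine symm_trans_eq ?_
    rintro (i | i) <;> rfl
  rw [map, h]
  change (((ρ_ X).inv ⊗ₘ 𝟙 (tpow X n)) ≫ (tpowAdd X 1 n).hom) ≫ permHom X _ ≫ 𝟙 _ = _
  rw [tensorHom_id, tpowAdd_one, Category.comp_id]
  exact (permHom_trans X _ _).trans (permHom_refl _ _)

/-- The braiding of two labelled objects exchanges the two sets of factors. -/
def Braids (L : Label X P ι) (M : Label X Q κ) : Prop :=
  (β_ P Q).hom = (L.tensor M).map (M.tensor L) (Equiv.sumComm ι κ)

theorem Braids.symm {L : Label X P ι} {M : Label X Q κ} (h : Braids L M) : Braids M L := by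
  have h1 := map_symm_eq _ _ _ h
  rw [Braids, SymmetricCategory.braiding_swap_eq_inv_braiding, h1]
  rfl

theorem Braids.congr_left {L : Label X P ι} {M : Label X Q κ} (h : Braids L M) {L' : Label X P' ι'}
    (φ : P' ≅ P) (ρ : ι' ≃ ι) (hφ : φ.hom = L'.map L ρ) : Braids L' M := by
  have h1 : (β_ P' Q).hom = φ.hom ▷ Q ≫ (β_ P Q).hom ≫ Q ◁ φ.inv := by
    rw [BraidedCategory.braiding_naturality_left_assoc, ← whiskerLeft_comp, Iso.hom_inv_id,
      whiskerLeft_id, Category.comp_id]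
  rw [Braids, h1, h, hφ, map_symm_eq _ _ _ hφ, map_whiskerRight L' L M, map_whiskerLeft M L L',
    map_trans, map_trans]
  congr 1
  ext (i | i) <;> simp

/-- The hexagon identity reduces the braiding with a tensor product to the braidings with the
factors. -/
theorem Braids.tensor_right {L : Label X P ι} {M : Label X Q ι'} {N : Label X R ι''}
    (h : Braids L M) (h' : Braids L N) : Braids L (M.tensor N) := by
  have h1 : (β_ P (Q ⊗ R)).hom = (α_ P Q R).inv ≫ (β_ P Q).hom ▷ R ≫ (α_ Q P R).hom ≫
      Q ◁ (β_ P R).hom ≫ (α_ Q R P).inv := by simp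
  rw [Braids, h1, h, h', map_symm_eq _ _ _ (associator_hom_eq L M N),
    map_symm_eq _ _ _ (associator_hom_eq M N L), associator_hom_eq M L N,
    map_whiskerRight _ _ N, map_whiskerLeft M, map_trans, map_trans, map_trans, map_trans]
  congr 1
  ext (i | i | i) <;> simp

theorem braids_unit (L : Label X P ι) (κ : Type*) [IsEmpty κ] : Braids L (unit X κ) := by
  have h1 : (β_ P (𝟙_ C)).hom = (ρ_ P).hom ≫ (λ_ P).inv := by simp
  rw [Braids, h1, rightUnitor_hom_eq L κ, map_symm_eq _ _ _ (leftUnitor_hom_eq L κ), map_trans]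
  congr 1
  ext (i | i)
  · simp
  · exact isEmptyElim i

/-- The base case: the braiding of `X` with itself is the transposition of `X^{⊗ 2}`. -/
theorem braids_single (X : C) : Braids (single X) (single X) := by
  have h : ((single X).tensor (single X)).e.symm.trans
      ((Equiv.sumComm Unit Unit).trans ((single X).tensor (single X)).e) =
      swap (0 : Fin 2) 1 := by
    refine symm_trans_eq ?_
    rintro (i | i) <;> exact Fin.ext (by rfl)
  rw [Braids, map, h, ← Category.assoc, Iso.eq_comp_inv]
  have h2 : ((single X).tensor (single X)).iso.hom = X ◁ (ρ_ X).inv := by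
    change ((ρ_ X).inv ⊗ₘ (ρ_ X).inv) ≫ (tpowAdd X 1 1).hom = _
    have h3 : (ρ_ X).inv ▷ (X ⊗ 𝟙_ C) ≫ (tpowAdd X 1 1).hom = 𝟙 _ :=
      (tpowAdd_one X 1).trans (permHom_refl X 2)
    rw [tensorHom_def', Category.assoc, h3]
    exact Category.comp_id _
  rw [h2]
  erw [← swapFirst_eq_permHom X 0]
  simp only [swapFirst]
  change _ = X ◁ (ρ_ X).inv ≫ (α_ X X (𝟙_ C)).inv ≫ (β_ X X).hom ▷ (𝟙_ C) ≫ (α_ X X (𝟙_ C)).hom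
  simp
  rfl

theorem braids_single_std (X : C) : ∀ n : ℕ, Braids (single X) (std X n)
  | 0 => by
    refine (Braids.congr_left (braids_unit (single X) (Fin 0)).symm (Iso.refl _)
      (Equiv.refl _) ?_).symm
    rw [Iso.refl_hom, ← map_refl]
    rfl
  | n + 1 => by
    refine (Braids.congr_left ((braids_single X).tensor_right (braids_single_std X n)).symm
      (Iso.refl _) (unitSumFin n).symm ?_).symm
    exact map_symm_eq _ _ _ (f := Iso.refl _) (map_std_succ X n).symm

theorem braids_std (X : C) (L : Label X P ι) (h : Braids (single X) L) : ∀ n : ℕ,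
    Braids (std X n) L
  | 0 => by
    refine Braids.congr_left (braids_unit L (Fin 0)).symm (Iso.refl _) (Equiv.refl _) ?_
    rw [Iso.refl_hom, ← map_refl]
    rfl
  | n + 1 => by
    refine Braids.congr_left (h.symm.tensor_right (braids_std X L h n).symm).symm
      (Iso.refl _) (unitSumFin n).symm ?_
    exact map_symm_eq _ _ _ (f := Iso.refl _) (map_std_succ X n).symm

theorem iso_hom_eq (L : Label X P ι) : L.iso.hom = L.map (std X L.n) L.e := by
  have h : L.e.symm.trans (L.e.trans (std X L.n).e) = Equiv.refl _ := by
    rw [← Equiv.trans_assoc, Equiv.symm_trans_self]; rfl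
  rw [map, h]
  exact (((Category.comp_id _).symm.trans (congrArg (L.iso.hom ≫ ·) (permHom_refl X L.n).symm)).trans
    (congrArg (L.iso.hom ≫ ·) (Category.comp_id _).symm))

/-- The braiding of any two labelled objects exchanges the two sets of factors. -/
theorem braids (L : Label X P ι) (M : Label X Q κ) : Braids L M := by
  have h : Braids (single X) M :=
    (Braids.congr_left (braids_single_std X M.n).symm M.iso M.e M.iso_hom_eq).symm
  exact Braids.congr_left (braids_std X M h L.n) L.iso L.e L.iso_hom_eq

end Label

end Labels

/-! ### Permutations of blocks of tensor factors -/

section Blocks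

variable {C : Type u} [Category.{v} C] [MonoidalCategory C] [SymmetricCategory C]

/-- The tensor product `f_0 ⊗ ⋯ ⊗ f_{n-1}` of a family of morphisms. -/
def tens {X Y : C} : (n : ℕ) → (Fin n → (X ⟶ Y)) → (tpow X n ⟶ tpow Y n)
  | 0, _ => 𝟙 _
  | n + 1, f => f 0 ⊗ₘ tens n (fun i => f i.succ)

theorem tens_comp {X Y Z : C} : ∀ (n : ℕ) (f : Fin n → (X ⟶ Y)) (g : Fin n → (Y ⟶ Z)),
    tens n f ≫ tens n g = tens n (fun i => f i ≫ g i)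
  | 0, _, _ => Category.comp_id _
  | n + 1, f, g => by
    simp only [tens]
    rw [tensorHom_comp_tensorHom, tens_comp n]

theorem tens_id (X : C) : ∀ n : ℕ, tens n (fun _ => 𝟙 X) = 𝟙 (tpow X n)
  | 0 => rfl
  | n + 1 => by
    simp only [tens]
    rw [tens_id X n]; simp

theorem tens_adj {X Y : C} : ∀ (n i : ℕ) (h : i + 1 < n) (f : Fin n → (X ⟶ Y)),
    tens n f ≫ adj Y n i = adj X n i ≫ tens n (f ∘ swap ⟨i, by omega⟩ ⟨i + 1, h⟩)
  | n + 2, 0, h, f => by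
    have h1 : adj X (n + 2) 0 = swapFirst X (tpow X n) := rfl
    have h2 : adj Y (n + 2) 0 = swapFirst Y (tpow Y n) := rfl
    have h3 : ∀ (a b : X ⟶ Y) (S T : C) (c : S ⟶ T), (a ⊗ₘ (b ⊗ₘ c)) ≫ swapFirst Y T =
        swapFirst X S ≫ (b ⊗ₘ (a ⊗ₘ c)) := by
      intro a b S T c
      have h4 : ((a ⊗ₘ b) ⊗ₘ c) ≫ (β_ Y Y).hom ▷ T = (β_ X X).hom ▷ S ≫ ((b ⊗ₘ a) ⊗ₘ c) := by
        rw [← tensorHom_id, ← tensorHom_id, tensorHom_comp_tensorHom, tensorHom_comp_tensorHom,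
          BraidedCategory.braiding_naturality, Category.comp_id, Category.id_comp]
      simp only [swapFirst, Category.assoc]
      rw [associator_inv_naturality_assoc, reassoc_of% h4, associator_naturality]
    rw [h1, h2]
    simp only [tens]
    rw [h3]
    congr 3
  | n + 1, i + 1, h, f => by
    have ih := tens_adj n i (by omega) (fun i => f i.succ)
    have h1 : adj X (n + 1) (i + 1) = X ◁ adj X n i := rfl
    have h2 : adj Y (n + 1) (i + 1) = Y ◁ adj Y n i := rfl
    have h0 : swap (⟨i + 1, by omega⟩ : Fin (n + 1)) ⟨i + 1 + 1, h⟩ 0 = 0 :=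
      swap_apply_of_ne_of_ne (by simp [Fin.ext_iff]) (by simp [Fin.ext_iff])
    rw [h1, h2]
    simp only [tens]
    rw [← id_tensorHom, ← id_tensorHom, tensorHom_comp_tensorHom, tensorHom_comp_tensorHom, ih,
      Category.comp_id, Category.id_comp, Function.comp_apply, h0]
    congr 3
    funext j
    simp only [Function.comp_apply]
    congr 1
    simp only [swap_apply_def, Fin.ext_iff, Fin.val_succ]
    split_ifs <;> simp_all

/-- The symmetry permutes the factors of a tensor product of morphisms. -/
theorem tens_permMor {X Y : C} (n : ℕ) (σ : Perm (Fin n)) (f : Fin n → (X ⟶ Y)) :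
    tens n f ≫ permMor Y n σ = permMor X n σ ≫ tens n (f ∘ σ.symm) := by
  rcases n with - | n
  · rw [Subsingleton.elim σ 1, permMor_one, permMor_one, Category.comp_id, Category.id_comp]
    rfl
  have hσ : σ ∈ Submonoid.closure (Set.range fun i : Fin n => swap i.castSucc i.succ) := by
    rw [Perm.mclosure_swap_castSucc_succ]; trivial
  induction hσ using Submonoid.closure_induction generalizing f with
  | mem x hx =>
    obtain ⟨i, rfl⟩ := hx
    have h1 := tens_adj (n + 1) i (by omega) f
    rw [← permMor_swap X (n + 1) i (by omega), ← permMor_swap Y (n + 1) i (by omega)] at h1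
    rw [symm_swap]
    exact h1
  | one =>
    rw [permMor_one, permMor_one, Category.comp_id, Category.id_comp]
    rfl
  | mul x y _ _ hx hy =>
    rw [permMor_mul, permMor_mul, reassoc_of% hy, hx, Category.assoc]
    rfl

namespace Label

variable {X P Q : C} {ι ι' κ κ' : Type*}

/-- The action of the symmetric group on a labelled object. -/
def act (L : Label X P ι) : Perm ι →* End P where
  toFun σ := L.map L σ
  map_one' := map_refl L
  map_mul' σ τ := (map_trans L L L τ σ).symm

theorem act_std (X : C) (n : ℕ) : (std X n).act = permAction X n := by
  ext σ
  exact (map_std X σ).trans (permHom_perm X σ)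

theorem tensor_reindex (L : Label X P ι) (M : Label X Q κ) (ρ : κ ≃ κ') :
    L.tensor (M.reindex ρ) = (L.tensor M).reindex ((Equiv.refl ι).sumCongr ρ) := by
  have h : (L.tensor (M.reindex ρ)).e = ((L.tensor M).reindex ((Equiv.refl ι).sumCongr ρ)).e := by
    ext (i | i) <;> rfl
  simp only [tensor, reindex] at h ⊢
  rw [h]

/-- The index set of a family of `m + 1` blocks. -/
def consProd (m : ℕ) (ι : Type*) : ι ⊕ Fin m × ι ≃ Fin (m + 1) × ι where
  toFun := Sum.elim (fun i => (0, i)) (fun p => (p.1.succ, p.2))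
  invFun p := Fin.cases (Sum.inl p.2) (fun a => Sum.inr (a, p.2)) p.1
  left_inv := by rintro (i | i) <;> rfl
  right_inv := by
    rintro ⟨a, i⟩
    induction a using Fin.cases <;> rfl

@[simp] theorem consProd_inl (m : ℕ) (i : ι) : consProd m ι (Sum.inl i) = (0, i) := rfl

@[simp] theorem consProd_inr (m : ℕ) (p : Fin m × ι) :
    consProd m ι (Sum.inr p) = (p.1.succ, p.2) := rfl

@[simp] theorem consProd_symm_zero (m : ℕ) (i : ι) :
    (consProd m ι).symm (0, i) = Sum.inl i := rfl

@[simp] theorem consProd_symm_succ (m : ℕ) (a : Fin m) (i : ι) :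
    (consProd m ι).symm (a.succ, i) = Sum.inr (a, i) := rfl

/-- The labelling of the tensor power of a labelled object. -/
def block (L : Label X P ι) : (m : ℕ) → Label X (tpow P m) (Fin m × ι)
  | 0 => unit X (Fin 0 × ι)
  | m + 1 => (L.tensor (block L m)).reindex (consProd m ι)

theorem block_succ (L : Label X P ι) (m : ℕ) :
    L.block (m + 1) = (L.tensor (L.block m)).reindex (consProd m ι) := rfl

/-- A tensor product of permutations of the factors of `P` permutes the factors inside each block. -/
theorem tens_eq_map (L : Label X P ι) : ∀ (m : ℕ) (σ : Fin m → Perm ι),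
    tens m (fun a => L.map L (σ a)) = (L.block m).map (L.block m) (fiberHom (Fin m) ι σ)
  | 0, σ => by
    rw [show fiberHom (Fin 0) ι σ = Equiv.refl _ from Subsingleton.elim _ _, map_refl]
    rfl
  | m + 1, σ => by
    simp only [tens]
    rw [tens_eq_map L m, map_tensor, block_succ, map_reindex]
    congr 1
    ext (i | i) <;> simp

/-- The exchange of two adjacent factors `P` exchanges the corresponding blocks; this is where the
braiding of labelled objects is needed. -/
theorem adj_eq_map (L : Label X P ι) : ∀ (m i : ℕ) (h : i + 1 < m),
    adj P m i =
      (L.block m).map (L.block m) (blockHom (Fin m) ι (swap ⟨i, by omega⟩ ⟨i + 1, h⟩))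
  | m + 2, 0, h => by
    have h1 : adj P (m + 2) 0 = swapFirst P (tpow P m) := rfl
    have h2 := L.braids L
    rw [h1, swapFirst, h2, map_symm_eq _ _ _ (associator_hom_eq L L (L.block m)),
      associator_hom_eq L L (L.block m), map_whiskerRight, map_trans, map_trans, block_succ,
      block_succ, tensor_reindex, map_reindex, map_reindex]
    congr 1
    have s3 : ∀ a : Fin m, swap (0 : Fin (m + 2)) 1 a.succ.succ = a.succ.succ :=
      fun a => swap_apply_of_ne_of_ne (by simp [Fin.ext_iff]) (by simp [Fin.ext_iff])
    have s4 : ∀ i : ι, (consProd (m + 1) ι).symm (1, i) = Sum.inr (0, i) := fun _ => rfl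
    ext (i | i | ⟨a, i⟩)
    · simp [s4]
    · simp
    · simp [s3]
  | m + 1, i + 1, h => by
    have h1 : adj P (m + 1) (i + 1) = P ◁ adj P m i := rfl
    rw [h1, adj_eq_map L m i (by omega), map_whiskerLeft L, block_succ, map_reindex]
    congr 1
    have h0 : swap (⟨i + 1, by omega⟩ : Fin (m + 1)) ⟨i + 1 + 1, h⟩ 0 = 0 :=
      swap_apply_of_ne_of_ne (by simp [Fin.ext_iff]) (by simp [Fin.ext_iff])
    have hs : ∀ a : Fin m, swap (⟨i + 1, by omega⟩ : Fin (m + 1)) ⟨i + 1 + 1, h⟩ a.succ =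
        (swap (⟨i, by omega⟩ : Fin m) ⟨i + 1, by omega⟩ a).succ := fun a => by
      simp only [swap_apply_def, Fin.ext_iff, Fin.val_succ]
      split_ifs <;> simp_all
    ext (j | ⟨a, j⟩)
    · simp [h0]
    · simp [hs]

/-- A permutation of the factors of `P^{⊗ m}` permutes blocks of factors `X`. -/
theorem permMor_eq_map (L : Label X P ι) (m : ℕ) (τ : Perm (Fin m)) :
    permMor P m τ = (L.block m).map (L.block m) (blockHom (Fin m) ι τ) := by
  rcases m with - | m
  · rw [Subsingleton.elim τ 1, permMor_one, map_one]
    exact (map_refl _).symm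
  have hτ : τ ∈ Submonoid.closure (Set.range fun i : Fin m => swap i.castSucc i.succ) := by
    rw [Perm.mclosure_swap_castSucc_succ]; trivial
  induction hτ using Submonoid.closure_induction with
  | mem x hx =>
    obtain ⟨i, rfl⟩ := hx
    have h1 := adj_eq_map L (m + 1) i (by omega)
    rw [← permMor_swap P (m + 1) i (by omega)] at h1
    exact h1
  | one =>
    rw [permMor_one, map_one]
    exact (map_refl _).symm
  | mul x y _ _ hx hy =>
    rw [permMor_mul, hx, hy, map_trans, map_mul]
    rfl

end Label

end Blocks

/-! ### Classes of images of idempotents -/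

section Images

variable {A : Type u} [Category.{v} A] [Preadditive A] [Limits.HasFiniteBiproducts A]
  [MonoidalCategory A] [SymmetricCategory A]

theorem K0.cls_congr {X Y : A} (e : X ≅ Y) : K0.cls X = K0.cls Y := by
  rw [K0.cls, K0.cls, show toSkeleton X = toSkeleton Y from Quotient.sound ⟨e⟩]

theorem K0.cls_biprod (X Y : A) [Limits.HasBinaryBiproduct X Y] :
    K0.cls (Limits.biprod X Y) = K0.cls X + K0.cls Y := by
  have := Limits.hasBinaryBiproducts_of_finite_biproducts A
  rw [← sub_eq_zero, ← sub_sub]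
  exact Ideal.Quotient.eq_zero_iff_mem.mpr (Ideal.subset_span ⟨X, Y, rfl⟩)

theorem K0.cls_tensor (X Y : A) : K0.cls (X ⊗ Y) = K0.cls X * K0.cls Y := by
  simp only [K0.cls, ← map_mul, FreeAbelianGroup.of_mul_of, Skeleton.toSkeleton_tensorObj]

theorem K0.cls_unit : K0.cls (𝟙_ A) = 1 := rfl

variable [IsIdempotentComplete A]

open Classical in
/-- The class of the image of an idempotent endomorphism, with value `0` for endomorphisms that are
not idempotent. -/
noncomputable def imCls {P : A} (p : P ⟶ P) : K0 A :=
  if hp : p ≫ p = p then K0.cls (idemImage p hp) else 0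

theorem imCls_of_idem {P : A} {p : P ⟶ P} (hp : p ≫ p = p) :
    imCls p = K0.cls (idemImage p hp) := dif_pos hp

theorem exists_splitting {P : A} {p : P ⟶ P} (hp : p ≫ p = p) :
    ∃ (Y : A) (i : Y ⟶ P) (e : P ⟶ Y), i ≫ e = 𝟙 Y ∧ e ≫ i = p ∧ imCls p = K0.cls Y :=
  have h := (IsIdempotentComplete.idempotents_split P p hp).choose_spec
  ⟨idemImage p hp, h.choose, h.choose_spec.choose, h.choose_spec.choose_spec.1,
    h.choose_spec.choose_spec.2, imCls_of_idem hp⟩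

theorem imCls_eq_of_splitting {P Y : A} {p : P ⟶ P} (i : Y ⟶ P) (e : P ⟶ Y) (h1 : i ≫ e = 𝟙 Y)
    (h2 : e ≫ i = p) : imCls p = K0.cls Y := by
  have hp : p ≫ p = p := by rw [← h2, Category.assoc, reassoc_of% h1]
  obtain ⟨Y', i', e', h1', h2', h⟩ := exists_splitting hp
  rw [h]
  refine K0.cls_congr ⟨i' ≫ e, i ≫ e', ?_, ?_⟩
  · rw [Category.assoc, reassoc_of% h2, ← h2', Category.assoc, h1', Category.comp_id, h1']
  · rw [Category.assoc, reassoc_of% h2', ← h2, Category.assoc, h1, Category.comp_id, h1]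

theorem imCls_id (P : A) : imCls (𝟙 P) = K0.cls P :=
  imCls_eq_of_splitting (𝟙 P) (𝟙 P) (by simp) (by simp)

/-- Equivalent idempotents have isomorphic images. -/
theorem imCls_comp_comm {P Q : A} (u : P ⟶ Q) (v : Q ⟶ P) (h : u ≫ v ≫ u = u)
    (_ : v ≫ u ≫ v = v) : imCls (u ≫ v) = imCls (v ≫ u) := by
  obtain ⟨Y, i, e, h1, h2, h3⟩ := exists_splitting (p := u ≫ v)
    (by rw [Category.assoc, reassoc_of% h])
  rw [h3]
  refine (imCls_eq_of_splitting (i ≫ u) (v ≫ e) ?_ ?_).symm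
  · rw [Category.assoc, ← Category.assoc u, ← h2, Category.assoc, h1, Category.comp_id, h1]
  · rw [Category.assoc, reassoc_of% h2, h]

theorem imCls_conj {P Q : A} (φ : P ≅ Q) {p : P ⟶ P} {q : Q ⟶ Q} (hp : p ≫ p = p)
    (h : p ≫ φ.hom = φ.hom ≫ q) : imCls p = imCls q := by
  have h1 : q = φ.inv ≫ p ≫ φ.hom := by rw [h, Iso.inv_hom_id_assoc]
  have h2 := imCls_comp_comm (p ≫ φ.hom) (φ.inv ≫ p) (by simp [reassoc_of% hp])
    (by simp [hp])
  simp only [Category.assoc, Iso.hom_inv_id_assoc, hp, reassoc_of% hp] at h2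
  rw [h2, h1]

theorem imCls_add {P : A} {p q : P ⟶ P} (hp : p ≫ p = p) (hq : q ≫ q = q) (hpq : p ≫ q = 0)
    (hqp : q ≫ p = 0) : imCls (p + q) = imCls p + imCls q := by
  have := Limits.hasBinaryBiproducts_of_finite_biproducts A
  obtain ⟨Y, i, e, h1, h2, h3⟩ := exists_splitting hp
  obtain ⟨Y', i', e', h1', h2', h3'⟩ := exists_splitting hq
  rw [h3, h3', ← K0.cls_biprod]
  have hi : i ≫ p = i := by rw [← h2, reassoc_of% h1]
  have he : p ≫ e = e := by rw [← h2, Category.assoc, h1, Category.comp_id]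
  have hi' : i' ≫ q = i' := by rw [← h2', reassoc_of% h1']
  have he' : q ≫ e' = e' := by rw [← h2', Category.assoc, h1', Category.comp_id]
  have h4 : i ≫ e' = 0 := by rw [← hi, ← he', Category.assoc, reassoc_of% hpq]; simp
  have h4' : i' ≫ e = 0 := by rw [← hi', ← he, Category.assoc, reassoc_of% hqp]; simp
  refine imCls_eq_of_splitting (Limits.biprod.desc i i') (Limits.biprod.lift e e') ?_ ?_
  · ext <;> simp [h1, h1', h4, h4']
  · rw [Limits.biprod.lift_desc, h2, h2']

theorem imCls_zero (P : A) : imCls (0 : P ⟶ P) = 0 := by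
  simpa using imCls_add (P := P) (p := 0) (q := 0) (by simp) (by simp) (by simp) (by simp)

theorem imCls_sum {P : A} {I : Type*} (s : Finset I) (p : I → (P ⟶ P))
    (hp : ∀ i ∈ s, p i ≫ p i = p i) (hpq : ∀ i ∈ s, ∀ j ∈ s, i ≠ j → p i ≫ p j = 0) :
    imCls (∑ i ∈ s, p i) = ∑ i ∈ s, imCls (p i) := by
  classical
  induction s using Finset.induction_on with
  | empty => simpa using imCls_zero P
  | insert a s ha ih =>
    have hm : ∀ i ∈ s, i ∈ insert a s := fun i hi => Finset.mem_insert_of_mem hi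
    have hne : ∀ i ∈ s, i ≠ a := fun i hi h => ha (h ▸ hi)
    rw [Finset.sum_insert ha, Finset.sum_insert ha, ← ih (fun i hi => hp i (hm i hi))
      (fun i hi j hj => hpq i (hm i hi) j (hm j hj))]
    refine imCls_add (hp a (Finset.mem_insert_self a s)) ?_ ?_ ?_
    · rw [Preadditive.sum_comp]
      refine Finset.sum_congr rfl fun i hi => ?_
      rw [Preadditive.comp_sum, Finset.sum_eq_single_of_mem i hi, hp i (hm i hi)]
      exact fun j hj hji => hpq i (hm i hi) j (hm j hj) hji.symm
    · rw [Preadditive.comp_sum]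
      exact Finset.sum_eq_zero fun i hi =>
        hpq a (Finset.mem_insert_self a s) i (hm i hi) (hne i hi).symm
    · rw [Preadditive.sum_comp]
      exact Finset.sum_eq_zero fun i hi =>
        hpq i (hm i hi) a (Finset.mem_insert_self a s) (hne i hi)

theorem imCls_tensor {P Q : A} {p : P ⟶ P} {q : Q ⟶ Q} (hp : p ≫ p = p) (hq : q ≫ q = q) :
    imCls (p ⊗ₘ q) = imCls p * imCls q := by
  obtain ⟨Y, i, e, h1, h2, h3⟩ := exists_splitting hp
  obtain ⟨Y', i', e', h1', h2', h3'⟩ := exists_splitting hq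
  rw [h3, h3', ← K0.cls_tensor]
  refine imCls_eq_of_splitting (i ⊗ₘ i') (e ⊗ₘ e') ?_ ?_
  · rw [tensorHom_comp_tensorHom, h1, h1', id_tensorHom_id]
  · rw [tensorHom_comp_tensorHom, h2, h2']

end Images

/-! ### The action of the group algebra -/

section GroupAlgebra

variable (κ : Type w) [Field κ] {A : Type u} [Category.{v} A] [Preadditive A] [Linear κ A]
  [MonoidalCategory A] [SymmetricCategory A]

/-- The action of the group algebra of the symmetric group on a labelled object. -/
noncomputable def Label.actAlg {X P : A} {ι : Type*} (L : Label X P ι) :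
    MonoidAlgebra κ (Perm ι) →ₐ[κ] End P :=
  MonoidAlgebra.lift κ (End P) (Perm ι) L.act

theorem Label.actAlg_of {X P : A} {ι : Type*} (L : Label X P ι) (σ : Perm ι) :
    L.actAlg κ (MonoidAlgebra.of κ _ σ) = L.map L σ := by
  rw [actAlg, MonoidAlgebra.lift_of]; rfl

theorem charProj_eq [CharZero κ] (X : A) (n : ℕ) (χ : Perm (Fin n) →* ℤˣ) :
    charProj κ X n χ = (Label.std X n).actAlg κ (avgElt κ χ) := by
  rw [avgElt, map_smul, map_sum, Fintype.card_perm, Fintype.card_fin, charProj]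
  congr 1
  refine Finset.sum_congr rfl fun σ _ => ?_
  rw [map_smul, Label.actAlg, MonoidAlgebra.lift_of, Label.act_std]

theorem Label.actAlg_conj {X P Q : A} {ι ι' : Type*} (L : Label X P ι) (M : Label X Q ι')
    (e : ι ≃ ι') (z : MonoidAlgebra κ (Perm ι)) :
    L.actAlg κ z ≫ L.map M e = L.map M e ≫
      M.actAlg κ (MonoidAlgebra.mapDomainAlgHom κ κ e.permCongrHom.toMonoidHom z) := by
  induction z using MonoidAlgebra.induction_on with
  | of σ =>
    rw [mapDomainAlgHom_of, actAlg_of, actAlg_of, map_trans, map_trans]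
    congr 1
    ext i
    simp
  | add x y hx hy =>
    simp only [map_add]
    erw [Preadditive.add_comp, Preadditive.comp_add]
    rw [hx, hy]
  | smul r x hx =>
    simp only [map_smul]
    erw [Linear.smul_comp, Linear.comp_smul]
    rw [hx]

/-- The isomorphism of labelled objects given by a bijection of the labels. -/
@[simps] def Label.mapIso {X P Q : A} {ι ι' : Type*} (L : Label X P ι) (M : Label X Q ι')
    (e : ι ≃ ι') : P ≅ Q where
  hom := L.map M e
  inv := M.map L e.symm
  hom_inv_id := by rw [map_trans, Equiv.self_trans_symm, map_refl]
  inv_hom_id := by rw [map_trans, Equiv.symm_trans_self, map_refl]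

variable [MonoidalPreadditive A] [MonoidalLinear κ A]

theorem smul_tensorHom {W X Y Z : A} (r : κ) (f : W ⟶ X) (g : Y ⟶ Z) :
    (r • f) ⊗ₘ g = r • (f ⊗ₘ g) := by
  simp [MonoidalCategory.tensorHom_def]

theorem tensorHom_smul {W X Y Z : A} (r : κ) (f : W ⟶ X) (g : Y ⟶ Z) :
    f ⊗ₘ (r • g) = r • (f ⊗ₘ g) := by
  simp [MonoidalCategory.tensorHom_def]

theorem Label.actAlg_tensor {X P Q : A} {ι ι' : Type*} [Fintype ι] [DecidableEq ι] [Fintype ι']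
    [DecidableEq ι'] (L : Label X P ι) (M : Label X Q ι')
    (y : MonoidAlgebra κ (Perm ι)) (z : MonoidAlgebra κ (Perm ι')) :
    (L.actAlg κ y ⊗ₘ M.actAlg κ z : P ⊗ Q ⟶ P ⊗ Q) = (L.tensor M).actAlg κ (juxt κ y z) := by
  induction y using MonoidAlgebra.induction_on with
  | of σ =>
    induction z using MonoidAlgebra.induction_on with
    | of τ => rw [juxt_of, actAlg_of, actAlg_of, actAlg_of, map_tensor]
    | add y z hy hz =>
      rw [juxt, map_add, map_add, mul_add, map_add]
      exact (MonoidalPreadditive.tensor_add _ _ _).trans (congrArg₂ (· + ·) hy hz)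
    | smul r y hy =>
      rw [juxt, map_smul, map_smul, mul_smul_comm, map_smul]
      exact (tensorHom_smul κ _ _ _).trans (congrArg (r • ·) hy)
  | add x y hx hy =>
    rw [juxt, map_add, map_add, add_mul, map_add]
    exact (MonoidalPreadditive.add_tensor _ _ _).trans (congrArg₂ (· + ·) hx hy)
  | smul r x hx =>
    rw [juxt, map_smul, map_smul, smul_mul_assoc, map_smul]
    exact (smul_tensorHom κ _ _ _).trans (congrArg (r • ·) hx)

omit [Linear κ A] [MonoidalLinear κ A] in
theorem tens_sum {X Y : A} {G : Type*} [Fintype G] : ∀ (n : ℕ) (F : Fin n → G → (X ⟶ Y)),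
    tens n (fun a => ∑ g, F a g) = ∑ σ : Fin n → G, tens n (fun a => F a (σ a))
  | 0, _ => by simp [tens]
  | n + 1, F => by
    simp only [tens]
    rw [tens_sum n, ← (Fin.consEquiv fun _ => G).sum_comp, Fintype.sum_prod_type, sum_tensor]
    refine Finset.sum_congr rfl fun g _ => ?_
    rw [tensor_sum]
    rfl

theorem tens_smul {X Y : A} : ∀ (n : ℕ) (c : Fin n → κ) (f : Fin n → (X ⟶ Y)),
    tens n (fun a => c a • f a) = (∏ a, c a) • tens n f
  | 0, _, _ => by simp [tens]
  | n + 1, c, f => by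
    simp only [tens]
    rw [tens_smul n, Fin.prod_univ_succ, smul_tensorHom, tensorHom_smul, smul_smul]

omit [MonoidalPreadditive A] [MonoidalLinear κ A] in
theorem actAlg_std_naturality {X Y : A} (n : ℕ) (f : X ⟶ Y) (z : MonoidAlgebra κ (Perm (Fin n))) :
    tens n (fun _ => f) ≫ (Label.std Y n).actAlg κ z =
      (Label.std X n).actAlg κ z ≫ tens n (fun _ => f) := by
  induction z using MonoidAlgebra.induction_on with
  | of σ =>
    rw [Label.actAlg_of, Label.actAlg_of, Label.map_std, Label.map_std, permHom_perm, permHom_perm,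
      tens_permMor]
    rfl
  | add x y hx hy =>
    rw [map_add, map_add]
    erw [Preadditive.add_comp, Preadditive.comp_add]
    rw [hx, hy]
  | smul r x hx =>
    rw [map_smul, map_smul]
    erw [Linear.smul_comp, Linear.comp_smul]
    rw [hx]

section Wreath

variable {X P : A} {ι : Type*} [Fintype ι] [DecidableEq ι] (L : Label X P ι) (m : ℕ)

/-- Alternation inside the blocks is the tensor power of the projector onto the exterior power. -/
theorem Label.actAlg_fiberAlt : (L.block m).actAlg κ (fiberAlt κ (Fin m) ι) =
    tens m (fun _ => L.actAlg κ (avgElt κ Perm.sign)) := by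
  have h : (L.actAlg κ (avgElt κ Perm.sign) : P ⟶ P) = ((Fintype.card (Perm ι) : κ)⁻¹) •
      ∑ σ : Perm ι, ((Perm.sign σ : ℤ) : κ) • L.map L σ := by
    rw [avgElt, map_smul, map_sum]
    simp only [map_smul, actAlg_of]
  rw [h, tens_smul κ m (fun _ => (Fintype.card (Perm ι) : κ)⁻¹), tens_sum, fiberAlt,
    mapDomainAlgHom_avgElt, map_smul, map_sum, Fintype.card_pi, Finset.prod_const,
    Finset.prod_const, Nat.cast_pow, inv_pow]
  congr 1
  refine Finset.sum_congr rfl fun σ _ => ?_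
  rw [tens_smul κ m (fun a => ((Perm.sign (σ a) : ℤ) : κ)), map_smul, actAlg_of, tens_eq_map,
    show ((piSign (Fin m) ι σ : ℤ) : κ) = ∏ a, ((Perm.sign (σ a) : ℤ) : κ) by simp [piSign]]

omit [Fintype ι] [DecidableEq ι] [MonoidalPreadditive A] [MonoidalLinear κ A] in
/-- Alternation of the blocks is the action of the alternating idempotent on the tensor power. -/
theorem Label.actAlg_blockAlt : (L.block m).actAlg κ (blockAlt κ (Fin m) ι) =
    (Label.std P m).actAlg κ (avgElt κ Perm.sign) := by
  rw [blockAlt, mapDomainAlgHom_avgElt, avgElt, map_smul, map_smul, map_sum, map_sum]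
  congr 1
  refine Finset.sum_congr rfl fun σ _ => ?_
  rw [map_smul, map_smul, actAlg_of, actAlg_of, map_std, permHom_perm, permMor_eq_map L]

/-- The image of `wreathElt` is an exterior power of an exterior power: it is equivalent to the
alternating idempotent on the tensor power of the image `Y` of the inner projector. -/
theorem Label.imCls_wreathElt [CharZero κ] [Limits.HasFiniteBiproducts A]
    [IsIdempotentComplete A] {Y : A} (i : Y ⟶ P) (e : P ⟶ Y) (h1 : i ≫ e = 𝟙 Y)
    (h2 : e ≫ i = L.actAlg κ (avgElt κ Perm.sign)) :
    imCls ((L.block m).actAlg κ (wreathElt κ (Fin m) ι)) = K0.cls (altPow κ Y m) := by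
  set q := charProj κ Y m Perm.sign with hq
  set f : tpow P m ⟶ tpow P m := (L.block m).actAlg κ (fiberAlt κ (Fin m) ι) with hf
  set a : tpow P m ⟶ tpow P m := (L.block m).actAlg κ (blockAlt κ (Fin m) ι) with ha
  have hqq : q ≫ q = q := charProj_idem κ Y m Perm.sign
  have h3 : tens m (fun _ => i) ≫ tens m (fun _ => e) = 𝟙 _ := by
    rw [tens_comp, h1, tens_id]
  have h4 : tens m (fun _ => e) ≫ tens m (fun _ => i) = f := by
    rw [tens_comp, h2, hf, actAlg_fiberAlt]
  -- `tens i` and `tens e` split the inner alternation, and by naturality commute with the outer one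
  have h5 : q ≫ tens m (fun _ => i) = tens m (fun _ => i) ≫ a := by
    rw [ha, actAlg_blockAlt, actAlg_std_naturality, hq, charProj_eq]
  have h6 : (L.block m).actAlg κ (wreathElt κ (Fin m) ι) =
      (tens m (fun _ => e) ≫ q) ≫ q ≫ tens m (fun _ => i) := by
    rw [wreathElt, map_mul, Category.assoc, reassoc_of% hqq, h5, reassoc_of% h4]
    rfl
  have h7 : (q ≫ tens m (fun _ => i)) ≫ tens m (fun _ => e) ≫ q = q := by
    rw [Category.assoc, reassoc_of% h3, hqq]
  rw [h6, ← imCls_comp_comm, h7, altPow, imCls_of_idem]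
  · rw [← Category.assoc, h7, ← Category.assoc, hqq]
  · simp only [Category.assoc, reassoc_of% h3, hqq]

end Wreath

end GroupAlgebra

/-! ### Tensor products of families of morphisms between labelled objects -/

section Families

variable {C : Type u} [Category.{v} C] [MonoidalCategory C] [SymmetricCategory C]

theorem tens_permHom {X Y : C} {n n' : ℕ} (σ : Fin n ≃ Fin n') (f : Fin n → (X ⟶ Y)) :
    tens n f ≫ permHom Y σ = permHom X σ ≫ tens n' (f ∘ σ.symm) := by
  obtain rfl := Fin.equiv_iff_eq.mp ⟨σ⟩
  rw [permHom_perm, permHom_perm, tens_permMor]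

theorem tens_tpowAdd {X Y : C} : ∀ (n m : ℕ) (f : Fin n → (X ⟶ Y)) (g : Fin m → (X ⟶ Y)),
    (tens n f ⊗ₘ tens m g) ≫ (tpowAdd Y n m).hom =
      (tpowAdd X n m).hom ≫ tens (n + m) (Fin.addCases f g)
  | 0, m, f, g => by
    rw [tpowAdd_zero_hom, tpowAdd_zero_hom]
    have h1 : (tens 0 f ⊗ₘ tens m g) ≫ (λ_ (tpow Y m)).hom = (λ_ (tpow X m)).hom ≫ tens m g := by
      change (𝟙 (𝟙_ C) ⊗ₘ tens m g) ≫ (λ_ (tpow Y m)).hom = _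
      rw [id_tensorHom, leftUnitor_naturality]
    rw [reassoc_of% h1, tens_permHom, Category.assoc]
    congr 3
    funext j
    induction j using Fin.addCases with
    | left i => exact i.elim0
    | right i =>
      rw [Fin.addCases_right]
      exact congrArg g (Fin.ext (by simp))
  | n + 1, m, f, g => by
    have ih := tens_tpowAdd n m (fun i => f i.succ) g
    have h1 : (tens (n + 1) f ⊗ₘ tens m g) ≫ (α_ Y (tpow Y n) (tpow Y m)).hom =
      (α_ X (tpow X n) (tpow X m)).hom ≫
        (f 0 ⊗ₘ (tens n (fun i => f i.succ) ⊗ₘ tens m g)) := associator_naturality _ _ _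
    have h3 : ∀ (S T T' : C) (a : S ⟶ T) (b : T ⟶ T'), (f 0 ⊗ₘ a) ≫ Y ◁ b = f 0 ⊗ₘ (a ≫ b) := by
      intro S T T' a b
      rw [← id_tensorHom, tensorHom_comp_tensorHom, Category.comp_id]
    have h4 : ∀ (S S' T : C) (a : S ⟶ S') (b : S' ⟶ T), X ◁ a ≫ (f 0 ⊗ₘ b) = f 0 ⊗ₘ (a ≫ b) := by
      intro S S' T a b
      rw [← id_tensorHom, tensorHom_comp_tensorHom, Category.id_comp]
    have h2 := tens_permHom (finCongr (by omega : n + m + 1 = n + 1 + m))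
      (Fin.cons (f 0) (Fin.addCases (fun i => f i.succ) g) : Fin (n + m + 1) → (X ⟶ Y))
    simp only [tens, Fin.cons_zero, Fin.cons_succ] at h2
    rw [tpowAdd_succ_hom, tpowAdd_succ_hom, reassoc_of% h1, reassoc_of% h3, ih, ← h4,
      Category.assoc, h2]
    simp only [Category.assoc]
    congr 4
    funext j
    induction j using Fin.addCases with
    | left i =>
      rw [Fin.addCases_left]
      induction i using Fin.cases with
      | zero => rfl
      | succ i =>
        have : (finCongr (by omega : n + m + 1 = n + 1 + m)).symm (Fin.castAdd m i.succ) =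
          (Fin.castAdd m i).succ := Fin.ext (by simp)
        rw [Function.comp_apply, this, Fin.cons_succ, Fin.addCases_left]
    | right i =>
      have : (finCongr (by omega : n + m + 1 = n + 1 + m)).symm (Fin.natAdd (n + 1) i) =
        (Fin.natAdd n i).succ := Fin.ext (by simp; omega)
      rw [Function.comp_apply, this, Fin.cons_succ, Fin.addCases_right, Fin.addCases_right]

namespace Label

variable {X Y Z P P' Q Q' R : C} {ι ι' : Type*}

/-- The tensor product of a family of morphisms, as a morphism between labelled objects. -/
def homs (L : Label X P ι) (M : Label Y Q ι) (f : ι → (X ⟶ Y)) : P ⟶ Q :=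
  L.iso.hom ≫ tens L.n (f ∘ L.e.symm) ≫ permHom Y (L.e.symm.trans M.e) ≫ M.iso.inv

/-- Permuting the factors after applying a family of morphisms is the same as applying the permuted
family after permuting the factors. -/
theorem homs_map (L : Label X P ι) (L' : Label X P' ι') (M : Label Y Q ι) (M' : Label Y Q' ι')
    (f : ι → (X ⟶ Y)) (σ : ι ≃ ι') :
    L.homs M f ≫ M.map M' σ = L.map L' σ ≫ L'.homs M' (f ∘ σ.symm) := by
  simp only [homs, map, Category.assoc, Iso.inv_hom_id_assoc]
  have h := tens_permHom (L.e.symm.trans (σ.trans L'.e)) (f ∘ L.e.symm)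
  rw [show (f ∘ L.e.symm) ∘ (L.e.symm.trans (σ.trans L'.e)).symm = (f ∘ σ.symm) ∘ L'.e.symm by
    funext j; simp] at h
  rw [permHom_trans_assoc, ← reassoc_of% h, permHom_trans_assoc]
  congr 4
  ext j
  simp

theorem homs_comp (L : Label X P ι) (M : Label Y Q ι) (N : Label Z R ι) (f : ι → (X ⟶ Y))
    (g : ι → (Y ⟶ Z)) : L.homs M f ≫ M.homs N g = L.homs N (fun i => f i ≫ g i) := by
  have h2 : permHom Y (L.e.symm.trans M.e) ≫ tens M.n (g ∘ M.e.symm) =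
      tens L.n (g ∘ L.e.symm) ≫ permHom Z (L.e.symm.trans M.e) := by
    rw [tens_permHom]
    congr 2
    funext j
    simp
  simp only [homs, Category.assoc, Iso.inv_hom_id_assoc]
  rw [reassoc_of% h2, permHom_trans_assoc, ← Category.assoc (tens L.n _), tens_comp]
  congr 3
  congr 1
  ext j
  simp

theorem homs_id (L : Label X P ι) : L.homs L (fun _ => 𝟙 X) = 𝟙 P := by
  have h : L.e.symm.trans L.e = Equiv.refl _ := Equiv.symm_trans_self _
  rw [homs, h, permHom_refl, Category.id_comp]
  erw [tens_id, Category.id_comp]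
  exact L.iso.hom_inv_id

theorem homs_tensor (L : Label X P ι) (M : Label Y Q ι) (L' : Label X P' ι') (M' : Label Y Q' ι')
    (f : ι → (X ⟶ Y)) (g : ι' → (X ⟶ Y)) :
    (L.homs M f ⊗ₘ L'.homs M' g) = (L.tensor L').homs (M.tensor M') (Sum.elim f g) := by
  have h : (L.tensor L').e.symm.trans (M.tensor M').e =
      sumFin (L.e.symm.trans M.e) (L'.e.symm.trans M'.e) := by
    refine symm_trans_eq ?_
    rintro (i | i)
    · change finSumFinEquiv (Sum.inl (M.e i)) = sumFin _ _ (finSumFinEquiv (Sum.inl (L.e i)))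
      simp
    · change finSumFinEquiv (Sum.inr (M'.e i)) = sumFin _ _ (finSumFinEquiv (Sum.inr (L'.e i)))
      simp
  have h' : Sum.elim f g ∘ (L.tensor L').e.symm = Fin.addCases (f ∘ L.e.symm) (g ∘ L'.e.symm) := by
    funext j
    induction j using Fin.addCases with
    | left i =>
      rw [Fin.addCases_left]
      change Sum.elim f g (Sum.map L.e.symm L'.e.symm (finSumFinEquiv.symm _)) = _
      rw [finSumFinEquiv_symm_apply_castAdd]
      rfl
    | right i =>
      rw [Fin.addCases_right]
      change Sum.elim f g (Sum.map L.e.symm L'.e.symm (finSumFinEquiv.symm _)) = _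
      rw [finSumFinEquiv_symm_apply_natAdd]
      rfl
  conv_rhs => rw [homs, h, h']
  simp only [homs, tensor, Iso.trans_hom, Iso.trans_inv, Category.assoc, tensorIso_hom,
    tensorIso_inv]
  rw [← reassoc_of% tens_tpowAdd, ← reassoc_of% tensor_permHom Y, Iso.hom_inv_id_assoc]
  simp only [tensorHom_comp_tensorHom]

theorem homs_std {X Y : C} (n : ℕ) (f : Fin n → (X ⟶ Y)) :
    (std X n).homs (std Y n) f = tens n f := by
  have h : (std X n).e.symm.trans (std Y n).e = Equiv.refl _ := Equiv.symm_trans_self _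
  rw [homs, h]
  erw [permHom_refl, Category.id_comp, Category.id_comp]
  exact Category.comp_id _

end Label

end Families

/-! ### Exterior powers of direct sums -/

section GroupAlgebraAlt

variable (κ : Type*) [Field κ]

theorem avgElt_sign_conj {ι ι' : Type*} [Fintype ι] [DecidableEq ι] [Fintype ι'] [DecidableEq ι']
    (e : ι ≃ ι') : MonoidAlgebra.mapDomainAlgHom κ κ e.permCongrHom.toMonoidHom
      (avgElt κ (Perm.sign : Perm ι →* ℤˣ)) = avgElt κ (Perm.sign : Perm ι' →* ℤˣ) := by
  rw [mapDomainAlgHom_avgElt, avgElt, Fintype.card_congr e.permCongr,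
    ← Equiv.sum_comp e.permCongr]
  congr 1
  refine Finset.sum_congr rfl fun σ _ => ?_
  rw [Perm.sign_permCongr]
  rfl

variable (ι ι' : Type*) [Fintype ι] [DecidableEq ι] [Fintype ι'] [DecidableEq ι']

/-- The word whose stabilizer is the Young subgroup `Perm ι × Perm ι'`. -/
def sumWord : ι ⊕ ι' → Bool := Sum.elim (fun _ => false) (fun _ => true)

variable {ι ι'} in
omit [Fintype ι] [DecidableEq ι] [Fintype ι'] [DecidableEq ι'] in
theorem exists_sumCongr {σ : Perm (ι ⊕ ι')} [Finite ι] [Finite ι']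
    (h : sumWord ι ι' ∘ σ = sumWord ι ι') : ∃ p : Perm ι × Perm ι', Perm.sumCongrHom ι ι' p = σ := by
  refine Perm.mem_sumCongrHom_range_of_perm_mapsTo_inl ?_
  rintro _ ⟨i, rfl⟩
  have h1 := congrFun h (Sum.inl i)
  rcases h2 : σ (Sum.inl i) with j | j
  · exact ⟨j, rfl⟩
  · simp [sumWord, h2] at h1

theorem sum_wordStab_sumWord {M : Type*} [AddCommMonoid M] (F : Perm (ι ⊕ ι') → M) :
    ∑ σ ∈ wordStab (sumWord ι ι'), F σ = ∑ p : Perm ι × Perm ι', F (Perm.sumCongrHom ι ι' p) := by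
  refine (Finset.sum_bij (fun p _ => Perm.sumCongrHom ι ι' p) ?_ ?_ ?_ ?_).symm
  · intro p _
    rw [mem_wordStab]
    ext (i | i) <;> rfl
  · exact fun p _ q _ h => Perm.sumCongrHom_injective h
  · intro σ hσ
    obtain ⟨p, hp⟩ := exists_sumCongr (mem_wordStab.mp hσ)
    exact ⟨p, Finset.mem_univ _, hp⟩
  · exact fun _ _ => rfl

theorem card_wordStab_sumWord : (wordStab (sumWord ι ι')).card =
    Fintype.card (Perm ι) * Fintype.card (Perm ι') := by
  rw [Finset.card_eq_sum_ones, sum_wordStab_sumWord, ← Finset.card_eq_sum_ones, Finset.card_univ,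
    Fintype.card_prod]

theorem juxt_avgElt : juxt κ (avgElt κ (Perm.sign : Perm ι →* ℤˣ))
    (avgElt κ (Perm.sign : Perm ι' →* ℤˣ)) = ((wordStab (sumWord ι ι')).card : κ)⁻¹ •
      ∑ σ ∈ wordStab (sumWord ι ι'), ((Perm.sign σ : ℤ) : κ) • MonoidAlgebra.of κ _ σ := by
  rw [juxt, mapDomainAlgHom_avgElt, mapDomainAlgHom_avgElt, smul_mul_smul_comm,
    card_wordStab_sumWord, Nat.cast_mul, mul_inv, sum_wordStab_sumWord, Finset.sum_mul_sum,
    Fintype.sum_prod_type]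
  congr 1
  refine Finset.sum_congr rfl fun σ _ => Finset.sum_congr rfl fun τ _ => ?_
  have h1 : Perm.sign (Perm.sumCongrHom ι ι' (σ, τ)) = Perm.sign σ * Perm.sign τ :=
    Perm.sign_sumCongr σ τ
  have h2 : Perm.sumCongrHom ι ι' (σ, τ) = (Perm.sumCongrHom ι ι').comp (MonoidHom.inl _ _) σ *
      (Perm.sumCongrHom ι ι').comp (MonoidHom.inr _ _) τ := by
    rw [MonoidHom.comp_apply, MonoidHom.comp_apply, ← map_mul]
    simp
  rw [smul_mul_smul_comm, ← map_mul, ← Int.cast_mul, ← Units.val_mul, ← h1, h2]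

end GroupAlgebraAlt

section Additivity

variable (κ : Type w) [Field κ] {A : Type u} [Category.{v} A] [Preadditive A] [Linear κ A]
  [MonoidalCategory A] [SymmetricCategory A]

namespace Label

section

variable {X P : A} {ι : Type*} [Fintype ι] [DecidableEq ι] (L : Label X P ι)

/-- The projector onto the antisymmetric part of a labelled object. -/
noncomputable def alt : P ⟶ P := L.actAlg κ (avgElt κ Perm.sign)

theorem alt_eq : L.alt κ = (Fintype.card (Perm ι) : κ)⁻¹ •
    ∑ σ : Perm ι, ((Perm.sign σ : ℤ) : κ) • L.map L σ := by
  rw [alt, avgElt, map_smul, map_sum]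
  simp only [map_smul, actAlg_of]

theorem alt_map (σ : Perm ι) : L.alt κ ≫ L.map L σ = ((Perm.sign σ : ℤ) : κ) • L.alt κ := by
  rw [alt, ← map_smul, ← of_mul_avgElt, map_mul, actAlg_of]
  rfl

theorem alt_comp_alt [CharZero κ] : L.alt κ ≫ L.alt κ = L.alt κ := by
  conv_rhs => rw [alt, ← avgElt_mul_self, map_mul]
  rfl

end

variable [MonoidalPreadditive A]

omit [Linear κ A] in
variable {κ} in
theorem homs_eq_zero {X Y P Q : A} {ι : Type*} (L : Label X P ι) (M : Label Y Q ι)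
    (f : ι → (X ⟶ Y)) (i : ι) (hi : f i = 0) : L.homs M f = 0 := by
  have h : ∀ (n : ℕ) (g : Fin n → (X ⟶ Y)) (j : Fin n), g j = 0 → tens n g = 0 := by
    intro n
    induction n with
    | zero => exact fun _ j => j.elim0
    | succ n ih =>
      intro g j hj
      simp only [tens]
      induction j using Fin.cases with
      | zero => rw [hj, MonoidalPreadditive.zero_tensor]
      | succ j => rw [ih _ j hj, MonoidalPreadditive.tensor_zero]
  rw [homs, h L.n _ (L.e i) (by simpa using hi)]
  simp

omit [Linear κ A] in
theorem homs_sum {X Y P Q : A} {ι D : Type*} [Fintype ι] [DecidableEq ι] [Fintype D]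
    (L : Label X P ι) (M : Label Y Q ι)
    (F : D → (X ⟶ Y)) : L.homs M (fun _ => ∑ d, F d) = ∑ w : ι → D, L.homs M (fun i => F (w i)) := by
  have h := tens_sum L.n (fun _ => F)
  rw [← (L.e.arrowCongr (Equiv.refl D)).sum_comp] at h
  simp only [homs]
  rw [← Preadditive.comp_sum, ← Preadditive.sum_comp]
  congr 2

variable {Z P : A} {ι D : Type*} (L : Label Z P ι) (p : D → (Z ⟶ Z))

/-- The idempotent of a word, for a decomposition of `Z` into summands indexed by the letters. -/
def wordProj (w : ι → D) : P ⟶ P := L.homs L fun k => p (w k)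

omit [Preadditive A] [Linear κ A] [MonoidalPreadditive A] in
theorem map_wordProj {P' : A} {ι' : Type*} (M : Label Z P' ι') (σ : ι ≃ ι') (w : ι' → D) :
    L.map M σ ≫ M.wordProj p w = L.wordProj p (w ∘ σ) ≫ L.map M σ := by
  rw [wordProj, wordProj, homs_map L M L M]
  congr 2
  funext k
  simp

variable [Fintype ι] [DecidableEq ι] [Fintype D] [DecidableEq D]

omit [Linear κ A] in
theorem sum_wordProj (hsum : ∑ d, p d = 𝟙 Z) : ∑ w : ι → D, L.wordProj p w = 𝟙 P := by
  simp only [wordProj]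
  rw [← homs_sum, hsum, homs_id]

variable (hp : ∀ d, p d ≫ p d = p d) (hpq : ∀ d d', d ≠ d' → p d ≫ p d' = 0)

include hp in
omit [Preadditive A] [Linear κ A] [MonoidalPreadditive A] [Fintype ι] [DecidableEq ι] [Fintype D]
  [DecidableEq D] in
theorem wordProj_self (w : ι → D) : L.wordProj p w ≫ L.wordProj p w = L.wordProj p w := by
  rw [wordProj, homs_comp]
  simp only [hp]

include hpq in
omit [Linear κ A] [Fintype ι] [DecidableEq ι] [Fintype D] [DecidableEq D] in
theorem wordProj_of_ne {w w' : ι → D} (h : w ≠ w') : L.wordProj p w ≫ L.wordProj p w' = 0 := by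
  obtain ⟨k, hk⟩ := Function.ne_iff.mp h
  rw [wordProj, wordProj, homs_comp]
  exact homs_eq_zero _ _ _ k (hpq _ _ hk)

/-- The sum of the idempotents of the rearrangements of a word. -/
noncomputable def contentProj (μ : D →₀ ℕ) : P ⟶ P :=
  ∑ w : ι → D with content w = μ, L.wordProj p w

omit [Linear κ A] in
theorem map_contentProj {P' : A} {ι' : Type*} [Fintype ι'] [DecidableEq ι'] (M : Label Z P' ι')
    (σ : ι ≃ ι') (μ : D →₀ ℕ) :
    L.map M σ ≫ M.contentProj p μ = L.contentProj p μ ≫ L.map M σ := by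
  rw [contentProj, contentProj, Preadditive.comp_sum, Preadditive.sum_comp]
  refine Finset.sum_equiv (σ.symm.arrowCongr (Equiv.refl D)) ?_ ?_
  · intro w
    have : content (σ.symm.arrowCongr (Equiv.refl D) w) = content w := by
      simp only [content]
      exact Equiv.sum_comp σ fun j => Finsupp.single (w j) 1
    simp only [Finset.mem_filter, Finset.mem_univ, true_and, this]
  · intro w _
    rw [map_wordProj]
    rfl

theorem alt_contentProj (μ : D →₀ ℕ) :
    L.alt κ ≫ L.contentProj p μ = L.contentProj p μ ≫ L.alt κ := by
  rw [alt_eq]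
  simp only [Linear.smul_comp, Linear.comp_smul, Preadditive.sum_comp, Preadditive.comp_sum,
    map_contentProj]

include hp hpq in
omit [Linear κ A] in
theorem contentProj_wordProj (w : ι → D) :
    L.contentProj p (content w) ≫ L.wordProj p w = L.wordProj p w := by
  rw [contentProj, Preadditive.sum_comp, Finset.sum_eq_single w]
  · exact L.wordProj_self p hp w
  · exact fun w' _ h => L.wordProj_of_ne p hpq h
  · simp

include hp hpq in
omit [Linear κ A] in
theorem wordProj_contentProj (w : ι → D) :
    L.wordProj p w ≫ L.contentProj p (content w) = L.wordProj p w := by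
  rw [contentProj, Preadditive.comp_sum, Finset.sum_eq_single w]
  · exact L.wordProj_self p hp w
  · exact fun w' _ h => L.wordProj_of_ne p hpq h.symm
  · simp

include hp hpq in
omit [Linear κ A] in
theorem contentProj_self (μ : D →₀ ℕ) :
    L.contentProj p μ ≫ L.contentProj p μ = L.contentProj p μ := by
  conv_lhs => enter [2]; rw [contentProj]
  rw [Preadditive.comp_sum, contentProj]
  refine Finset.sum_congr rfl fun w hw => ?_
  rw [← contentProj, ← (Finset.mem_filter.mp hw).2, L.contentProj_wordProj p hp hpq]

include hpq in
omit [Linear κ A] in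
theorem contentProj_of_ne {μ ν : D →₀ ℕ} (h : μ ≠ ν) :
    L.contentProj p μ ≫ L.contentProj p ν = 0 := by
  rw [contentProj, contentProj, Preadditive.sum_comp]
  refine Finset.sum_eq_zero fun w hw => ?_
  rw [Preadditive.comp_sum]
  refine Finset.sum_eq_zero fun w' hw' => L.wordProj_of_ne p hpq ?_
  rintro rfl
  exact h ((Finset.mem_filter.mp hw).2.symm.trans (Finset.mem_filter.mp hw').2)

/-- The symmetric group permutes the idempotents of the words of a given content transitively, so
between two alternating projectors each of them is the same multiple of their sum. -/
theorem alt_wordProj_alt [CharZero κ] (w : ι → D) :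
    L.alt κ ≫ L.wordProj p w ≫ L.alt κ =
      ((wordStab w).card / Fintype.card (Perm ι) : κ) •
        (L.alt κ ≫ L.contentProj p (content w)) := by
  have h1 : ∀ σ : Perm ι, L.alt κ ≫ L.wordProj p w ≫ (((Perm.sign σ : ℤ) : κ) • L.map L σ) =
      L.alt κ ≫ L.wordProj p (w ∘ σ.symm) := by
    intro σ
    have h2 := L.map_wordProj p L σ (w ∘ σ.symm)
    rw [Function.comp_assoc, symm_comp_self, Function.comp_id] at h2
    rw [Linear.comp_smul, Linear.comp_smul, ← h2, ← Category.assoc, alt_map, Linear.smul_comp,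
      smul_smul, ← Int.cast_mul, ← Units.val_mul, Int.units_mul_self]
    simp
  conv_lhs => enter [2, 2]; rw [alt_eq]
  rw [Linear.comp_smul, Linear.comp_smul, Preadditive.comp_sum, Preadditive.comp_sum,
    Finset.sum_congr rfl fun σ _ => h1 σ, ← Equiv.sum_comp (Equiv.inv (Perm ι))]
  have h3 := sum_comp_perm w fun w => L.alt κ ≫ L.wordProj p w
  simp only [Equiv.inv_apply, Perm.inv_def, symm_symm]
  rw [h3, div_eq_inv_mul, mul_smul, Nat.cast_smul_eq_nsmul, contentProj, Preadditive.comp_sum]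

variable [CharZero κ] [Limits.HasFiniteBiproducts A] [IsIdempotentComplete A]

include hp hpq in
/-- The part of the exterior power of a given content, described on the summand of a single word. -/
theorem imCls_alt_contentProj (w : ι → D) :
    imCls (L.alt κ ≫ L.contentProj p (content w)) =
      imCls ((Fintype.card (Perm ι) / (wordStab w).card : κ) •
        L.wordProj p w ≫ L.alt κ ≫ L.wordProj p w) := by
  have h0 : ((wordStab w).card : κ) ≠ 0 := by
    rw [Nat.cast_ne_zero]
    exact Finset.card_ne_zero_of_mem (a := 1) (by simp)
  have h0' : (Fintype.card (Perm ι) : κ) ≠ 0 := Nat.cast_ne_zero.mpr Fintype.card_ne_zero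
  set c : κ := Fintype.card (Perm ι) / (wordStab w).card with hc
  have h1 : (L.alt κ ≫ L.wordProj p w) ≫ (c • L.wordProj p w ≫ L.alt κ) =
      L.alt κ ≫ L.contentProj p (content w) := by
    rw [Linear.comp_smul, Category.assoc, ← Category.assoc (L.wordProj p w),
      L.wordProj_self p hp, L.alt_wordProj_alt κ p, smul_smul, hc, div_mul_div_comm, mul_comm,
      div_self (mul_ne_zero h0 h0'), one_smul]
  have h2 : (c • L.wordProj p w ≫ L.alt κ) ≫ (L.alt κ ≫ L.wordProj p w) =
      c • L.wordProj p w ≫ L.alt κ ≫ L.wordProj p w := by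
    rw [Linear.smul_comp, Category.assoc, ← Category.assoc (L.alt κ) (L.alt κ), alt_comp_alt]
  rw [← h1, ← h2]
  refine imCls_comp_comm _ _ ?_ ?_
  · rw [← Category.assoc, h1, alt_contentProj, Category.assoc, ← Category.assoc (L.alt κ),
      alt_comp_alt, ← Category.assoc, ← alt_contentProj, Category.assoc,
      L.contentProj_wordProj p hp hpq]
  · rw [h1, Linear.smul_comp, Category.assoc, ← Category.assoc (L.alt κ) (L.alt κ), alt_comp_alt,
      alt_contentProj, ← Category.assoc, L.wordProj_contentProj p hp hpq]

omit [CharZero κ] [Limits.HasFiniteBiproducts A] [IsIdempotentComplete A] in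
/-- On the summand `X^{⊗ ι} ⊗ Y^{⊗ ι'}`, only the permutations in the Young subgroup contribute to
the alternating projector. -/
theorem wordProj_alt_wordProj_sumWord [CharZero κ] {Z P : A} {ι ι' : Type*} [Fintype ι]
    [DecidableEq ι] [Fintype ι'] [DecidableEq ι'] (L : Label Z P (ι ⊕ ι')) (p : Bool → (Z ⟶ Z))
    (hp : ∀ d, p d ≫ p d = p d) (hpq : ∀ d d', d ≠ d' → p d ≫ p d' = 0) :
    (Fintype.card (Perm (ι ⊕ ι')) / (wordStab (sumWord ι ι')).card : κ) •
        L.wordProj p (sumWord ι ι') ≫ L.alt κ ≫ L.wordProj p (sumWord ι ι') =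
      L.wordProj p (sumWord ι ι') ≫ L.actAlg κ (juxt κ (avgElt κ Perm.sign)
        (avgElt κ Perm.sign)) := by
  have h0' : (Fintype.card (Perm (ι ⊕ ι')) : κ) ≠ 0 := Nat.cast_ne_zero.mpr Fintype.card_ne_zero
  have h1 : ∀ σ : Perm (ι ⊕ ι'), L.wordProj p (sumWord ι ι') ≫ (((Perm.sign σ : ℤ) : κ) •
      L.map L σ) ≫ L.wordProj p (sumWord ι ι') = if sumWord ι ι' ∘ σ = sumWord ι ι' then
        L.wordProj p (sumWord ι ι') ≫ (((Perm.sign σ : ℤ) : κ) • L.map L σ) else 0 := by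
    intro σ
    rw [Linear.smul_comp, Linear.comp_smul, map_wordProj, ← Category.assoc]
    split_ifs with h
    · rw [h, L.wordProj_self p hp, Linear.comp_smul]
    · rw [L.wordProj_of_ne p hpq (Ne.symm h), Limits.zero_comp, smul_zero]
  have h2 : (L.actAlg κ (juxt κ (avgElt κ Perm.sign) (avgElt κ Perm.sign)) : P ⟶ P) =
      ((wordStab (sumWord ι ι')).card : κ)⁻¹ •
      ∑ σ ∈ wordStab (sumWord ι ι'), ((Perm.sign σ : ℤ) : κ) • L.map L σ := by
    rw [juxt_avgElt, map_smul, map_sum]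
    simp only [map_smul, actAlg_of]
  rw [h2, alt_eq, Linear.smul_comp, Linear.comp_smul, smul_smul, div_eq_inv_mul, mul_assoc,
    mul_inv_cancel₀ h0', mul_one, Linear.comp_smul, Preadditive.sum_comp, Preadditive.comp_sum,
    Preadditive.comp_sum, Finset.sum_congr rfl fun σ _ => h1 σ, wordStab, Finset.sum_filter]

theorem alt_comp_map {Z P : A} {ι ι' : Type*} [Fintype ι] [DecidableEq ι]
    [Fintype ι'] [DecidableEq ι'] (L : Label Z P ι) (M : Label Z P' ι') (e : ι ≃ ι') :
    L.alt κ ≫ L.map M e = L.map M e ≫ M.alt κ := by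
  rw [alt, actAlg_conj, avgElt_sign_conj, alt]

end Label

theorem cls_altPow [CharZero κ] [Limits.HasFiniteBiproducts A] [IsIdempotentComplete A] (X : A)
    (n : ℕ) : K0.cls (altPow κ X n) = imCls ((Label.std X n).alt κ) := by
  rw [altPow, ← imCls_of_idem, charProj_eq]; rfl

variable [MonoidalPreadditive A] [MonoidalLinear κ A]
  [CharZero κ] [Limits.HasFiniteBiproducts A] [IsIdempotentComplete A]

/-- The summand of `Alt^n (X ⊕ Y)` belonging to the words with `i` letters `X` and `j` letters
`Y`. -/
theorem imCls_alt_contentProj_sumWord {X Y Z : A} (a : X ⟶ Z) (a' : Z ⟶ X) (b : Y ⟶ Z)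
    (b' : Z ⟶ Y) (haa : a ≫ a' = 𝟙 X) (hbb : b ≫ b' = 𝟙 Y) (hab : a ≫ b' = 0) (hba : b ≫ a' = 0)
    (i j : ℕ) :
    imCls (((Label.std Z i).tensor (Label.std Z j)).alt κ ≫
      ((Label.std Z i).tensor (Label.std Z j)).contentProj
        (fun d => bif d then b' ≫ b else a' ≫ a) (content (sumWord (Fin i) (Fin j)))) =
      K0.cls (altPow κ X i) * K0.cls (altPow κ Y j) := by
  set p : Bool → (Z ⟶ Z) := fun d => bif d then b' ≫ b else a' ≫ a with hpdef
  have hp : ∀ d, p d ≫ p d = p d := by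
    rintro (- | -) <;> simp [p, reassoc_of% haa, reassoc_of% hbb]
  have hpq : ∀ d d', d ≠ d' → p d ≫ p d' = 0 := by
    rintro (- | -) (- | -) h <;> simp [p, reassoc_of% hab, reassoc_of% hba] at h ⊢
  set L := (Label.std Z i).tensor (Label.std Z j) with hL
  -- `I` and `J` identify `X^{⊗ i} ⊗ Y^{⊗ j}` with the summand of the word, and `q` is the projector onto
  -- `Alt^i X ⊗ Alt^j Y`
  set q : tpow X i ⊗ tpow Y j ⟶ tpow X i ⊗ tpow Y j :=
    (Label.std X i).alt κ ⊗ₘ (Label.std Y j).alt κ with hq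
  set I : tpow X i ⊗ tpow Y j ⟶ tpow Z i ⊗ tpow Z j :=
    tens i (fun _ => a) ⊗ₘ tens j (fun _ => b) with hI
  set J : tpow Z i ⊗ tpow Z j ⟶ tpow X i ⊗ tpow Y j :=
    tens i (fun _ => a') ⊗ₘ tens j (fun _ => b') with hJ
  have hqq : q ≫ q = q := by
    rw [hq, tensorHom_comp_tensorHom, Label.alt_comp_alt, Label.alt_comp_alt]
  have hIJ : I ≫ J = 𝟙 _ := by
    rw [hI, hJ, tensorHom_comp_tensorHom, tens_comp, tens_comp, haa, hbb, tens_id, tens_id,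
      id_tensorHom_id]
  have hJI : J ≫ I = L.wordProj p (sumWord (Fin i) (Fin j)) := by
    rw [hI, hJ, tensorHom_comp_tensorHom, tens_comp, tens_comp, ← Label.homs_std,
      ← Label.homs_std, Label.homs_tensor, Label.wordProj, hL]
    congr 1
    funext k
    rcases k with k | k <;> rfl
  have hqI : q ≫ I = I ≫ L.actAlg κ (juxt κ (avgElt κ Perm.sign) (avgElt κ Perm.sign)) := by
    rw [hL, ← Label.actAlg_tensor, hq, hI, tensorHom_comp_tensorHom, tensorHom_comp_tensorHom,
      actAlg_std_naturality, actAlg_std_naturality]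
    rfl
  have h1 : (J ≫ q) ≫ (q ≫ I) = (Fintype.card (Perm (Fin i ⊕ Fin j)) /
      (wordStab (sumWord (Fin i) (Fin j))).card : κ) •
        L.wordProj p (sumWord (Fin i) (Fin j)) ≫ L.alt κ ≫
          L.wordProj p (sumWord (Fin i) (Fin j)) := by
    rw [Label.wordProj_alt_wordProj_sumWord κ L p hp hpq, Category.assoc, ← Category.assoc q q,
      hqq, hqI, ← hJI, Category.assoc]
  have h2 : (q ≫ I) ≫ (J ≫ q) = q := by
    rw [Category.assoc, reassoc_of% hIJ, hqq]
  rw [Label.imCls_alt_contentProj κ L p hp hpq, ← h1, ← imCls_comp_comm, h2, hq, imCls_tensor,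
    cls_altPow, cls_altPow]
  · exact Label.alt_comp_alt κ _
  · exact Label.alt_comp_alt κ _
  · rw [← Category.assoc, h2, ← Category.assoc, hqq]
  · simp only [Category.assoc, reassoc_of% hIJ, hqq]

/-- `[Alt^n (X ⊕ Y)] = ∑ [Alt^i X] [Alt^j Y]`. -/
theorem cls_altPow_of_biprod {X Y Z : A} (a : X ⟶ Z) (a' : Z ⟶ X) (b : Y ⟶ Z)
    (b' : Z ⟶ Y) (haa : a ≫ a' = 𝟙 X) (hbb : b ≫ b' = 𝟙 Y) (hab : a ≫ b' = 0) (hba : b ≫ a' = 0)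
    (hsum : a' ≫ a + b' ≫ b = 𝟙 Z) (n : ℕ) :
    K0.cls (altPow κ Z n) = ∑ ij ∈ Finset.HasAntidiagonal.antidiagonal n,
      K0.cls (altPow κ X ij.1) * K0.cls (altPow κ Y ij.2) := by
  set p : Bool → (Z ⟶ Z) := fun d => bif d then b' ≫ b else a' ≫ a with hpdef
  have hp : ∀ d, p d ≫ p d = p d := by
    rintro (- | -) <;> simp [p, reassoc_of% haa, reassoc_of% hbb]
  have hpq : ∀ d d', d ≠ d' → p d ≫ p d' = 0 := by
    rintro (- | -) (- | -) h <;> simp [p, reassoc_of% hab, reassoc_of% hba] at h ⊢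
  have hs : ∑ d, p d = 𝟙 Z := by simpa [p, add_comm] using hsum
  set L := Label.std Z n with hL
  let μ : ℕ × ℕ → Bool →₀ ℕ := fun ij => content (sumWord (Fin ij.1) (Fin ij.2))
  have hμ : ∀ ij, μ ij false = ij.1 ∧ μ ij true = ij.2 := by
    intro ij
    simp [μ, content, sumWord, Fintype.sum_sum_type]
  have hcard : ∀ w : Fin n → Bool, content w false + content w true = n := by
    intro w
    rw [content, Finsupp.finsetSum_apply, Finsupp.finsetSum_apply, ← Finset.sum_add_distrib]
    have : ∀ j, Finsupp.single (w j) 1 false + Finsupp.single (w j) 1 true = 1 := by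
      intro j
      cases w j <;> simp
    simp [this]
  have hw : ∀ (w : Fin n → Bool) (ij : ℕ × ℕ), content w = μ ij ↔
      (content w false, content w true) = ij := by
    intro w ij
    rw [Finsupp.ext_iff, Bool.forall_bool, (hμ ij).1, (hμ ij).2, Prod.ext_iff]
  -- the alternating projector is the sum of its orthogonal parts, one for each content `(i, j)`
  have h1 : L.alt κ = ∑ ij ∈ Finset.HasAntidiagonal.antidiagonal n,
      L.alt κ ≫ L.contentProj p (μ ij) := by
    rw [← Preadditive.comp_sum]
    conv_lhs => rw [← Category.comp_id (L.alt κ), ← L.sum_wordProj p hs]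
    congr 1
    simp only [Label.contentProj, hw]
    exact (Finset.sum_fiberwise_of_maps_to (fun w _ => by simpa using hcard w) _).symm
  have hexist : ∀ ij ∈ Finset.HasAntidiagonal.antidiagonal n,
      Nonempty (Fin n ≃ Fin ij.1 ⊕ Fin ij.2) := by
    intro ij hij
    rw [Finset.HasAntidiagonal.mem_antidiagonal] at hij
    exact ⟨(finCongr hij.symm).trans finSumFinEquiv.symm⟩
  have hidem : ∀ ij, (L.alt κ ≫ L.contentProj p (μ ij)) ≫ L.alt κ ≫ L.contentProj p (μ ij) =
      L.alt κ ≫ L.contentProj p (μ ij) := by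
    intro ij
    rw [Category.assoc, ← Category.assoc (L.contentProj p (μ ij)), ← Label.alt_contentProj,
      Category.assoc, L.contentProj_self p hp hpq, ← Category.assoc, Label.alt_comp_alt]
  have hμinj : ∀ ij kl, ij ≠ kl → μ ij ≠ μ kl := by
    intro ij kl hne h
    refine hne (Prod.ext ?_ ?_)
    · rw [← (hμ ij).1, h, (hμ kl).1]
    · rw [← (hμ ij).2, h, (hμ kl).2]
  rw [cls_altPow, ← hL, h1, imCls_sum]
  · refine Finset.sum_congr rfl fun ij hij => ?_
    rw [← imCls_alt_contentProj_sumWord κ a a' b b' haa hbb hab hba]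
    obtain ⟨e⟩ := hexist ij hij
    refine imCls_conj (Label.mapIso L ((Label.std Z ij.1).tensor (Label.std Z ij.2)) e) ?_ ?_
    · exact hidem ij
    · rw [Label.mapIso_hom, Category.assoc, ← Label.map_contentProj, reassoc_of% Label.alt_comp_map]
  · exact fun ij _ => hidem ij
  · intro ij _ kl _ hne
    rw [Category.assoc, ← Category.assoc (L.contentProj p (μ ij)), ← Label.alt_contentProj,
      Category.assoc, L.contentProj_of_ne p hpq (hμinj ij kl hne), Limits.comp_zero,
      Limits.comp_zero]

end Additivity

/-! ### Relations between classes of images from identities between symmetric polynomials -/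

section Relations

variable (κ : Type w) [Field κ] [CharZero κ] {A : Type u} [Category.{v} A] [Preadditive A]
  [Linear κ A] [MonoidalCategory A] [SymmetricCategory A] [Limits.HasFiniteBiproducts A]
  [IsIdempotentComplete A]

/-- The group of pairs consisting of a class in `K₀` and a symmetric polynomial that come from the
same virtual idempotent in the group algebra of `S_N`, acting on `X^{⊗ N}`. -/
noncomputable def schurPairs (X : A) (D : Type) [Fintype D] [DecidableEq D] (N : ℕ) :
    AddSubgroup (K0 A × MvPolynomial D κ) :=
  AddSubgroup.closure {z | ∃ e : MonoidAlgebra κ (Perm (Fin N)), e * e = e ∧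
    z = (imCls ((Label.std X N).actAlg κ e : tpow X N ⟶ tpow X N), charPoly κ D e)}

variable {X : A} {D : Type} [Fintype D] [DecidableEq D]

theorem actAlg_idem {P : A} {ι : Type*} (L : Label X P ι) {e : MonoidAlgebra κ (Perm ι)}
    (he : e * e = e) : (L.actAlg κ e : P ⟶ P) ≫ L.actAlg κ e = L.actAlg κ e := by
  conv_rhs => rw [← he, map_mul]
  rfl

/-- Idempotents acting on any object labelled by `N` factors `X` may be used. -/
theorem mem_schurPairs {P : A} {ι : Type*} [Fintype ι] [DecidableEq ι] (L : Label X P ι)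
    {e : MonoidAlgebra κ (Perm ι)} (he : e * e = e) {N : ℕ} (hN : Fintype.card ι = N) :
    ((imCls (L.actAlg κ e : P ⟶ P), charPoly κ D e) : K0 A × MvPolynomial D κ) ∈
      schurPairs κ X D N := by
  let φ : ι ≃ Fin N := Fintype.equivFinOfCardEq hN
  refine AddSubgroup.subset_closure
    ⟨MonoidAlgebra.mapDomainAlgHom κ κ φ.permCongrHom.toMonoidHom e, ?_, ?_⟩
  · rw [← map_mul, he]
  · rw [charPoly_conj]
    congr 1
    exact imCls_conj (Label.mapIso L (Label.std X N) φ) (actAlg_idem κ L he)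
      (Label.actAlg_conj κ L (Label.std X N) φ e)

theorem altPow_mem_schurPairs (X : A) (n : ℕ) :
    ((K0.cls (altPow κ X n), MvPolynomial.esymm D κ n) : K0 A × MvPolynomial D κ) ∈
      schurPairs κ X D n := by
  have h := mem_schurPairs κ (D := D) (Label.std X n) (avgElt_mul_self κ Perm.sign)
    (Fintype.card_fin n)
  rw [charPoly_sign, Fintype.card_fin] at h
  rw [cls_altPow]
  exact h

theorem symPow_mem_schurPairs (X : A) (n : ℕ) :
    ((K0.cls (symPow κ X n), ∑ μ ∈ Finset.univ.finsuppAntidiag n, MvPolynomial.monomial μ 1) :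
      K0 A × MvPolynomial D κ) ∈ schurPairs κ X D n := by
  have h := mem_schurPairs κ (D := D) (Label.std X n) (avgElt_mul_self κ 1) (Fintype.card_fin n)
  rw [charPoly_triv, Fintype.card_fin] at h
  rw [symPow, ← imCls_of_idem, charProj_eq]
  exact h

/-- A virtual idempotent is a difference of two families of idempotents. -/
theorem exists_multisets {N : ℕ} {z : K0 A × MvPolynomial D κ} (hz : z ∈ schurPairs κ X D N) :
    ∃ s t : Multiset (MonoidAlgebra κ (Perm (Fin N))), (∀ e ∈ s, e * e = e) ∧
      (∀ e ∈ t, e * e = e) ∧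
      z.1 = (s.map fun e => imCls ((Label.std X N).actAlg κ e : tpow X N ⟶ tpow X N)).sum -
        (t.map fun e => imCls ((Label.std X N).actAlg κ e : tpow X N ⟶ tpow X N)).sum ∧
      z.2 = charPoly κ D s.sum - charPoly κ D t.sum := by
  induction hz using AddSubgroup.closure_induction with
  | mem z hz =>
    obtain ⟨e, he, rfl⟩ := hz
    exact ⟨{e}, 0, by simpa using he, by simp, by simp, by simp⟩
  | zero => exact ⟨0, 0, by simp, by simp, by simp, by simp⟩
  | add x y _ _ hx hy =>
    obtain ⟨s, t, hs, ht, h1, h2⟩ := hx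
    obtain ⟨s', t', hs', ht', h1', h2'⟩ := hy
    refine ⟨s + s', t + t', ?_, ?_, ?_, ?_⟩
    · intro e he
      exact (Multiset.mem_add.mp he).elim (hs e) (hs' e)
    · intro e he
      exact (Multiset.mem_add.mp he).elim (ht e) (ht' e)
    · rw [Prod.fst_add, h1, h1', Multiset.map_add, Multiset.map_add, Multiset.sum_add,
        Multiset.sum_add]
      abel
    · rw [Prod.snd_add, h2, h2', Multiset.sum_add, Multiset.sum_add, map_add, map_add]
      abel
  | neg x _ hx =>
    obtain ⟨s, t, hs, ht, h1, h2⟩ := hx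
    exact ⟨t, s, ht, hs, by rw [Prod.fst_neg, h1, neg_sub], by rw [Prod.snd_neg, h2, neg_sub]⟩

/-- A class in `K₀` attached to a virtual idempotent is determined by its symmetric polynomial, if
there are enough variables. -/
theorem eq_zero_of_mem_schurPairs {N : ℕ} (hN : N ≤ Fintype.card D) {x : K0 A}
    (h : (x, (0 : MvPolynomial D κ)) ∈ schurPairs κ X D N) : x = 0 := by
  obtain ⟨s, t, hs, ht, h1, h2⟩ := exists_multisets κ h
  rw [eq_comm, sub_eq_zero] at h2
  simp only at h1
  rw [h1, sub_eq_zero]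
  refine sum_map_eq_of_charPoly_eq (by simpa using hN) _ ?_ ?_ s t hs ht h2
  · intro e f he hf hef hfe
    rw [map_add]
    refine imCls_add (actAlg_idem κ _ he) (actAlg_idem κ _ hf) ?_ ?_
    · exact (map_mul ((Label.std X N).actAlg κ) f e).symm.trans (by rw [hfe, map_zero])
    · exact (map_mul ((Label.std X N).actAlg κ) e f).symm.trans (by rw [hef, map_zero])
  · intro u v hu hv
    rw [map_mul, map_mul]
    refine imCls_comp_comm (P := tpow X N) (Q := tpow X N) ((Label.std X N).actAlg κ v)
      ((Label.std X N).actAlg κ u) ?_ ?_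
    · conv_rhs => rw [← hv, map_mul, map_mul]
      rfl
    · conv_rhs => rw [← hu, map_mul, map_mul]
      rfl

theorem eq_of_mem_schurPairs {N : ℕ} (hN : N ≤ Fintype.card D) {x y : K0 A} {f : MvPolynomial D κ}
    (hx : (x, f) ∈ schurPairs κ X D N) (hy : (y, f) ∈ schurPairs κ X D N) : x = y := by
  rw [← sub_eq_zero]
  refine eq_zero_of_mem_schurPairs κ hN (D := D) (X := X) ?_
  have := sub_mem hx hy
  rwa [Prod.mk_sub_mk, sub_self] at this

variable [MonoidalPreadditive A] [MonoidalLinear κ A]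

/-- The juxtaposition of idempotents corresponds to the product on both sides. -/
theorem mul_mem_schurPairs {i j : ℕ} {y z : K0 A × MvPolynomial D κ}
    (hy : y ∈ schurPairs κ X D i) (hz : z ∈ schurPairs κ X D j) :
    y * z ∈ schurPairs κ X D (i + j) := by
  induction hy using AddSubgroup.closure_induction with
  | mem y hy =>
    obtain ⟨e, he, rfl⟩ := hy
    induction hz using AddSubgroup.closure_induction with
    | mem z hz =>
      obtain ⟨f, hf, rfl⟩ := hz
      rw [Prod.mk_mul_mk, ← charPoly_juxt, ← imCls_tensor (actAlg_idem κ _ he)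
        (actAlg_idem κ _ hf), Label.actAlg_tensor]
      exact mem_schurPairs κ _ (by rw [juxt_mul_juxt, he, hf]) (by simp)
    | zero => rw [mul_zero]; exact zero_mem _
    | add x y _ _ hx hy => rw [mul_add]; exact add_mem hx hy
    | neg x _ hx => rw [mul_neg]; exact neg_mem hx
  | zero => rw [zero_mul]; exact zero_mem _
  | add x y _ _ hx hy => rw [add_mul]; exact add_mem hx hy
  | neg x _ hx => rw [neg_mul]; exact neg_mem hx

theorem cls_altPow_zero (X : A) : K0.cls (altPow κ X 0) = 1 := by
  have h : (Label.std X 0).alt κ = 𝟙 (𝟙_ A) := by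
    rw [Label.alt_eq, Fintype.card_unique, Nat.cast_one, inv_one, one_smul, Fintype.sum_unique]
    rw [show (default : Perm (Fin 0)) = Equiv.refl _ from rfl, Label.map_refl]
    erw [map_one]
    simp
  rw [cls_altPow, h, imCls_id, K0.cls_unit]

theorem cls_altPow_one (X : A) : K0.cls (altPow κ X 1) = K0.cls X := by
  have h : (Label.std X 1).alt κ = 𝟙 (X ⊗ 𝟙_ A) := by
    rw [Label.alt_eq, Fintype.card_unique, Nat.cast_one, inv_one, one_smul, Fintype.sum_unique]
    rw [show (default : Perm (Fin 1)) = Equiv.refl _ from Subsingleton.elim _ _, Label.map_refl]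
    erw [map_one]
    simp
  rw [cls_altPow, h, imCls_id]
  exact K0.cls_congr (ρ_ X)

theorem one_mem_schurPairs : (1 : K0 A × MvPolynomial D κ) ∈ schurPairs κ X D 0 := by
  have := altPow_mem_schurPairs κ (D := D) X 0
  rwa [cls_altPow_zero, MvPolynomial.esymm_zero] at this

/-- The relation between the exterior and the symmetric powers. -/
theorem sum_cls_altPow_mul_cls_symPow (X : A) {n : ℕ} (hn : n ≠ 0) :
    ∑ ij ∈ Finset.HasAntidiagonal.antidiagonal n,
      (-1) ^ ij.1 * K0.cls (altPow κ X ij.1) * K0.cls (symPow κ X ij.2) = 0 := by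
  refine eq_zero_of_mem_schurPairs κ (D := Fin n) (X := X) (Fintype.card_fin n).ge ?_
  rw [← sum_homogeneous_mul_esymm (D := Fin n) κ hn]
  have h : ∀ ij ∈ Finset.HasAntidiagonal.antidiagonal n,
      (((-1) ^ ij.1 * K0.cls (altPow κ X ij.1) * K0.cls (symPow κ X ij.2),
        (-1) ^ ij.1 * MvPolynomial.esymm (Fin n) κ ij.1 *
        (∑ μ ∈ Finset.univ.finsuppAntidiag ij.2, MvPolynomial.monomial μ 1)) :
        K0 A × MvPolynomial (Fin n) κ) ∈ schurPairs κ X (Fin n) n := by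
    intro ij hij
    rw [Finset.HasAntidiagonal.mem_antidiagonal] at hij
    have h1 := mul_mem_schurPairs κ (altPow_mem_schurPairs κ (D := Fin n) X ij.1)
      (symPow_mem_schurPairs κ (D := Fin n) X ij.2)
    rw [hij, Prod.mk_mul_mk] at h1
    rcases neg_one_pow_eq_or (K0 A × MvPolynomial (Fin n) κ) ij.1 with h2 | h2
    · have h3 := congrArg Prod.fst h2
      have h4 := congrArg Prod.snd h2
      simp only [Prod.pow_fst, Prod.pow_snd, Prod.fst_neg, Prod.snd_neg, Prod.fst_one,
        Prod.snd_one] at h3 h4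
      rwa [h3, h4, one_mul, one_mul]
    · have h3 := congrArg Prod.fst h2
      have h4 := congrArg Prod.snd h2
      simp only [Prod.pow_fst, Prod.pow_snd, Prod.fst_neg, Prod.snd_neg, Prod.fst_one,
        Prod.snd_one] at h3 h4
      rw [h3, h4, neg_one_mul, neg_one_mul, neg_mul, neg_mul]
      exact neg_mem h1
  have h2 := sum_mem h
  convert h2 using 1
  exact Prod.ext (by rw [Prod.fst_sum]) (by rw [Prod.snd_sum])

theorem altPow_altPow_mem_schurPairs (X : A) (m r : ℕ) :
    ((K0.cls (altPow κ (altPow κ X r) m),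
      ∑ S ∈ (Finset.univ.powersetCard r : Finset (Finset D)).powersetCard m,
        ∏ s ∈ S, ∏ d ∈ s, (MvPolynomial.X d : MvPolynomial D κ)) : K0 A × MvPolynomial D κ) ∈
      schurPairs κ X D (r * m) := by
  obtain ⟨i, e, h1, h2⟩ := (IsIdempotentComplete.idempotents_split _ _
    (charProj_idem κ X r Perm.sign)).choose_spec
  -- both sides come from the idempotent `wreathElt`, acting on `(X^{⊗ r})^{⊗ m}` with `m` blocks
  have h3 := mem_schurPairs κ (D := D) ((Label.std X r).block m)
    (wreathElt_mul_self κ (α := Fin m) (β := Fin r)) (N := r * m) (by simp [mul_comm])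
  rw [charPoly_wreathElt, Fintype.card_fin, Fintype.card_fin,
    Label.imCls_wreathElt κ (Label.std X r) m i e h1 (h2.trans (charProj_eq κ X r Perm.sign))] at h3
  exact h3

end Relations

/-! ### Stability of symmetric polynomials in the number of variables -/

section Stability

open MvPolynomial

theorem isHomogeneous_esymm (σ S : Type*) [Fintype σ] [CommRing S] (k : ℕ) :
    (esymm σ S k).IsHomogeneous k := by
  refine IsHomogeneous.sum _ _ _ fun t ht => ?_
  have h := IsHomogeneous.prod t (fun i => (X i : MvPolynomial σ S)) (fun _ => 1)
    fun i _ => isHomogeneous_X S i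
  rwa [Finset.sum_const, (Finset.mem_powersetCard.mp ht).2, smul_eq_mul, mul_one] at h

variable {S : Type u} [CommRing S]

/-- The weights of the variables standing for the elementary symmetric polynomials. -/
def esymmWeight (n : ℕ) : Fin n → ℕ := fun i => i + 1

theorem isHomogeneous_aeval_esymm_monomial (σ : Type*) [Fintype σ] {n : ℕ} (m : Fin n →₀ ℕ)
    (a : S) : (aeval (fun i : Fin n => esymm σ S (i + 1)) (monomial m a)).IsHomogeneous
      (Finsupp.weight (esymmWeight n) m) := by
  rw [aeval_monomial]
  refine IsHomogeneous.C_mul ?_ _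
  have h := IsHomogeneous.prod m.support (fun i : Fin n => esymm σ S (i + 1) ^ m i)
    (fun i => (i + 1) * m i) fun i _ => (isHomogeneous_esymm σ S _).pow _
  rw [Finsupp.prod, Finsupp.weight_apply, Finsupp.sum]
  convert h using 1
  exact Finset.sum_congr rfl fun i _ => by rw [smul_eq_mul, mul_comm, esymmWeight]

/-- Inserting the elementary symmetric polynomials turns the weighted degree into the degree. -/
theorem homogeneousComponent_aeval_esymm (σ : Type*) [Fintype σ] {n : ℕ} (d : ℕ)
    (G : MvPolynomial (Fin n) S) :
    homogeneousComponent d (aeval (fun i : Fin n => esymm σ S (i + 1)) G) =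
      aeval (fun i : Fin n => esymm σ S (i + 1))
        (weightedHomogeneousComponent (esymmWeight n) d G) := by
  induction G using MvPolynomial.induction_on' with
  | monomial m a =>
    rw [homogeneousComponent_of_mem (isHomogeneous_aeval_esymm_monomial σ m a),
      weightedHomogeneousComponent_of_mem (isWeightedHomogeneous_monomial _ m a rfl)]
    split_ifs
    · rfl
    · rw [map_zero]
  | add p q hp hq => simp only [map_add, hp, hq]

theorem isHomogeneous_aeval_esymm (σ : Type*) [Fintype σ] {n d : ℕ} {G : MvPolynomial (Fin n) S}
    (hG : G.IsWeightedHomogeneous (esymmWeight n) d) :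
    (aeval (fun i : Fin n => esymm σ S (i + 1)) G).IsHomogeneous d := by
  rw [← hG.weightedHomogeneousComponent_same, ← homogeneousComponent_aeval_esymm]
  exact homogeneousComponent_isHomogeneous _ _

theorem aeval_esymm_injective (σ : Type*) [Fintype σ] {n : ℕ} (hn : n ≤ Fintype.card σ) :
    Function.Injective (aeval (R := S) (fun i : Fin n => esymm σ S (i + 1))) := by
  intro p q h
  refine esymmAlgHom_injective S hn (Subtype.ext ?_)
  rw [esymmAlgHom_apply, esymmAlgHom_apply]
  exact h

theorem isWeightedHomogeneous_of_aeval_esymm (σ : Type*) [Fintype σ] {n d : ℕ}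
    (hn : n ≤ Fintype.card σ) {G : MvPolynomial (Fin n) S}
    (hG : (aeval (fun i : Fin n => esymm σ S (i + 1)) G).IsHomogeneous d) :
    G.IsWeightedHomogeneous (esymmWeight n) d := by
  have h := homogeneousComponent_aeval_esymm σ d G
  rw [homogeneousComponent_eq_self hG] at h
  rw [aeval_esymm_injective σ hn h]
  exact weightedHomogeneousComponent_mem (esymmWeight n) G d

open Classical in
theorem coeff_aeval_restrict {σ : Type*} (s : Finset σ) {m : σ →₀ ℕ} (hm : m.support ⊆ s)
    (H : MvPolynomial σ S) :
    coeff m (aeval (fun i => if i ∈ s then (X i : MvPolynomial σ S) else 0) H) = coeff m H := by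
  induction H using MvPolynomial.induction_on' with
  | monomial u a =>
    rw [aeval_monomial]
    by_cases hu : u.support ⊆ s
    · rw [Finsupp.prod, Finset.prod_congr rfl (g := fun i => (X i : MvPolynomial σ S) ^ u i)
        fun i hi => by rw [if_pos (hu hi)], monomial_eq]
      rfl
    · obtain ⟨i, hi, his⟩ := Finset.not_subset.mp hu
      rw [Finsupp.prod, Finset.prod_eq_zero hi
        (by rw [if_neg his, zero_pow (Finsupp.mem_support_iff.mp hi)]), mul_zero, coeff_zero,
        coeff_monomial, if_neg]
      rintro rfl
      exact hu hm
  | add p q hp hq => simp only [map_add, coeff_add, hp, hq]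

open Classical in
/-- A homogeneous polynomial of degree `d` vanishes if it does so whenever all but `d` of the
variables are replaced by zero. -/
theorem eq_zero_of_restrict {σ : Type*} {d : ℕ} {H : MvPolynomial σ S} (hH : H.IsHomogeneous d)
    (h : ∀ s : Finset σ, s.card ≤ d →
      aeval (fun i => if i ∈ s then (X i : MvPolynomial σ S) else 0) H = 0) : H = 0 := by
  ext m
  by_contra hm
  have hd : m.degree = d := by
    by_contra h1
    exact hm (hH.coeff_eq_zero h1)
  refine hm ?_
  rw [← coeff_aeval_restrict m.support (Finset.Subset.refl _), h]
  rw [← hd, Finsupp.degree, Finset.card_eq_sum_ones]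
  exact Finset.sum_le_sum fun i hi => Nat.one_le_iff_ne_zero.mpr (Finsupp.mem_support_iff.mp hi)

/-- Extending a family by zeros does not change its elementary symmetric functions. -/
theorem aeval_esymm_extend {R : Type*} [CommRing R] [Algebra S R] {τ υ : Type*} [Fintype τ]
    [Fintype υ] (j : τ ↪ υ) (y : υ → R) (hy : ∀ b ∉ Set.range j, y b = 0) (k : ℕ) :
    aeval y (esymm υ S k) = aeval (y ∘ j) (esymm τ S k) := by
  simp only [esymm, map_sum, map_prod, aeval_X]
  have h := Finset.powersetCard_map j k Finset.univ
  rw [← Finset.sum_subset (Finset.powersetCard_mono (Finset.subset_univ (Finset.univ.map j))), h,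
    Finset.sum_map]
  · refine Finset.sum_congr rfl fun t _ => ?_
    simp
  · intro t ht ht'
    have : ∃ b ∈ t, b ∉ Set.range j := by
      by_contra! h1
      refine ht' (Finset.mem_powersetCard.mpr ⟨fun b hb => ?_, (Finset.mem_powersetCard.mp ht).2⟩)
      obtain ⟨a, rfl⟩ := h1 b hb
      simp
    obtain ⟨b, hb, hbj⟩ := this
    exact Finset.prod_eq_zero hb (hy b hbj)

/-- Symmetric polynomials of degree `d`, given for every number of variables and compatible with the
insertion of zeros, are expressed by the same polynomial in the elementary symmetric ones as soon as
this holds for some number `n ≥ d` of variables. -/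
theorem aeval_esymm_eq_of_stable (F : ∀ (τ : Type) [Fintype τ], MvPolynomial τ S) {n d : ℕ}
    (hd : d ≤ n) (hF : ∀ (τ : Type) [Fintype τ], (F τ).IsHomogeneous d)
    (hext : ∀ (τ υ : Type) [Fintype τ] [Fintype υ] (j : τ ↪ υ) (R : Type u) [CommRing R]
      [Algebra S R] (y : υ → R), (∀ b ∉ Set.range j, y b = 0) →
        aeval y (F υ) = aeval (y ∘ j) (F τ))
    (G : MvPolynomial (Fin n) S) (hG : aeval (fun i : Fin n => esymm (Fin n) S (i + 1)) G = F (Fin n))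
    (σ : Type) [Fintype σ] : aeval (fun i : Fin n => esymm σ S (i + 1)) G = F σ := by
  classical
  have hGw : G.IsWeightedHomogeneous (esymmWeight n) d :=
    isWeightedHomogeneous_of_aeval_esymm (Fin n) (Fintype.card_fin n).ge (hG ▸ hF (Fin n))
  rw [← sub_eq_zero]
  -- after restriction to at most `d ≤ n` variables, both sides are specializations of the identity `hG`
  refine eq_zero_of_restrict ((isHomogeneous_aeval_esymm σ hGw).sub (hF σ)) fun s hs => ?_
  set y : σ → MvPolynomial σ S := fun i => if i ∈ s then X i else 0 with hy
  obtain ⟨j⟩ : Nonempty (s ↪ Fin n) :=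
    Function.Embedding.nonempty_of_card_le (by simpa using hs.trans hd)
  let θ : Fin n → MvPolynomial σ S := Function.extend j (fun i => X i.1) 0
  have hθ : ∀ b ∉ Set.range j, θ b = 0 := fun b hb => Function.extend_apply' _ _ _ hb
  have hy0 : ∀ b ∉ Set.range (Function.Embedding.subtype (· ∈ s)), y b = 0 := by
    intro b hb
    refine if_neg fun h => hb ⟨⟨b, h⟩, rfl⟩
  have hyθ : y ∘ Function.Embedding.subtype (· ∈ s) = θ ∘ j := by
    funext i
    have h2 : θ (j i) = X i.1 := j.injective.extend_apply (fun i : s => X i.1) 0 i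
    exact (if_pos i.2).trans h2.symm
  have he : ∀ k, aeval y (esymm σ S k) = aeval θ (esymm (Fin n) S k) := by
    intro k
    rw [aeval_esymm_extend (Function.Embedding.subtype (· ∈ s)) y hy0, hyθ,
      ← aeval_esymm_extend j θ hθ]
  have h1 : ∀ (ρ : Type) (z : ρ → MvPolynomial σ S) [Fintype ρ],
      aeval z (aeval (fun i : Fin n => esymm ρ S (i + 1)) G) =
      aeval (fun i : Fin n => aeval z (esymm ρ S (i + 1))) G := by
    intro ρ z _
    rw [← AlgHom.comp_apply, comp_aeval]
  rw [map_sub, sub_eq_zero, h1, hext s σ (Function.Embedding.subtype (· ∈ s)) _ y hy0, hyθ,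
    ← hext s (Fin n) j _ θ hθ, ← hG, h1]
  simp only [he]

end Stability

section Plethysm

open MvPolynomial

/-- The coefficient of `t^m` in the product of all `1 + x_{i_1} ⋯ x_{i_r} t`. -/
noncomputable def plethysmPoly (S : Type*) [CommRing S] (m r : ℕ) (τ : Type*) [Fintype τ] :
    MvPolynomial τ S :=
  ∑ W ∈ (Finset.univ.powersetCard r : Finset (Finset τ)).powersetCard m, ∏ T ∈ W, ∏ i ∈ T, X i

theorem isHomogeneous_plethysmPoly (S : Type*) [CommRing S] (m r : ℕ) (τ : Type*) [Fintype τ] :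
    (plethysmPoly S m r τ).IsHomogeneous (r * m) := by
  refine IsHomogeneous.sum _ _ _ fun W hW => ?_
  rw [Finset.mem_powersetCard] at hW
  have h := IsHomogeneous.prod W (fun T => ∏ i ∈ T, (X i : MvPolynomial τ S)) (fun T => r) ?_
  · rwa [Finset.sum_const, hW.2, smul_eq_mul, mul_comm] at h
  · intro T hT
    have h := IsHomogeneous.prod T (fun i => (X i : MvPolynomial τ S)) (fun _ => 1)
      fun i _ => isHomogeneous_X S i
    rwa [Finset.sum_const, (Finset.mem_powersetCard.mp (hW.1 hT)).2, smul_eq_mul, mul_one] at h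

theorem aeval_plethysmPoly {S R : Type*} [CommRing S] [CommRing R] [Algebra S R] (m r : ℕ)
    {τ : Type*} [Fintype τ] (y : τ → R) :
    aeval y (plethysmPoly S m r τ) = PowerSeries.coeff m
      (∏ T ∈ Finset.univ.powersetCard r, (1 + PowerSeries.C (∏ i ∈ T, y i) * PowerSeries.X)) := by
  rw [coeff_prod_one_add, plethysmPoly]
  simp only [map_sum, map_prod, aeval_X]

theorem prod_powersetCard_extend {R M : Type*} [CommRing R] [CommMonoid M] {τ υ : Type*} [Fintype τ]
    [Fintype υ] (j : τ ↪ υ) (y : υ → R) (hy : ∀ b ∉ Set.range j, y b = 0) (r : ℕ) (φ : R → M)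
    (hφ : φ 0 = 1) :
    ∏ T ∈ Finset.univ.powersetCard r, φ (∏ i ∈ T, y i) =
      ∏ T ∈ Finset.univ.powersetCard r, φ (∏ i ∈ T, y (j i)) := by
  have h := Finset.powersetCard_map j r Finset.univ
  rw [← Finset.prod_subset (Finset.powersetCard_mono (Finset.subset_univ (Finset.univ.map j))), h,
    Finset.prod_map]
  · refine Finset.prod_congr rfl fun t _ => ?_
    simp
  · intro t ht ht'
    have : ∃ b ∈ t, b ∉ Set.range j := by
      by_contra! h1
      refine ht' (Finset.mem_powersetCard.mpr ⟨fun b hb => ?_, (Finset.mem_powersetCard.mp ht).2⟩)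
      obtain ⟨a, rfl⟩ := h1 b hb
      simp
    obtain ⟨b, hb, hbj⟩ := this
    rw [Finset.prod_eq_zero hb (hy b hbj), hφ]

theorem aeval_univPP (m r : ℕ) :
    aeval (fun i : Fin (r * m) => esymm (Fin (r * m)) ℤ (i + 1)) (univPP m r) =
      plethysmPoly ℤ m r (Fin (r * m)) := by
  have h : aeval (fun i : Fin (r * m) => esymm (Fin (r * m)) ℤ (i + 1)) (univPP m r) = _ :=
    (univPP_exists m r).choose_spec
  rw [h, ← aeval_X_left_apply (plethysmPoly ℤ m r _), aeval_plethysmPoly, ← Polynomial.coeff_coe]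
  congr 1
  rw [← Polynomial.coeToPowerSeries.ringHom_apply, map_prod]
  simp only [Polynomial.coeToPowerSeries.ringHom_apply, Polynomial.coe_add, Polynomial.coe_one,
    Polynomial.coe_mul, Polynomial.coe_C, Polynomial.coe_X]

theorem isWeightedHomogeneous_univPP (m r : ℕ) :
    (univPP m r).IsWeightedHomogeneous (esymmWeight (r * m)) (r * m) :=
  isWeightedHomogeneous_of_aeval_esymm (Fin (r * m)) (Fintype.card_fin _).ge
    (aeval_univPP m r ▸ isHomogeneous_plethysmPoly ℤ m r _)

/-- The defining property of `P_{m,r}` for an arbitrary number of variables. -/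
theorem aeval_univPP_stable (m r : ℕ) (σ : Type) [Fintype σ] :
    aeval (fun i : Fin (r * m) => esymm σ ℤ (i + 1)) (univPP m r) = plethysmPoly ℤ m r σ := by
  refine aeval_esymm_eq_of_stable (fun τ _ => plethysmPoly ℤ m r τ) le_rfl
    (fun τ _ => isHomogeneous_plethysmPoly ℤ m r τ) ?_ _ (aeval_univPP m r) σ
  intro τ υ _ _ j R _ _ y hy
  rw [aeval_plethysmPoly, aeval_plethysmPoly, prod_powersetCard_extend j y hy r
    (fun z => 1 + PowerSeries.C z * PowerSeries.X) (by simp)]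
  rfl

end Plethysm

/-! ### The operations on `1 + t R[[t]]` in terms of roots -/

section Product

open MvPolynomial

theorem rescale_C {R : Type*} [CommRing R] (a b : R) :
    PowerSeries.rescale a (PowerSeries.C b) = PowerSeries.C b := by
  ext k
  rw [PowerSeries.coeff_rescale, PowerSeries.coeff_C]
  split_ifs with h
  · rw [h, pow_zero, one_mul]
  · rw [mul_zero]

theorem coeff_prod_rescale {R τ : Type*} [CommRing R] [Fintype τ] [DecidableEq τ]
    (n : ℕ) (y : τ → R) (g : PowerSeries R) :
    PowerSeries.coeff n (∏ i, PowerSeries.rescale (y i) g) =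
      ∑ l ∈ (Finset.univ : Finset τ).finsuppAntidiag n,
        ∏ i, (y i ^ l i * PowerSeries.coeff (l i) g) := by
  rw [PowerSeries.coeff_prod]
  simp only [PowerSeries.coeff_rescale]

open Classical in
/-- The coefficient of `t^n` in the product of the series `g (x_i t)`. -/
noncomputable def circPoly {S : Type*} [CommRing S] (n : ℕ) (g : PowerSeries S) (τ : Type*)
    [Fintype τ] : MvPolynomial τ S :=
  ∑ l ∈ (Finset.univ : Finset τ).finsuppAntidiag n, ∏ i, (C (PowerSeries.coeff (l i) g) * X i ^ l i)

theorem isHomogeneous_circPoly {S : Type*} [CommRing S] (n : ℕ) (g : PowerSeries S) (τ : Type*)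
    [Fintype τ] : (circPoly n g τ).IsHomogeneous n := by
  classical
  refine IsHomogeneous.sum _ _ _ fun l hl => ?_
  have h := IsHomogeneous.prod Finset.univ
    (fun i => (C (PowerSeries.coeff (l i) g) * X i ^ l i : MvPolynomial τ S)) l
    fun i _ => isHomogeneous_C_mul_X_pow _ i (l i)
  rwa [(Finset.mem_finsuppAntidiag.mp hl).1] at h

theorem aeval_circPoly {S R : Type*} [CommRing S] [CommRing R] [Algebra S R] (n : ℕ)
    (g : PowerSeries S) {τ : Type*} [Fintype τ] (y : τ → R) :
    aeval y (circPoly n g τ) = PowerSeries.coeff n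
      (∏ i, PowerSeries.rescale (y i) (PowerSeries.map (algebraMap S R) g)) := by
  classical
  rw [coeff_prod_rescale, circPoly, map_sum]
  refine Finset.sum_congr rfl fun l _ => ?_
  rw [map_prod]
  refine Finset.prod_congr rfl fun i _ => ?_
  rw [map_mul, map_pow, aeval_X, aeval_C, PowerSeries.coeff_map, mul_comm]

/-- The generic power series `1 + s_1 t + ⋯ + s_n t^n`. -/
noncomputable def genericSeries (n : ℕ) : PowerSeries (MvPolynomial (Fin n) ℤ) :=
  PowerSeries.mk fun k => if k = 0 then 1 else if h : k - 1 < n then X ⟨k - 1, h⟩ else 0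

theorem map_genericSeries {R : Type*} [CommRing R] (n : ℕ) (s : ℕ → R) (k : ℕ) (hk : k ≤ n) :
    (aeval fun j : Fin n => s (j + 1)) (PowerSeries.coeff k (genericSeries n)) =
      if k = 0 then 1 else s k := by
  rw [genericSeries, PowerSeries.coeff_mk]
  split_ifs with h1 h2
  · simp
  · rw [aeval_X]
    congr 1
    simp only
    omega
  · omega

/-- The defining property of `P_n` with the second group of variables replaced by a generic series:
the elementary symmetric polynomials in the `x_j` are algebraically independent, so they may be
replaced by indeterminates. -/
theorem aeval_univP (n : ℕ) :
    aeval (fun i : Fin n => esymm (Fin n) (MvPolynomial (Fin n) ℤ) (i + 1))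
      (sumAlgEquiv ℤ (Fin n) (Fin n) (univP n)) = circPoly n (genericSeries n) (Fin n) := by
  have hspec : aeval (Sum.elim
      (fun i : Fin n => rename Sum.inl (esymm (Fin n) ℤ (i + 1)))
      (fun j : Fin n => rename Sum.inr (esymm (Fin n) ℤ (j + 1)))) (univP n) =
      (∏ i : Fin n, ∏ j : Fin n,
        (1 + Polynomial.C (X (Sum.inl i) * X (Sum.inr j)) * Polynomial.X :
      Polynomial (MvPolynomial (Fin n ⊕ Fin n) ℤ))).coeff n := (univP_exists n).choose_spec
  -- the embedding of the indeterminates as elementary symmetric polynomials in the `x_j`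
  let φ : MvPolynomial (Fin n) ℤ →ₐ[ℤ] MvPolynomial (Fin n) ℤ :=
    aeval fun j : Fin n => esymm (Fin n) ℤ (j + 1)
  have hφ : Function.Injective φ := aeval_esymm_injective (Fin n) (Fintype.card_fin n).ge
  apply map_injective φ.toRingHom hφ
  have h1 := congrArg (sumAlgEquiv ℤ (Fin n) (Fin n)) hspec
  have h2 : ∀ P : MvPolynomial (Fin n ⊕ Fin n) ℤ, sumAlgEquiv ℤ (Fin n) (Fin n) (aeval (Sum.elim
      (fun i : Fin n => rename Sum.inl (esymm (Fin n) ℤ (i + 1)))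
      (fun j : Fin n => rename Sum.inr (esymm (Fin n) ℤ (j + 1)))) P) =
      map φ.toRingHom (aeval (fun i : Fin n => esymm (Fin n) (MvPolynomial (Fin n) ℤ) (i + 1))
      (sumAlgEquiv ℤ (Fin n) (Fin n) P)) := by
    intro P
    induction P using MvPolynomial.induction_on with
    | C a => simp
    | add p q hp hq => simp only [map_add, hp, hq]
    | mul_X p i hp =>
      simp only [map_mul, hp]
      congr 1
      rcases i with i | i
      · simp [esymm]
      · simp [esymm, φ]
  have h3 : PowerSeries.map φ.toRingHom (genericSeries n) =
      ∏ j : Fin n, (1 + PowerSeries.C (X j) * PowerSeries.X) := by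
    ext1 k
    rw [coeff_prod_one_add, PowerSeries.coeff_map]
    rcases Nat.lt_or_ge n k with hk | hk
    · rw [Finset.powersetCard_eq_empty.mpr (by simpa using hk), Finset.sum_empty, genericSeries,
        PowerSeries.coeff_mk, if_neg (by omega), dif_neg (by omega), map_zero]
    · refine (map_genericSeries n (fun k => esymm (Fin n) ℤ k) k hk).trans ?_
      split_ifs with h0
      · subst h0; simp
      · rfl
  have h4 : ∀ (g : PowerSeries (MvPolynomial (Fin n) ℤ)),
      map φ.toRingHom (circPoly n g (Fin n)) =
        aeval (X : Fin n → MvPolynomial (Fin n) (MvPolynomial (Fin n) ℤ))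
          (circPoly n (PowerSeries.map φ.toRingHom g) (Fin n)) := by
    intro g
    rw [aeval_X_left_apply]
    simp [circPoly]
  rw [← h2, h1, h4, aeval_circPoly, h3]
  change (sumAlgEquiv ℤ (Fin n) (Fin n)).toAlgHom.toRingHom _ = _
  rw [← Polynomial.coeff_map, ← Polynomial.coeff_coe]
  congr 1
  rw [Polynomial.map_prod, ← Polynomial.coeToPowerSeries.ringHom_apply, map_prod]
  refine Finset.prod_congr rfl fun i _ => ?_
  rw [Polynomial.map_prod, map_prod, map_prod, map_prod]
  refine Finset.prod_congr rfl fun j _ => ?_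
  simp [rescale_C]
  ring

/-- The defining property of `P_n` for an arbitrary number of variables in the first group. -/
theorem aeval_univP_stable (n : ℕ) (σ : Type) [Fintype σ] :
    aeval (fun i : Fin n => esymm σ (MvPolynomial (Fin n) ℤ) (i + 1))
      (sumAlgEquiv ℤ (Fin n) (Fin n) (univP n)) = circPoly n (genericSeries n) σ := by
  refine aeval_esymm_eq_of_stable (fun τ _ => circPoly n (genericSeries n) τ) le_rfl
    (fun τ _ => isHomogeneous_circPoly n _ τ) ?_ _ (aeval_univP n) σ
  intro τ υ _ _ j R _ _ y hy
  rw [aeval_circPoly, aeval_circPoly]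
  congr 1
  refine (Fintype.prod_of_injective j j.injective _ _ (fun i hi => ?_) fun i => rfl).symm
  rw [hy i hi, PowerSeries.rescale_zero, RingHom.comp_apply,
    ← PowerSeries.coeff_zero_eq_constantCoeff_apply, PowerSeries.coeff_map, genericSeries,
    PowerSeries.coeff_mk, if_pos rfl, map_one, map_one]

end Product

section Roots

variable {R : Type u} [CommRing R]

/-- The power series `∏ (1 + ξ_i t)`, whose roots are the family `ξ` in the usual abuse of language. -/
noncomputable def rootSeries {σ : Type*} [Fintype σ] (ξ : σ → R) : PowerSeries R :=
  ∏ i, (1 + PowerSeries.C (ξ i) * PowerSeries.X)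

theorem coeff_rootSeries {σ : Type*} [Fintype σ] (ξ : σ → R) (k : ℕ) :
    PowerSeries.coeff k (rootSeries ξ) = MvPolynomial.aeval ξ (MvPolynomial.esymm σ ℤ k) := by
  rw [rootSeries, coeff_prod_one_add, MvPolynomial.esymm]
  simp

/-- If `f = ∏ (1 + ξ_i t)`, then `f ∘ g = ∏ g (ξ_i t)`. -/
theorem circ_rootSeries {σ : Type} [Fintype σ] (ξ : σ → R) (g : PowerSeries R)
    (hg : PowerSeries.coeff 0 g = 1) :
    circ (rootSeries ξ) g = ∏ i, PowerSeries.rescale (ξ i) g := by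
  classical
  ext n
  let ψ : MvPolynomial (Fin n) ℤ →+* R :=
    (MvPolynomial.aeval fun j : Fin n => PowerSeries.coeff (j + 1) g : _ →ₐ[ℤ] R).toRingHom
  let := ψ.toAlgebra
  have h1 : ∀ P : MvPolynomial (Fin n ⊕ Fin n) ℤ,
      MvPolynomial.aeval (Sum.elim (fun i : Fin n => PowerSeries.coeff (i + 1) (rootSeries ξ))
        (fun j : Fin n => PowerSeries.coeff (j + 1) g)) P =
      MvPolynomial.aeval ξ (MvPolynomial.aeval
        (fun i : Fin n => MvPolynomial.esymm σ (MvPolynomial (Fin n) ℤ) (i + 1))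
        (MvPolynomial.sumAlgEquiv ℤ (Fin n) (Fin n) P)) := by
    intro P
    induction P using MvPolynomial.induction_on with
    | C a => simp
    | add p q hp hq => simp only [map_add, hp, hq]
    | mul_X p i hp =>
      simp only [map_mul, hp]
      congr 1
      rcases i with i | i
      · simp [coeff_rootSeries, MvPolynomial.esymm]
      · rw [MvPolynomial.aeval_X, show MvPolynomial.sumAlgEquiv ℤ (Fin n) (Fin n)
          (MvPolynomial.X (Sum.inr i)) = MvPolynomial.C (MvPolynomial.X i) by simp,
          MvPolynomial.aeval_C, MvPolynomial.algebraMap_eq, MvPolynomial.aeval_C]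
        exact (MvPolynomial.aeval_X (R := ℤ) (fun j : Fin n => PowerSeries.coeff (j + 1) g) i).symm
  rw [circ, PowerSeries.coeff_mk, evalP, h1, aeval_univP_stable, aeval_circPoly,
    coeff_prod_rescale, coeff_prod_rescale]
  refine Finset.sum_congr rfl fun l hl => Finset.prod_congr rfl fun i _ => ?_
  have hl' : l i ≤ n := by
    rw [← (Finset.mem_finsuppAntidiag.mp hl).1]
    exact Finset.single_le_sum (f := l) (fun _ _ => Nat.zero_le _) (Finset.mem_univ i)
  congr 1
  rw [PowerSeries.coeff_map]
  refine (map_genericSeries n (fun k => PowerSeries.coeff k g) _ hl').trans ?_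
  split_ifs with h0
  · rw [h0, hg]
  · rfl

/-- If `f = ∏ (1 + ξ_i t)`, then `Λ^r f` has the products of `r` of the `ξ_i` as roots. -/
theorem bigLam_rootSeries {σ : Type} [Fintype σ] (ξ : σ → R) (r : ℕ) :
    bigLam r (rootSeries ξ) = rootSeries
      (fun T : ↥(Finset.powersetCard r (Finset.univ : Finset σ)) => ∏ i ∈ T.1, ξ i) := by
  ext m
  conv_rhs => rw [rootSeries]
  rw [Finset.prod_coe_sort (Finset.powersetCard r (Finset.univ : Finset σ))
    (fun T => 1 + PowerSeries.C (∏ i ∈ T, ξ i) * PowerSeries.X), ← aeval_plethysmPoly (S := ℤ),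
    ← aeval_univPP_stable, bigLam, PowerSeries.coeff_mk, evalPP, ← AlgHom.comp_apply,
    MvPolynomial.comp_aeval]
  simp only [coeff_rootSeries]

end Roots

/-! ### The identities of the `λ`-ring `1 + t R[[t]]` -/

section Splitting

variable {R : Type u} [CommRing R]

/-- Up to any given order, a power series with constant coefficient `1` acquires roots in an
extension of the ring of coefficients. -/
theorem exists_rootSeries (f : PowerSeries R) (hf : PowerSeries.coeff 0 f = 1) (n : ℕ) :
    ∃ (S : Type u) (_ : CommRing S) (φ : R →+* S), Function.Injective φ ∧ ∃ ξ : Fin n → S,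
      ∀ k ≤ n, φ (PowerSeries.coeff k f) = PowerSeries.coeff k (rootSeries ξ) := by
  rcases subsingleton_or_nontrivial R with hR | hR
  · exact ⟨R, inferInstance, RingHom.id R, fun _ _ h => h, 0, fun _ _ => Subsingleton.elim _ _⟩
  -- split the reversed polynomial `t^n + f_1 t^{n-1} + ⋯ + f_n`, which is monic, into factors `t + ξ_i`
  let p : Polynomial R := ∑ k ∈ Finset.range (n + 1),
    Polynomial.monomial k (PowerSeries.coeff (n - k) f)
  have hp : ∀ k ≤ n, p.coeff k = PowerSeries.coeff (n - k) f := by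
    intro k hk
    rw [Polynomial.finsetSum_coeff, Finset.sum_eq_single k]
    · simp
    · intro j _ hj
      rw [Polynomial.coeff_monomial, if_neg hj]
    · intro h
      exact absurd (Finset.mem_range.mpr (by omega)) h
  have hdeg : p.natDegree ≤ n :=
    Polynomial.natDegree_sum_le_of_forall_le _ _ fun k hk =>
      (Polynomial.natDegree_monomial_le _).trans (by rw [Finset.mem_range] at hk; omega)
  have hmonic : p.Monic :=
    Polynomial.monic_of_natDegree_le_of_coeff_eq_one n hdeg (by rw [hp n le_rfl, Nat.sub_self, hf])
  have hdeg' : p.natDegree = n := by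
    refine le_antisymm hdeg (Polynomial.le_natDegree_of_ne_zero ?_)
    rw [hp n le_rfl, Nat.sub_self, hf]
    exact one_ne_zero
  obtain ⟨S, _, _, _, _, _, hS⟩ := hmonic.exists_splits_map
  obtain ⟨m, hm⟩ := Polynomial.splits_iff_exists_multiset'.mp hS
  have hmonic' := hmonic.map (algebraMap R S)
  rw [hmonic'.leadingCoeff, map_one, one_mul] at hm
  have hcard : Multiset.card m = n := by
    have h := congrArg Polynomial.natDegree hm
    rw [hmonic.natDegree_map, hdeg', Polynomial.natDegree_multiset_prod_of_monic] at h
    · simpa using h.symm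
    · intro q hq
      obtain ⟨a, _, rfl⟩ := Multiset.mem_map.mp hq
      exact Polynomial.monic_X_add_C a
  obtain ⟨ξ, hξ⟩ : ∃ ξ : Fin n → S, Finset.univ.val.map ξ = m := by
    subst hcard
    induction m using Quotient.inductionOn with
    | h l => exact ⟨l.get, (Fin.univ_val_map l.get).trans (congrArg _ (List.ofFn_get l))⟩
  refine ⟨S, inferInstance, algebraMap R S, FaithfulSMul.algebraMap_injective R S, ξ,
    fun k hk => ?_⟩
  rw [coeff_rootSeries, MvPolynomial.aeval_esymm_eq_multiset_esymm, hξ]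
  have h := Multiset.prod_X_add_C_coeff m (k := n - k) (by omega)
  rw [← hm, Polynomial.coeff_map, hp _ (by omega), hcard, Nat.sub_sub_self hk] at h
  exact h

theorem circ_map {S : Type*} [CommRing S] (φ : R →+* S) (f g : PowerSeries R) :
    PowerSeries.map φ (circ f g) = circ (PowerSeries.map φ f) (PowerSeries.map φ g) := by
  ext n
  rw [PowerSeries.coeff_map, circ, circ, PowerSeries.coeff_mk, PowerSeries.coeff_mk, evalP, evalP]
  induction univP n using MvPolynomial.induction_on with
  | C a => simp
  | add p q hp hq => simp only [map_add, hp, hq]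
  | mul_X p i hp =>
    rw [map_mul, map_mul, map_mul, hp]
    congr 1
    rcases i with i | i <;> simp

theorem bigLam_map {S : Type*} [CommRing S] (φ : R →+* S) (r : ℕ) (f : PowerSeries R) :
    PowerSeries.map φ (bigLam r f) = bigLam r (PowerSeries.map φ f) := by
  ext n
  rw [PowerSeries.coeff_map, bigLam, bigLam, PowerSeries.coeff_mk, PowerSeries.coeff_mk, evalPP,
    evalPP]
  induction univPP n r using MvPolynomial.induction_on with
  | C a => simp
  | add p q hp hq => simp only [map_add, hp, hq]
  | mul_X p i hp => simp [hp]

/-- Two power series agree up to order `n`. The coefficients of order at most `n` of the operations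
of `1 + t R[[t]]` depend only on finitely many coefficients, so that roots may be used although a
power series acquires them only up to a given order. -/
def AgreeTo (n : ℕ) (f g : PowerSeries R) : Prop :=
  ∀ k ≤ n, PowerSeries.coeff k f = PowerSeries.coeff k g

namespace AgreeTo

variable {n : ℕ} {f f' g g' : PowerSeries R}

protected theorem refl (n : ℕ) (f : PowerSeries R) : AgreeTo n f f := fun _ _ => rfl

protected theorem mono {k : ℕ} (h : AgreeTo n f g) (hk : k ≤ n) : AgreeTo k f g :=
  fun j hj => h j (hj.trans hk)

protected theorem mul (h : AgreeTo n f f') (h' : AgreeTo n g g') :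
    AgreeTo n (f * g) (f' * g') := by
  intro k hk
  rw [PowerSeries.coeff_mul, PowerSeries.coeff_mul]
  refine Finset.sum_congr rfl fun ij hij => ?_
  rw [Finset.HasAntidiagonal.mem_antidiagonal] at hij
  rw [h _ (by omega), h' _ (by omega)]

protected theorem prod {ι : Type*} {s : Finset ι} {F G : ι → PowerSeries R}
    (h : ∀ i ∈ s, AgreeTo n (F i) (G i)) : AgreeTo n (∏ i ∈ s, F i) (∏ i ∈ s, G i) := by
  classical
  induction s using Finset.induction_on with
  | empty => exact AgreeTo.refl _ _
  | insert i s hi ih =>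
    rw [Finset.prod_insert hi, Finset.prod_insert hi]
    exact (h i (Finset.mem_insert_self i s)).mul (ih fun j hj => h j (Finset.mem_insert_of_mem hj))

protected theorem rescale (c : R) (h : AgreeTo n f f') :
    AgreeTo n (PowerSeries.rescale c f) (PowerSeries.rescale c f') := by
  intro k hk
  rw [PowerSeries.coeff_rescale, PowerSeries.coeff_rescale, h k hk]

protected theorem circ (h : AgreeTo n f f') (h' : AgreeTo n g g') :
    AgreeTo n (circ f g) (circ f' g') := by
  intro k hk
  rw [circ, circ, PowerSeries.coeff_mk, PowerSeries.coeff_mk, evalP, evalP]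
  congr 2
  funext i
  rcases i with i | i
  · exact h _ (by omega)
  · exact h' _ (by omega)

protected theorem bigLam {r : ℕ} (h : AgreeTo (r * n) f f') :
    AgreeTo n (bigLam r f) (bigLam r f') := by
  intro k hk
  rw [bigLam, bigLam, PowerSeries.coeff_mk, PowerSeries.coeff_mk, evalPP, evalPP]
  congr 2
  funext i
  exact h _ (i.2.trans_le (Nat.mul_le_mul_left r hk))

end AgreeTo

theorem exists_agreeTo (f : PowerSeries R) (hf : PowerSeries.coeff 0 f = 1) (n : ℕ) :
    ∃ (S : Type u) (_ : CommRing S) (φ : R →+* S), Function.Injective φ ∧ ∃ ξ : Fin n → S,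
      AgreeTo n (PowerSeries.map φ f) (rootSeries ξ) := by
  obtain ⟨S, _, φ, hφ, ξ, h⟩ := exists_rootSeries f hf n
  exact ⟨S, _, φ, hφ, ξ, fun k hk => by rw [PowerSeries.coeff_map, h k hk]⟩

theorem map_rootSeries {S : Type u} [CommRing S] (φ : R →+* S) {σ : Type*} [Fintype σ]
    (ξ : σ → R) : PowerSeries.map φ (rootSeries ξ) = rootSeries fun i => φ (ξ i) := by
  simp [rootSeries]

theorem rescale_map {S : Type*} [CommRing S] (φ : R →+* S) (c : R) (f : PowerSeries R) :
    PowerSeries.map φ (PowerSeries.rescale c f) =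
      PowerSeries.rescale (φ c) (PowerSeries.map φ f) := by
  ext k
  simp [PowerSeries.coeff_rescale]

protected theorem AgreeTo.map {S : Type*} [CommRing S] (φ : R →+* S) {n : ℕ}
    {f g : PowerSeries R} (h : AgreeTo n f g) :
    AgreeTo n (PowerSeries.map φ f) (PowerSeries.map φ g) := by
  intro k hk
  rw [PowerSeries.coeff_map, PowerSeries.coeff_map, h k hk]

theorem exists_agreeTo₂ (f g : PowerSeries R) (hf : PowerSeries.coeff 0 f = 1)
    (hg : PowerSeries.coeff 0 g = 1) (n : ℕ) :
    ∃ (S : Type u) (_ : CommRing S) (φ : R →+* S), Function.Injective φ ∧ ∃ ξ η : Fin n → S,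
      AgreeTo n (PowerSeries.map φ f) (rootSeries ξ) ∧
      AgreeTo n (PowerSeries.map φ g) (rootSeries η) := by
  obtain ⟨S, _, φ, hφ, ξ, h⟩ := exists_agreeTo f hf n
  obtain ⟨T, _, ψ, hψ, η, h'⟩ := exists_agreeTo (PowerSeries.map φ g)
    (by rw [PowerSeries.coeff_map, hg, map_one]) n
  refine ⟨T, _, ψ.comp φ, hψ.comp hφ, fun i => ψ (ξ i), η, ?_, ?_⟩
  · rw [← map_rootSeries]
    have := h.map ψ
    exact this
  · exact h'

/-- Identities between power series may be checked after an injective change of rings. -/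
theorem coeff_eq_of_map {S : Type*} [CommRing S] (φ : R →+* S) (hφ : Function.Injective φ) {n : ℕ}
    {f g : PowerSeries R} (h : AgreeTo n (PowerSeries.map φ f) (PowerSeries.map φ g)) :
    PowerSeries.coeff n f = PowerSeries.coeff n g := by
  apply hφ
  rw [← PowerSeries.coeff_map, ← PowerSeries.coeff_map, h n le_rfl]

protected theorem AgreeTo.trans {n : ℕ} {f g h : PowerSeries R} (h1 : AgreeTo n f g)
    (h2 : AgreeTo n g h) : AgreeTo n f h := fun k hk => (h1 k hk).trans (h2 k hk)

protected theorem AgreeTo.symm {n : ℕ} {f g : PowerSeries R} (h1 : AgreeTo n f g) :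
    AgreeTo n g f := fun k hk => (h1 k hk).symm

theorem coeff_zero_rootSeries {σ : Type*} [Fintype σ] (ξ : σ → R) :
    PowerSeries.coeff 0 (rootSeries ξ) = 1 := by
  rw [coeff_rootSeries, MvPolynomial.esymm_zero, map_one]

theorem coeff_zero_mul {f g : PowerSeries R} (hf : PowerSeries.coeff 0 f = 1)
    (hg : PowerSeries.coeff 0 g = 1) : PowerSeries.coeff 0 (f * g) = 1 := by
  rw [PowerSeries.coeff_mul]
  simp [hf, hg]

theorem coeff_zero_map {S : Type*} [CommRing S] (φ : R →+* S) {f : PowerSeries R}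
    (hf : PowerSeries.coeff 0 f = 1) : PowerSeries.coeff 0 (PowerSeries.map φ f) = 1 := by
  rw [PowerSeries.coeff_map, hf, map_one]

theorem coeff_zero_rescale (c : R) {f : PowerSeries R}
    (hf : PowerSeries.coeff 0 f = 1) : PowerSeries.coeff 0 (PowerSeries.rescale c f) = 1 := by
  rw [PowerSeries.coeff_rescale, hf, pow_zero, one_mul]

theorem rootSeries_sumElim {σ τ : Type*} [Fintype σ] [Fintype τ] (ξ : σ → R) (η : τ → R) :
    rootSeries (Sum.elim ξ η) = rootSeries ξ * rootSeries η := by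
  simp [rootSeries]

theorem rescale_rootSeries {σ : Type*} [Fintype σ] (c : R) (ξ : σ → R) :
    PowerSeries.rescale c (rootSeries ξ) = rootSeries fun i => c * ξ i := by
  rw [rootSeries, map_prod, rootSeries]
  refine Finset.prod_congr rfl fun i _ => ?_
  rw [map_add, map_one, map_mul, rescale_C, PowerSeries.rescale_X, map_mul]
  ring

theorem rootSeries_one : rootSeries (fun _ : Unit => (1 : R)) = 1 + PowerSeries.X := by
  simp [rootSeries]

theorem rootSeries_empty (ξ : Empty → R) : rootSeries ξ = 1 := by
  simp [rootSeries]

theorem coeff_zero_one_add_X : PowerSeries.coeff 0 (1 + PowerSeries.X : PowerSeries R) = 1 := by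
  simp

end Splitting

section Circ

variable {R : Type u} [CommRing R] {f f' g g' : PowerSeries R}

theorem circ_mul_left (hf : PowerSeries.coeff 0 f = 1) (hf' : PowerSeries.coeff 0 f' = 1)
    (hg : PowerSeries.coeff 0 g = 1) : circ (f * f') g = circ f g * circ f' g := by
  ext n
  obtain ⟨S, _, φ, hφ, ξ, η, h1, h2⟩ := exists_agreeTo₂ f f' hf hf' n
  have hg' := coeff_zero_map φ hg
  refine coeff_eq_of_map φ hφ ?_
  rw [circ_map, map_mul, map_mul, circ_map, circ_map]
  refine ((h1.mul h2).circ (.refl _ _)).trans (.trans ?_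
    ((h1.circ (.refl _ _)).mul (h2.circ (.refl _ _))).symm)
  rw [← rootSeries_sumElim, circ_rootSeries _ _ hg', circ_rootSeries _ _ hg',
    circ_rootSeries _ _ hg', Fintype.prod_sum_type]
  exact .refl _ _

theorem circ_mul_right (hf : PowerSeries.coeff 0 f = 1) (hg : PowerSeries.coeff 0 g = 1)
    (hg' : PowerSeries.coeff 0 g' = 1) : circ f (g * g') = circ f g * circ f g' := by
  ext n
  obtain ⟨S, _, φ, hφ, ξ, h1⟩ := exists_agreeTo f hf n
  refine coeff_eq_of_map φ hφ ?_
  rw [circ_map, map_mul, map_mul, circ_map, circ_map]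
  refine (h1.circ (.refl _ _)).trans (.trans ?_
    ((h1.circ (.refl _ _)).mul (h1.circ (.refl _ _))).symm)
  rw [circ_rootSeries _ _ (coeff_zero_mul (coeff_zero_map φ hg) (coeff_zero_map φ hg')),
    circ_rootSeries _ _ (coeff_zero_map φ hg), circ_rootSeries _ _ (coeff_zero_map φ hg'),
    ← Finset.prod_mul_distrib]
  simp only [map_mul]
  exact .refl _ _

theorem one_add_X_circ (hg : PowerSeries.coeff 0 g = 1) : circ (1 + PowerSeries.X) g = g := by
  rw [← rootSeries_one, circ_rootSeries _ _ hg]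
  simp [PowerSeries.rescale_one]

theorem one_circ (hg : PowerSeries.coeff 0 g = 1) : circ 1 g = 1 := by
  rw [← rootSeries_empty (Empty.elim), circ_rootSeries _ _ hg]
  simp [rootSeries]

theorem circ_one (hf : PowerSeries.coeff 0 f = 1) : circ f 1 = 1 := by
  ext n
  obtain ⟨S, _, φ, hφ, ξ, h1⟩ := exists_agreeTo f hf n
  refine coeff_eq_of_map φ hφ ?_
  rw [circ_map, map_one]
  refine (h1.circ (.refl _ _)).trans ?_
  rw [circ_rootSeries _ _ (by simp)]
  simp only [map_one, Finset.prod_const_one]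
  exact .refl _ _

theorem circ_one_add_X (hf : PowerSeries.coeff 0 f = 1) : circ f (1 + PowerSeries.X) = f := by
  ext n
  obtain ⟨S, _, φ, hφ, ξ, h1⟩ := exists_agreeTo f hf n
  refine coeff_eq_of_map φ hφ ?_
  rw [circ_map, map_add, map_one, PowerSeries.map_X]
  refine (h1.circ (.refl _ _)).trans (.trans ?_ h1.symm)
  rw [circ_rootSeries _ _ coeff_zero_one_add_X, rootSeries]
  simp only [map_add, map_one, PowerSeries.rescale_X]
  exact .refl _ _

theorem circ_rescale_left (c : R) (hf : PowerSeries.coeff 0 f = 1)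
    (hg : PowerSeries.coeff 0 g = 1) :
    circ (PowerSeries.rescale c f) g = PowerSeries.rescale c (circ f g) := by
  ext n
  obtain ⟨S, _, φ, hφ, ξ, h1⟩ := exists_agreeTo f hf n
  have hg' := coeff_zero_map φ hg
  refine coeff_eq_of_map φ hφ ?_
  rw [circ_map, rescale_map, rescale_map, circ_map]
  refine ((h1.rescale _).circ (.refl _ _)).trans (.trans ?_
    ((h1.circ (.refl _ _)).rescale _).symm)
  rw [rescale_rootSeries, circ_rootSeries _ _ hg', circ_rootSeries _ _ hg', map_prod]
  simp only [PowerSeries.rescale_rescale, mul_comm]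
  exact .refl _ _

theorem circ_rescale_right (c : R) (hf : PowerSeries.coeff 0 f = 1)
    (hg : PowerSeries.coeff 0 g = 1) :
    circ f (PowerSeries.rescale c g) = PowerSeries.rescale c (circ f g) := by
  ext n
  obtain ⟨S, _, φ, hφ, ξ, h1⟩ := exists_agreeTo f hf n
  have hg' := coeff_zero_map φ hg
  refine coeff_eq_of_map φ hφ ?_
  rw [circ_map, rescale_map, rescale_map, circ_map]
  refine (h1.circ (.refl _ _)).trans (.trans ?_
    ((h1.circ (.refl _ _)).rescale _).symm)
  rw [circ_rootSeries _ _ (coeff_zero_rescale _ hg'), circ_rootSeries _ _ hg', map_prod]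
  simp only [PowerSeries.rescale_rescale, mul_comm]
  exact .refl _ _

theorem coeff_zero_circ (f g : PowerSeries R) (hf : PowerSeries.coeff 0 f = 1)
    (hg : PowerSeries.coeff 0 g = 1) : PowerSeries.coeff 0 (circ f g) = 1 := by
  obtain ⟨S, _, φ, hφ, ξ, h1⟩ := exists_agreeTo f hf 0
  apply hφ
  rw [← PowerSeries.coeff_map, circ_map, (h1.circ (.refl _ _)) 0 le_rfl,
    circ_rootSeries _ _ (coeff_zero_map φ hg), map_one]
  simp

end Circ

section BigLam

variable {R : Type u} [CommRing R] {f f' : PowerSeries R}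

theorem coeff_zero_bigLam (r : ℕ) (hf : PowerSeries.coeff 0 f = 1) :
    PowerSeries.coeff 0 (bigLam r f) = 1 := by
  obtain ⟨S, _, φ, hφ, ξ, h1⟩ := exists_agreeTo f hf (r * 0)
  apply hφ
  rw [← PowerSeries.coeff_map, bigLam_map, h1.bigLam 0 le_rfl, bigLam_rootSeries,
    coeff_zero_rootSeries, map_one]

theorem bigLam_zero (f : PowerSeries R) (hf : PowerSeries.coeff 0 f = 1) :
    bigLam 0 f = 1 + PowerSeries.X := by
  ext n
  obtain ⟨S, _, φ, hφ, ξ, h1⟩ := exists_agreeTo f hf (0 * n)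
  refine coeff_eq_of_map φ hφ ?_
  rw [bigLam_map]
  refine h1.bigLam.trans ?_
  rw [bigLam_rootSeries, rootSeries, Finset.prod_coe_sort (Finset.powersetCard 0 Finset.univ)
    (fun T => 1 + PowerSeries.C (∏ i ∈ T, ξ i) * PowerSeries.X)]
  simp only [Finset.powersetCard_zero, Finset.prod_singleton, Finset.prod_empty, map_one, one_mul,
    map_add, PowerSeries.map_X]
  exact .refl _ _

theorem bigLam_one (hf : PowerSeries.coeff 0 f = 1) : bigLam 1 f = f := by
  ext n
  obtain ⟨S, _, φ, hφ, ξ, h1⟩ := exists_agreeTo f hf (1 * n)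
  refine coeff_eq_of_map φ hφ ?_
  rw [bigLam_map]
  refine h1.bigLam.trans (.trans ?_ (h1.mono (by omega)).symm)
  rw [bigLam_rootSeries, rootSeries, Finset.prod_coe_sort (Finset.powersetCard 1 Finset.univ)
    (fun T => 1 + PowerSeries.C (∏ i ∈ T, ξ i) * PowerSeries.X), Finset.powersetCard_one,
    Finset.prod_map]
  simp only [Function.Embedding.coeFn_mk, Finset.prod_singleton]
  exact .refl _ _

theorem bigLam_apply_one {r : ℕ} (hr : r ≠ 0) : bigLam r (1 : PowerSeries R) = 1 := by
  rw [← rootSeries_empty (Empty.elim), bigLam_rootSeries, rootSeries_empty, rootSeries,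
    Finset.prod_coe_sort (Finset.powersetCard r (Finset.univ : Finset Empty))
    (fun T => 1 + PowerSeries.C (∏ i ∈ T, (Empty.elim : Empty → R) i) * PowerSeries.X),
    Finset.powersetCard_eq_empty.mpr (by simpa using Nat.pos_of_ne_zero hr), Finset.prod_empty]

theorem bigLam_rescale (r : ℕ) (c : R) (hf : PowerSeries.coeff 0 f = 1) :
    bigLam r (PowerSeries.rescale c f) = PowerSeries.rescale (c ^ r) (bigLam r f) := by
  ext n
  obtain ⟨S, _, φ, hφ, ξ, h1⟩ := exists_agreeTo f hf (r * n)
  refine coeff_eq_of_map φ hφ ?_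
  rw [bigLam_map, rescale_map, rescale_map, bigLam_map]
  refine (h1.rescale _).bigLam.trans (.trans ?_ (h1.bigLam.rescale _).symm)
  rw [rescale_rootSeries, bigLam_rootSeries, bigLam_rootSeries, rescale_rootSeries]
  convert AgreeTo.refl _ _ using 2
  funext T
  rw [Finset.prod_mul_distrib, Finset.prod_const, (Finset.mem_powersetCard.mp T.2).2, map_pow]

/-- A subset of a disjoint union is a pair of subsets. -/
theorem prod_powersetCard_sum {M : Type*} [CommMonoid M] {σ τ : Type*} [Fintype σ] [Fintype τ]
    (r : ℕ) (F : Finset σ → Finset τ → M) :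
    ∏ T ∈ Finset.powersetCard r (Finset.univ : Finset (σ ⊕ τ)), F T.toLeft T.toRight =
      ∏ ij ∈ Finset.HasAntidiagonal.antidiagonal r, ∏ T ∈ Finset.powersetCard ij.1 Finset.univ,
        ∏ T' ∈ Finset.powersetCard ij.2 Finset.univ, F T T' := by
  simp only [← Finset.prod_product']
  rw [Finset.prod_sigma']
  refine Finset.prod_bij' (fun T _ => ⟨(T.toLeft.card, T.toRight.card), (T.toLeft, T.toRight)⟩)
    (fun x _ => x.2.1.disjSum x.2.2) ?_ ?_ ?_ ?_ ?_
  · intro T hT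
    simp only [Finset.mem_powersetCard, Finset.subset_univ, true_and] at hT
    simp [Finset.HasAntidiagonal.mem_antidiagonal, Finset.card_toLeft_add_card_toRight, hT]
  · rintro ⟨⟨i, j⟩, ⟨T, T'⟩⟩ hx
    simp only [Finset.mem_sigma, Finset.HasAntidiagonal.mem_antidiagonal, Finset.mem_product,
      Finset.mem_powersetCard, Finset.subset_univ, true_and] at hx
    simp [hx]
  · intro T _
    exact Finset.toLeft_disjSum_toRight
  · rintro ⟨⟨i, j⟩, ⟨T, T'⟩⟩ hx
    simp only [Finset.mem_sigma, Finset.HasAntidiagonal.mem_antidiagonal, Finset.mem_product,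
      Finset.mem_powersetCard, Finset.subset_univ, true_and] at hx
    obtain ⟨-, rfl, rfl⟩ := hx
    simp
  · intro T _
    rfl

/-- The `λ`-operations of `1 + t R[[t]]` satisfy the addition formula, where the sum is the product
of power series: a set of `r` roots of `f f'` consists of some roots of `f` and some of `f'`. -/
theorem bigLam_mul (r : ℕ) (hf : PowerSeries.coeff 0 f = 1) (hf' : PowerSeries.coeff 0 f' = 1) :
    bigLam r (f * f') = ∏ ij ∈ Finset.HasAntidiagonal.antidiagonal r,
      circ (bigLam ij.1 f) (bigLam ij.2 f') := by
  ext n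
  obtain ⟨S, _, φ, hφ, ξ, η, h1, h2⟩ := exists_agreeTo₂ f f' hf hf' (r * n)
  refine coeff_eq_of_map φ hφ ?_
  rw [bigLam_map, map_mul, map_prod]
  refine (h1.mul h2).bigLam.trans (.trans ?_ (AgreeTo.prod
    (G := fun ij => circ (bigLam ij.1 (rootSeries ξ)) (bigLam ij.2 (rootSeries η)))
    fun ij hij => ?_).symm)
  · rw [← rootSeries_sumElim, bigLam_rootSeries, rootSeries,
      Finset.prod_coe_sort (Finset.powersetCard r (Finset.univ : Finset (Fin (r * n) ⊕ Fin (r * n))))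
      (fun T => 1 + PowerSeries.C (∏ i ∈ T, Sum.elim ξ η i) * PowerSeries.X)]
    convert AgreeTo.refl _ _ using 1
    have h3 : ∀ T : Finset (Fin (r * n) ⊕ Fin (r * n)), ∏ i ∈ T, Sum.elim ξ η i =
        (∏ i ∈ T.toLeft, ξ i) * ∏ i ∈ T.toRight, η i := by
      intro T
      conv_lhs => rw [← Finset.toLeft_disjSum_toRight (u := T)]
      rw [Finset.prod_disjSum]
      simp
    simp only [h3]
    rw [prod_powersetCard_sum r (fun T T' =>
      1 + PowerSeries.C ((∏ i ∈ T, ξ i) * ∏ i ∈ T', η i) * PowerSeries.X)]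
    refine Finset.prod_congr rfl fun ij _ => ?_
    rw [bigLam_rootSeries, bigLam_rootSeries, circ_rootSeries _ _ (coeff_zero_rootSeries _),
      Finset.prod_coe_sort (Finset.powersetCard ij.1 Finset.univ)
        (fun T => PowerSeries.rescale (∏ i ∈ T, ξ i) _)]
    refine Finset.prod_congr rfl fun T _ => ?_
    rw [rescale_rootSeries, rootSeries, Finset.prod_coe_sort (Finset.powersetCard ij.2 Finset.univ)
      (fun T' => 1 + PowerSeries.C ((∏ i ∈ T, ξ i) * ∏ i ∈ T', η i) * PowerSeries.X)]
  · rw [Finset.HasAntidiagonal.mem_antidiagonal] at hij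
    rw [circ_map, bigLam_map, bigLam_map]
    exact (h1.mono (Nat.mul_le_mul_right n (by omega))).bigLam.circ
      (h2.mono (Nat.mul_le_mul_right n (by omega))).bigLam

end BigLam

/-! ### Special `λ`-structures -/

theorem mul_left_cancel_of_coeff_zero {R : Type*} [CommRing R] {f g h : PowerSeries R}
    (hf : PowerSeries.coeff 0 f = 1) (hgh : f * g = f * h) : g = h := by
  have hu : IsUnit f := by
    rw [PowerSeries.isUnit_iff_constantCoeff, ← PowerSeries.coeff_zero_eq_constantCoeff_apply, hf]
    exact isUnit_one
  exact hu.mul_left_cancel hgh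

theorem coeff_zero_prod {R ι : Type*} [CommRing R] {s : Finset ι} {F : ι → PowerSeries R}
    (hF : ∀ i ∈ s, PowerSeries.coeff 0 (F i) = 1) : PowerSeries.coeff 0 (∏ i ∈ s, F i) = 1 := by
  rw [PowerSeries.coeff_zero_eq_constantCoeff_apply, map_prod]
  exact Finset.prod_eq_one fun i hi => by
    rw [← PowerSeries.coeff_zero_eq_constantCoeff_apply, hF i hi]

namespace LambdaStructure

variable {R : Type u} [CommRing R] (L : LambdaStructure R)

theorem coeff_lamT (n : ℕ) (a : R) : PowerSeries.coeff n (L.lamT a) = L.lam n a :=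
  PowerSeries.coeff_mk _ _

theorem coeff_zero_lamT (a : R) : PowerSeries.coeff 0 (L.lamT a) = 1 := by
  rw [coeff_lamT, L.lam_zero]

theorem lamT_zero : L.lamT 0 = 1 := by
  refine mul_left_cancel_of_coeff_zero (L.coeff_zero_lamT 0) ?_
  rw [← L.lamT_add, add_zero, mul_one]

theorem lamT_mul_lamT_neg (a : R) : L.lamT a * L.lamT (-a) = 1 := by
  rw [← L.lamT_add, add_neg_cancel, lamT_zero]

theorem lamT_sum {ι : Type*} (s : Finset ι) (F : ι → R) :
    L.lamT (∑ i ∈ s, F i) = ∏ i ∈ s, L.lamT (F i) := by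
  classical
  induction s using Finset.induction_on with
  | empty => simp [lamT_zero]
  | insert i s hi ih => rw [Finset.sum_insert hi, Finset.prod_insert hi, lamT_add, ih]

/-- Compatibility with products is a consequence of compatibility with `λ^2`, since
`λ^2 (a + b) = λ^2 a + a b + λ^2 b`. -/
theorem lamT_mul_of_lamT_lam_two {a b : R} (ha : L.lamT (L.lam 2 a) = bigLam 2 (L.lamT a))
    (hb : L.lamT (L.lam 2 b) = bigLam 2 (L.lamT b))
    (hab : L.lamT (L.lam 2 (a + b)) = bigLam 2 (L.lamT (a + b))) :
    L.lamT (a * b) = circ (L.lamT a) (L.lamT b) := by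
  have h0a := L.coeff_zero_lamT a
  have h0b := L.coeff_zero_lamT b
  have hanti : Finset.HasAntidiagonal.antidiagonal 2 = {(0, 2), (1, 1), (2, 0)} := rfl
  rw [L.lam_add, L.lamT_add, lamT_sum, bigLam_mul _ h0a h0b, hanti,
    Finset.prod_insert (by simp), Finset.prod_insert (by simp), Finset.prod_singleton,
    Finset.prod_insert (by simp), Finset.prod_insert (by simp), Finset.prod_singleton] at hab
  simp only [L.lam_zero, L.lam_one, one_mul, mul_one] at hab
  rw [bigLam_zero _ h0a, bigLam_zero _ h0b, bigLam_one h0a, bigLam_one h0b,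
    one_add_X_circ (coeff_zero_bigLam 2 h0b), circ_one_add_X (coeff_zero_bigLam 2 h0a), ha,
    hb] at hab
  have hab' := mul_left_cancel_of_coeff_zero (coeff_zero_bigLam 2 h0b) hab
  rw [mul_comm, mul_comm (circ _ _)] at hab'
  exact mul_left_cancel_of_coeff_zero (coeff_zero_bigLam 2 h0a) hab'

variable {L} {G : Set R}

theorem lamT_mul_of_closure (hG : AddSubgroup.closure G = ⊤)
    (h : ∀ a ∈ G, ∀ b ∈ G, L.lamT (a * b) = circ (L.lamT a) (L.lamT b)) (a b : R) :
    L.lamT (a * b) = circ (L.lamT a) (L.lamT b) := by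
  have h0 := L.coeff_zero_lamT
  -- extend first in the left, then in the right variable
  have hl : ∀ b ∈ G, ∀ a, L.lamT (a * b) = circ (L.lamT a) (L.lamT b) := by
    intro b hb a
    have ha : a ∈ AddSubgroup.closure G := hG ▸ AddSubgroup.mem_top a
    induction ha using AddSubgroup.closure_induction with
    | mem a ha => exact h a ha b hb
    | zero => rw [zero_mul, lamT_zero, one_circ (h0 b)]
    | add x y _ _ hx hy =>
      rw [add_mul, lamT_add, lamT_add, circ_mul_left (h0 x) (h0 y) (h0 b), hx, hy]
    | neg x _ hx =>
      refine mul_left_cancel_of_coeff_zero (h0 (x * b)) ?_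
      rw [neg_mul, lamT_mul_lamT_neg, hx, ← circ_mul_left (h0 x) (h0 (-x)) (h0 b),
        lamT_mul_lamT_neg, one_circ (h0 b)]
  have hb : b ∈ AddSubgroup.closure G := hG ▸ AddSubgroup.mem_top b
  induction hb using AddSubgroup.closure_induction with
  | mem b hb => exact hl b hb a
  | zero => rw [mul_zero, lamT_zero, circ_one (h0 a)]
  | add x y _ _ hx hy =>
    rw [mul_add, lamT_add, lamT_add, circ_mul_right (h0 a) (h0 x) (h0 y), hx, hy]
  | neg x _ hx =>
    refine mul_left_cancel_of_coeff_zero (h0 (a * x)) ?_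
    rw [mul_neg, lamT_mul_lamT_neg, hx, ← circ_mul_right (h0 a) (h0 x) (h0 (-x)),
      lamT_mul_lamT_neg, circ_one (h0 a)]

theorem lamT_lam_of_closure (hG : AddSubgroup.closure G = ⊤) (h1 : L.lamT 1 = 1 + PowerSeries.X)
    (hmul : ∀ a b, L.lamT (a * b) = circ (L.lamT a) (L.lamT b))
    (h : ∀ r, ∀ a ∈ G, L.lamT (L.lam r a) = bigLam r (L.lamT a)) (r : ℕ) (a : R) :
    L.lamT (L.lam r a) = bigLam r (L.lamT a) := by
  have h0 := L.coeff_zero_lamT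
  have hzero : ∀ a, L.lamT (L.lam 0 a) = bigLam 0 (L.lamT a) := fun a => by
    rw [L.lam_zero, h1, bigLam_zero _ (h0 a)]
  have hsum : ∀ r a b, L.lamT (L.lam r (a + b)) = ∏ ij ∈ Finset.HasAntidiagonal.antidiagonal r,
      circ (L.lamT (L.lam ij.1 a)) (L.lamT (L.lam ij.2 b)) := by
    intro r a b
    rw [L.lam_add, lamT_sum]
    exact Finset.prod_congr rfl fun ij _ => hmul _ _
  have hz : ∀ r, L.lamT (L.lam r 0) = bigLam r (L.lamT 0) := by
    intro r
    rcases eq_or_ne r 0 with rfl | hr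
    · exact hzero 0
    · rw [lamT_zero, bigLam_apply_one hr, ← coeff_lamT, lamT_zero, PowerSeries.coeff_one, if_neg hr,
        lamT_zero]
  have ha : a ∈ AddSubgroup.closure G := hG ▸ AddSubgroup.mem_top a
  induction ha using AddSubgroup.closure_induction generalizing r with
  | mem a ha => exact h r a ha
  | zero => exact hz r
  | add x y _ _ hx hy =>
    rw [hsum, L.lamT_add, bigLam_mul r (h0 x) (h0 y)]
    exact Finset.prod_congr rfl fun ij _ => by rw [hx, hy]
  | neg x _ hx =>
    -- compare `λ^r (x + (-x))` with `Λ^r` of a product and cancel the terms already known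
    induction r using Nat.strong_induction_on with
    | _ r ih =>
    rcases r with _ | r
    · exact hzero (-x)
    have e1 := hsum (r + 1) x (-x)
    rw [add_neg_cancel, hz, ← add_neg_cancel x, L.lamT_add, bigLam_mul _ (h0 x) (h0 (-x)),
      Finset.Nat.prod_antidiagonal_succ, Finset.Nat.prod_antidiagonal_succ] at e1
    simp only [← hx] at e1
    rw [hzero, bigLam_zero _ (h0 x), one_add_X_circ (coeff_zero_bigLam _ (h0 _)),
      one_add_X_circ (h0 _), mul_comm, mul_comm (L.lamT (L.lam (r + 1) (-x)))] at e1
    have e2 : ∏ p ∈ Finset.HasAntidiagonal.antidiagonal r,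
        circ (L.lamT (L.lam (p.1 + 1) x)) (bigLam p.2 (L.lamT (-x))) =
        ∏ p ∈ Finset.HasAntidiagonal.antidiagonal r,
        circ (L.lamT (L.lam (p.1 + 1) x)) (L.lamT (L.lam p.2 (-x))) := by
      refine Finset.prod_congr rfl fun p hp => ?_
      rw [Finset.HasAntidiagonal.mem_antidiagonal] at hp
      rw [ih p.2 (by omega)]
    rw [e2] at e1
    exact (mul_left_cancel_of_coeff_zero
      (coeff_zero_prod fun p _ => coeff_zero_circ _ _ (h0 _) (h0 _)) e1).symm

/-- A `λ`-structure is special as soon as it is compatible with the `λ`-operations on a set of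
additive generators closed under addition. -/
theorem isSpecial_of_closure (hG : AddSubgroup.closure G = ⊤) (hne : G.Nonempty)
    (hadd : ∀ a ∈ G, ∀ b ∈ G, a + b ∈ G)
    (h : ∀ r, ∀ a ∈ G, L.lamT (L.lam r a) = bigLam r (L.lamT a)) : L.IsSpecial := by
  have h1 : L.lamT 1 = 1 + PowerSeries.X := by
    obtain ⟨a, ha⟩ := hne
    rw [← L.lam_zero a, h 0 a ha, bigLam_zero _ (L.coeff_zero_lamT a)]
  have hmul := lamT_mul_of_closure hG fun a ha b hb =>
    L.lamT_mul_of_lamT_lam_two (h 2 a ha) (h 2 b hb) (h 2 _ (hadd a ha b hb))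
  exact ⟨h1, hmul, lamT_lam_of_closure hG h1 hmul h⟩

/-! ### The opposite structure of a special `λ`-structure -/

variable (L)

theorem oppT_eq (a : R) : L.oppT a = PowerSeries.rescale (-1) (L.lamT (-a)) := by
  refine mul_left_cancel_of_coeff_zero (coeff_zero_rescale (-1) (L.coeff_zero_lamT a)) ?_
  rw [L.oppT_spec, ← map_mul, lamT_mul_lamT_neg, map_one]

theorem opposite_lam (n : ℕ) (a : R) : L.opposite.lam n a = (-1) ^ n * L.lam n (-a) := by
  change PowerSeries.coeff n (L.oppT a) = _
  rw [oppT_eq, PowerSeries.coeff_rescale, coeff_lamT]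

theorem evalP_eq_coeff_circ (n : ℕ) (f g : PowerSeries R) :
    evalP n (fun k => PowerSeries.coeff k f) (fun k => PowerSeries.coeff k g) =
      PowerSeries.coeff n (circ f g) := by
  rw [circ, PowerSeries.coeff_mk]

variable {L}

theorem IsSpecial.evalPP_opposite (hL : L.IsSpecial) (m n : ℕ) (a : R) :
    evalPP m n (fun k => L.opposite.lam k a) =
      PowerSeries.coeff m (PowerSeries.rescale ((-1) ^ n) (L.lamT (L.lam n (-a)))) := by
  rw [hL.map_lam, ← bigLam_rescale _ _ (L.coeff_zero_lamT _), ← oppT_eq, bigLam,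
    PowerSeries.coeff_mk]
  rfl

theorem IsSpecial.opposite_opposite_of_odd (hL : L.IsSpecial) (m : ℕ) {n : ℕ} (hn : Odd n) (a : R) :
    L.opposite.lam m (L.opposite.lam n a) = evalPP m n (fun k => L.opposite.lam k a) := by
  rw [hL.evalPP_opposite, hn.neg_one_pow, opposite_lam L n, hn.neg_one_pow, neg_one_mul,
    PowerSeries.coeff_rescale, coeff_lamT, opposite_lam, neg_neg]

theorem IsSpecial.lam_opposite_of_even (hL : L.IsSpecial) (m : ℕ) {n : ℕ} (hn : Even n) (a : R) :
    L.lam m (L.opposite.lam n a) = evalPP m n (fun k => L.opposite.lam k a) := by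
  rw [hL.evalPP_opposite, hn.neg_one_pow, opposite_lam L n, hn.neg_one_pow, one_mul,
    PowerSeries.coeff_rescale, coeff_lamT, one_pow, one_mul]

theorem IsSpecial.lam_mul_eq_opposite (hL : L.IsSpecial) (n : ℕ) (a b : R) :
    L.lam n (a * b) = evalP n (fun k => L.opposite.lam k a) (fun k => L.opposite.lam k b) := by
  have h0 := L.coeff_zero_lamT
  refine Eq.trans ?_ (evalP_eq_coeff_circ n (L.oppT a) (L.oppT b)).symm
  rw [oppT_eq, oppT_eq, circ_rescale_left _ (h0 _) (coeff_zero_rescale _ (h0 _)),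
    circ_rescale_right _ (h0 _) (h0 _), PowerSeries.rescale_rescale, ← hL.map_mul, neg_mul_neg,
    neg_mul_neg, one_mul, PowerSeries.rescale_one, RingHom.id_apply, coeff_lamT]

theorem IsSpecial.opposite_mul_left (hL : L.IsSpecial) (n : ℕ) (a b : R) :
    L.opposite.lam n (a * b) = evalP n (fun k => L.opposite.lam k a) (fun k => L.lam k b) := by
  have h0 := L.coeff_zero_lamT
  simp only [← L.coeff_lamT]
  refine Eq.trans ?_ (evalP_eq_coeff_circ n (L.oppT a) (L.lamT b)).symm
  rw [oppT_eq, circ_rescale_left _ (h0 _) (h0 _), ← hL.map_mul, neg_mul, ← oppT_eq]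
  rfl

theorem IsSpecial.opposite_mul_right (hL : L.IsSpecial) (n : ℕ) (a b : R) :
    L.opposite.lam n (a * b) = evalP n (fun k => L.lam k a) (fun k => L.opposite.lam k b) := by
  have h0 := L.coeff_zero_lamT
  simp only [← L.coeff_lamT]
  refine Eq.trans ?_ (evalP_eq_coeff_circ n (L.lamT a) (L.oppT b)).symm
  rw [oppT_eq, circ_rescale_right _ (h0 _) (h0 _), ← hL.map_mul, mul_neg, ← oppT_eq]
  rfl

end LambdaStructure

/-! ### Exterior powers of exterior powers -/

section AltAlt

variable (κ : Type w) [Field κ] [CharZero κ] {A : Type u} [Category.{v} A] [Preadditive A]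
  [Linear κ A] [MonoidalCategory A] [SymmetricCategory A] [Limits.HasFiniteBiproducts A]
  [IsIdempotentComplete A] [MonoidalPreadditive A] [MonoidalLinear κ A] {X : A}
  {D : Type} [Fintype D] [DecidableEq D]

theorem pow_mem_schurPairs {i : ℕ} {z : K0 A × MvPolynomial D κ} (hz : z ∈ schurPairs κ X D i)
    (k : ℕ) : z ^ k ∈ schurPairs κ X D (k * i) := by
  induction k with
  | zero =>
    rw [pow_zero, zero_mul]
    exact one_mem_schurPairs κ
  | succ k ih =>
    rw [pow_succ, Nat.succ_mul]
    exact mul_mem_schurPairs κ ih hz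

theorem prod_mem_schurPairs {ι : Type*} (s : Finset ι) {F : ι → K0 A × MvPolynomial D κ}
    {d : ι → ℕ} (h : ∀ i ∈ s, F i ∈ schurPairs κ X D (d i)) :
    ∏ i ∈ s, F i ∈ schurPairs κ X D (∑ i ∈ s, d i) := by
  classical
  induction s using Finset.induction_on with
  | empty => exact one_mem_schurPairs κ
  | insert i s hi ih =>
    rw [Finset.prod_insert hi, Finset.sum_insert hi]
    exact mul_mem_schurPairs κ (h i (Finset.mem_insert_self i s))
      (ih fun j hj => h j (Finset.mem_insert_of_mem hj))

/-- A weighted homogeneous polynomial preserves the relation between classes and symmetric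
polynomials. -/
theorem aeval_mem_schurPairs {n d : ℕ} {P : MvPolynomial (Fin n) ℤ}
    (hP : P.IsWeightedHomogeneous (esymmWeight n) d) {a : ℕ → K0 A × MvPolynomial D κ}
    (ha : ∀ k, a k ∈ schurPairs κ X D k) :
    MvPolynomial.aeval (fun i : Fin n => a (i + 1)) P ∈ schurPairs κ X D d := by
  rw [P.as_sum, map_sum]
  refine sum_mem fun m hm => ?_
  rw [MvPolynomial.aeval_monomial, ← hP (MvPolynomial.mem_support_iff.mp hm), eq_intCast,
    ← zsmul_eq_mul]
  refine zsmul_mem ?_ _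
  rw [Finsupp.weight_apply]
  exact prod_mem_schurPairs κ _ fun i _ => pow_mem_schurPairs κ (ha (i + 1)) (m i)

omit [CharZero κ] in
theorem aeval_univPP_field (m r : ℕ) :
    MvPolynomial.aeval (fun i : Fin (r * m) => MvPolynomial.esymm (Fin (r * m)) κ (i + 1))
      (univPP m r) = plethysmPoly κ m r (Fin (r * m)) := by
  have h := congrArg (MvPolynomial.map (Int.castRingHom κ)) (aeval_univPP m r)
  have h1 : MvPolynomial.map (Int.castRingHom κ) (plethysmPoly ℤ m r (Fin (r * m))) =
      plethysmPoly κ m r (Fin (r * m)) := by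
    simp [plethysmPoly]
  rw [← h1, ← h]
  induction univPP m r using MvPolynomial.induction_on with
  | C a => simp
  | add p q hp hq => simp only [map_add, hp, hq]
  | mul_X p i hp => simp [hp, MvPolynomial.map_esymm]

/-- Both sides belong to the same symmetric polynomial, the plethysm `e_m ∘ e_r`. -/
theorem cls_altPow_altPow (X : A) (m r : ℕ) :
    K0.cls (altPow κ (altPow κ X r) m) = evalPP m r fun k => K0.cls (altPow κ X k) := by
  let a : ℕ → K0 A × MvPolynomial (Fin (r * m)) κ := fun k =>
    (K0.cls (altPow κ X k), MvPolynomial.esymm (Fin (r * m)) κ k)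
  have h := aeval_mem_schurPairs κ (X := X) (a := a) (isWeightedHomogeneous_univPP m r)
    fun k => altPow_mem_schurPairs κ X k
  have h1 : (MvPolynomial.aeval (fun i : Fin (r * m) => a (i + 1)) (univPP m r)).1 =
      evalPP m r fun k => K0.cls (altPow κ X k) := by
    change AlgHom.fst ℤ _ _ _ = _
    rw [← AlgHom.comp_apply, MvPolynomial.comp_aeval]
    rfl
  have h2 : (MvPolynomial.aeval (fun i : Fin (r * m) => a (i + 1)) (univPP m r)).2 =
      plethysmPoly κ m r (Fin (r * m)) := by
    rw [← aeval_univPP_field]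
    change AlgHom.snd ℤ _ _ _ = _
    rw [← AlgHom.comp_apply, MvPolynomial.comp_aeval]
    rfl
  refine eq_of_mem_schurPairs κ (X := X) (D := Fin (r * m)) (N := r * m) (Fintype.card_fin _).ge
    (altPow_altPow_mem_schurPairs κ X m r) ?_
  have h3 := Prod.ext (x := MvPolynomial.aeval (fun i : Fin (r * m) => a (i + 1)) (univPP m r))
    (y := (_, _)) h1 h2
  rw [h3] at h
  exact h

end AltAlt

/-! ### The `λ`-structure on the Grothendieck ring -/

section Structure

variable {A : Type u} [Category.{v} A] [Preadditive A] [Limits.HasFiniteBiproducts A]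
  [MonoidalCategory A] [SymmetricCategory A]

theorem K0.closure_cls : AddSubgroup.closure (Set.range (K0.cls (A := A))) = ⊤ := by
  rw [eq_top_iff]
  rintro z -
  obtain ⟨z, rfl⟩ := Ideal.Quotient.mk_surjective z
  induction z using FreeAbelianGroup.induction_on with
  | zero => rw [map_zero]; exact zero_mem _
  | of s => exact AddSubgroup.subset_closure ⟨s.out, by rw [K0.cls]; congr 2; exact Quotient.out_eq s⟩
  | neg s h => rw [map_neg]; exact neg_mem h
  | add x y hx hy => rw [map_add]; exact add_mem hx hy

variable [IsIdempotentComplete A] [MonoidalPreadditive A]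
variable (κ : Type w) [Field κ] [CharZero κ] [Linear κ A] [MonoidalLinear κ A]

/-- The power series `1 + ∑_{n ≥ 1} [Alt^n X] t^n`. -/
noncomputable def altSeries (X : A) : PowerSeries (K0 A) :=
  PowerSeries.mk fun n => K0.cls (altPow κ X n)

theorem coeff_altSeries (X : A) (n : ℕ) :
    PowerSeries.coeff n (altSeries κ X) = K0.cls (altPow κ X n) := PowerSeries.coeff_mk _ _

theorem coeff_zero_altSeries (X : A) : PowerSeries.coeff 0 (altSeries κ X) = 1 := by
  rw [coeff_altSeries, cls_altPow_zero]

theorem altSeries_mul {X Y Z : A} (a : X ⟶ Z) (a' : Z ⟶ X) (b : Y ⟶ Z)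
    (b' : Z ⟶ Y) (haa : a ≫ a' = 𝟙 X) (hbb : b ≫ b' = 𝟙 Y) (hab : a ≫ b' = 0) (hba : b ≫ a' = 0)
    (hsum : a' ≫ a + b' ≫ b = 𝟙 Z) : altSeries κ Z = altSeries κ X * altSeries κ Y := by
  ext n
  rw [PowerSeries.coeff_mul]
  simp only [coeff_altSeries]
  exact cls_altPow_of_biprod κ a a' b b' haa hbb hab hba hsum n

/-- The series of a zero object is invertible and equal to its square, since `0 = 0 ⊕ 0`. -/
theorem altSeries_of_isZero {Z : A} (hZ : Limits.IsZero Z) : altSeries κ Z = 1 := by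
  refine mul_left_cancel_of_coeff_zero (coeff_zero_altSeries κ Z) ?_
  rw [mul_one, ← altSeries_mul κ (𝟙 Z) (𝟙 Z) (𝟙 Z) (𝟙 Z)] <;> exact hZ.eq_of_src _ _

/-- Isomorphic objects have the same series: `Y` is a direct sum of `X` and zero. -/
theorem altSeries_congr {X Y : A} (e : X ≅ Y) : altSeries κ X = altSeries κ Y := by
  have := Limits.hasZeroObject_of_hasFiniteBiproducts A
  obtain ⟨Z, hZ⟩ := Limits.HasZeroObject.zero (C := A)
  rw [altSeries_mul κ e.inv e.hom (0 : Z ⟶ X) 0 (by simp) (hZ.eq_of_src _ _) (by simp) (by simp)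
    (by simp), altSeries_of_isZero κ hZ, mul_one]

theorem altSeries_biprod (X Y : A) [Limits.HasBinaryBiproduct X Y] :
    altSeries κ (Limits.biprod X Y) = altSeries κ X * altSeries κ Y :=
  altSeries_mul κ Limits.biprod.inl Limits.biprod.fst Limits.biprod.inr Limits.biprod.snd
    (by simp) (by simp) (by simp) (by simp) Limits.biprod.total

theorem isUnit_altSeries (X : A) : IsUnit (altSeries κ X) := by
  rw [PowerSeries.isUnit_iff_constantCoeff, ← PowerSeries.coeff_zero_eq_constantCoeff_apply,
    coeff_zero_altSeries]
  exact isUnit_one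

/-- The additive extension of `altSeries` to the free abelian group on isomorphism classes, with
values in the multiplicative group of power series. -/
noncomputable def altLift : FreeAbelianGroup (Skeleton A) →+ Additive (PowerSeries (K0 A))ˣ :=
  FreeAbelianGroup.lift fun s => Additive.ofMul (isUnit_altSeries κ (s.out : A)).unit

theorem altLift_toSkeleton (X : A) : altLift κ (FreeAbelianGroup.of (toSkeleton X)) =
    Additive.ofMul (isUnit_altSeries κ X).unit := by
  rw [altLift, FreeAbelianGroup.lift_apply_of]
  congr 1
  refine Units.ext ?_
  obtain ⟨e⟩ : Nonempty ((toSkeleton X).out ≅ X) := Quotient.mk_out (s := isIsomorphicSetoid A) X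
  exact altSeries_congr κ e

/-- The additive extension of `altSeries` to the Grothendieck ring. -/
noncomputable def altHom : K0 A →+ Additive (PowerSeries (K0 A))ˣ :=
  QuotientAddGroup.lift (Ideal.span (K0.relators A)).toAddSubgroup (altLift κ) (by
    have := Limits.hasBinaryBiproducts_of_finite_biproducts A
    rw [K0.span_relators, AddSubgroup.closure_le]
    rintro _ ⟨X, Y, rfl⟩
    change altLift κ _ = 0
    rw [map_sub, map_sub, altLift_toSkeleton, altLift_toSkeleton, altLift_toSkeleton, sub_sub,
      sub_eq_zero, ← ofMul_mul]
    congr 1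
    exact Units.ext (altSeries_biprod κ X Y))

/-- The value of `λ_t` at a class in the Grothendieck ring. -/
noncomputable def altT (a : K0 A) : PowerSeries (K0 A) := ((altHom κ a).toMul : _)

theorem altT_cls (X : A) : altT κ (K0.cls X) = altSeries κ X := by
  have h : altHom κ (K0.cls X) = Additive.ofMul (isUnit_altSeries κ X).unit :=
    altLift_toSkeleton κ X
  rw [altT, h]
  rfl

theorem altT_add (a b : K0 A) : altT κ (a + b) = altT κ a * altT κ b := by
  rw [altT, map_add]
  rfl

theorem altT_zero : altT κ (0 : K0 A) = 1 := by
  rw [altT, map_zero]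
  rfl

theorem coeff_altT (a : K0 A) :
    PowerSeries.coeff 0 (altT κ a) = 1 ∧ PowerSeries.coeff 1 (altT κ a) = a := by
  have hmul : ∀ f g : PowerSeries (K0 A), PowerSeries.coeff 1 (f * g) =
      PowerSeries.coeff 0 f * PowerSeries.coeff 1 g + PowerSeries.coeff 1 f *
        PowerSeries.coeff 0 g := by
    intro f g
    rw [PowerSeries.coeff_mul, Finset.Nat.sum_antidiagonal_succ]
    simp
  have hmul0 : ∀ f g : PowerSeries (K0 A), PowerSeries.coeff 0 (f * g) =
      PowerSeries.coeff 0 f * PowerSeries.coeff 0 g := by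
    intro f g
    rw [PowerSeries.coeff_mul]
    simp
  have ha : a ∈ AddSubgroup.closure (Set.range (K0.cls (A := A))) :=
    (K0.closure_cls (A := A)).ge (AddSubgroup.mem_top a)
  induction ha using AddSubgroup.closure_induction with
  | mem a ha =>
    obtain ⟨X, rfl⟩ : ∃ X : A, K0.cls X = a := ha
    rw [altT_cls, coeff_altSeries, coeff_altSeries, cls_altPow_zero, cls_altPow_one]
    exact ⟨rfl, rfl⟩
  | zero =>
    rw [altT_zero]
    simp [PowerSeries.coeff_one]
  | add x y _ _ hx hy =>
    rw [altT_add, hmul, hmul0, hx.1, hx.2, hy.1, hy.2]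
    exact ⟨one_mul 1, by ring⟩
  | neg x _ hx =>
    have h0 := congrArg (PowerSeries.coeff 0) (altT_add κ x (-x))
    have h1 := congrArg (PowerSeries.coeff 1) (altT_add κ x (-x))
    rw [add_neg_cancel, altT_zero, hmul0, hx.1, one_mul, PowerSeries.coeff_zero_one] at h0
    rw [add_neg_cancel, altT_zero, hmul, hx.1, hx.2, ← h0, one_mul, mul_one, PowerSeries.coeff_one,
      if_neg one_ne_zero] at h1
    exact ⟨h0.symm, by linear_combination -h1⟩

/-- The `λ`-structure on the Grothendieck ring given by the exterior powers. -/
noncomputable def K0.lambda : LambdaStructure (K0 A) where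
  lam r a := PowerSeries.coeff r (altT κ a)
  lam_zero a := (coeff_altT κ a).1
  lam_one a := (coeff_altT κ a).2
  lam_add r a b := by rw [altT_add, PowerSeries.coeff_mul]

theorem K0.lambda_cls (n : ℕ) (X : A) : (K0.lambda κ).lam n (K0.cls X) = K0.cls (altPow κ X n) := by
  change PowerSeries.coeff n (altT κ (K0.cls X)) = _
  rw [altT_cls, coeff_altSeries]

theorem K0.lambda_unique (L L' : LambdaStructure (K0 A))
    (h : ∀ (n : ℕ) (X : A), L'.lam n (K0.cls X) = L.lam n (K0.cls X)) : L' = L := by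
  have h1 : ∀ a, L'.lamT a = L.lamT a := by
    intro a
    have ha : a ∈ AddSubgroup.closure (Set.range (K0.cls (A := A))) :=
      (K0.closure_cls (A := A)).ge (AddSubgroup.mem_top a)
    induction ha using AddSubgroup.closure_induction with
    | mem a ha =>
      obtain ⟨X, rfl⟩ : ∃ X : A, K0.cls X = a := ha
      ext n
      rw [LambdaStructure.coeff_lamT, LambdaStructure.coeff_lamT, h]
    | zero => rw [LambdaStructure.lamT_zero, LambdaStructure.lamT_zero]
    | add x y _ _ hx hy => rw [L'.lamT_add, L.lamT_add, hx, hy]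
    | neg x _ hx =>
      refine mul_left_cancel_of_coeff_zero (L.coeff_zero_lamT x) ?_
      rw [L.lamT_mul_lamT_neg, ← hx, L'.lamT_mul_lamT_neg]
  ext n a
  rw [← LambdaStructure.coeff_lamT, h1, LambdaStructure.coeff_lamT]

theorem K0.lambda_isSpecial : (K0.lambda κ : LambdaStructure (K0 A)).IsSpecial := by
  have := Limits.hasBinaryBiproducts_of_finite_biproducts A
  refine LambdaStructure.isSpecial_of_closure K0.closure_cls ⟨_, 𝟙_ A, rfl⟩ ?_ ?_
  · rintro _ ⟨X, rfl⟩ _ ⟨Y, rfl⟩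
    exact ⟨Limits.biprod X Y, K0.cls_biprod X Y⟩
  · rintro r _ ⟨X, rfl⟩
    ext m
    rw [K0.lambda_cls, LambdaStructure.coeff_lamT, K0.lambda_cls, cls_altPow_altPow, bigLam,
      PowerSeries.coeff_mk]
    simp only [LambdaStructure.coeff_lamT, K0.lambda_cls]

theorem cls_symPow_zero (X : A) : K0.cls (symPow κ X 0) = 1 := by
  rw [← cls_altPow_zero κ X, symPow, altPow]
  simp only [show (1 : Perm (Fin 0) →* ℤˣ) = Perm.sign from
    MonoidHom.ext fun σ => by rw [Subsingleton.elim σ 1, map_one, map_one]]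

theorem K0.opposite_lambda_cls (n : ℕ) (X : A) :
    (K0.lambda κ).opposite.lam n (K0.cls X) = K0.cls (symPow κ X n) := by
  have h : (K0.lambda κ).oppT (K0.cls X) = PowerSeries.mk fun n => K0.cls (symPow κ X n) := by
    refine mul_left_cancel_of_coeff_zero
      (coeff_zero_rescale (-1) ((K0.lambda κ).coeff_zero_lamT (K0.cls X))) ?_
    rw [LambdaStructure.oppT_spec]
    ext n
    rw [PowerSeries.coeff_mul]
    simp only [PowerSeries.coeff_rescale, LambdaStructure.coeff_lamT, K0.lambda_cls,
      PowerSeries.coeff_mk, PowerSeries.coeff_one]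
    split_ifs with hn
    · subst hn
      simp [cls_altPow_zero, cls_symPow_zero]
    · exact (sum_cls_altPow_mul_cls_symPow κ X hn).symm
  change PowerSeries.coeff n ((K0.lambda κ).oppT (K0.cls X)) = _
  rw [h, PowerSeries.coeff_mk]

end Structure

end LambdaK0

theorem mainTheorem3 (κ : Type w) [Field κ] [CharZero κ]
    (A : Type u) [Category.{v} A] [Preadditive A] [Linear κ A] [Limits.HasFiniteBiproducts A]
    [IsIdempotentComplete A] [MonoidalCategory A] [SymmetricCategory A] [MonoidalPreadditive A]
    [MonoidalLinear κ A] :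
    ∃ L : LambdaStructure (K0 A),
      -- `L` is the unique `λ`-structure induced by the exterior powers
      (∀ (n : ℕ) (X : A), L.lam n (K0.cls X) = K0.cls (altPow κ X n)) ∧
      (∀ L' : LambdaStructure (K0 A),
        (∀ (n : ℕ) (X : A), L'.lam n (K0.cls X) = K0.cls (altPow κ X n)) → L' = L) ∧
      -- it is special
      L.IsSpecial ∧
      -- its opposite structure is given by the symmetric powers
      (∀ (n : ℕ) (X : A), L.opposite.lam n (K0.cls X) = K0.cls (symPow κ X n)) ∧
      -- identities relating symmetric and exterior powers
      (∀ (m n : ℕ) (X : A), Odd n →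
        L.opposite.lam m (L.opposite.lam n (K0.cls X)) =
          evalPP m n (fun k => L.opposite.lam k (K0.cls X))) ∧
      (∀ (m n : ℕ) (X : A), Even n →
        L.lam m (L.opposite.lam n (K0.cls X)) =
          evalPP m n (fun k => L.opposite.lam k (K0.cls X))) ∧
      (∀ (n : ℕ) (X Y : A), L.lam n (K0.cls X * K0.cls Y) =
        evalP n (fun k => L.opposite.lam k (K0.cls X)) (fun k => L.opposite.lam k (K0.cls Y))) ∧
      (∀ (n : ℕ) (X Y : A), L.opposite.lam n (K0.cls X * K0.cls Y) =
        evalP n (fun k => L.opposite.lam k (K0.cls X)) (fun k => L.lam k (K0.cls Y))) ∧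
      (∀ (n : ℕ) (X Y : A), L.opposite.lam n (K0.cls X * K0.cls Y) =
        evalP n (fun k => L.lam k (K0.cls X)) (fun k => L.opposite.lam k (K0.cls Y))) := by
  have hL := K0.lambda_isSpecial (A := A) κ
  refine ⟨K0.lambda κ, K0.lambda_cls κ, fun L' h => ?_, hL, K0.opposite_lambda_cls κ,
    fun m n X hn => hL.opposite_opposite_of_odd m hn _,
    fun m n X hn => hL.lam_opposite_of_even m hn _, fun n X Y => hL.lam_mul_eq_opposite n _ _,
    fun n X Y => hL.opposite_mul_left n _ _, fun n X Y => hL.opposite_mul_right n _ _⟩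
  exact K0.lambda_unique _ _ fun n X => (h n X).trans (K0.lambda_cls κ n X).symm
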